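/- **Conventions.** Let $S$ be a locally compact Hausdorff space with countable base and $\mathcal M(S)$ the space of finite signed Borel measures on $S$. Let $X$ be a (time-homogeneous, possibly killed) Markov process in $S$ having, with respect to a $\sigma$-finite reference measure $m$, jointly measurable transition densities $p_t(x,y)\in[0,\infty]$, $t>0$, with $p_{s+t}(x,z)=\int p_s(x,y)p_t(y,z)\,dm(y)$ for all $s,t>0$, $x,z\in S$. Its potential density is $u(x,y)=\int_0^\infty p_t(x,y)\,dt\in[0,\infty]$. Norms may take the value $\infty$. For a linear space $\mathcal V\subseteq\mathcal M(S)$, a *proper norm for $\mathcal V$ with respect to $u$* is a function $\|\cdot\|:\mathcal V\to[0,\infty]$ which is absolutely homogeneous, subadditive, vanishes only at $\nu=0$, and for which there is $C<\infty$ such that for all $n\ge2$ and $\nu_1,\dots,\nu_n\in\mathcal V$ $$\Big|\int\prod_{j=1}^n u(x_j,x_{j+1})\prod_{j=1}^n d\nu_j(x_j)\Big|\le C^n\prod_{j=1}^n\|\nu_j\|,\qquad x_{n+1}=x_1,$$ whenever the integral converges absolutely; moreover the integral is required to converge absolutely whenever each $\nu_j$ is a difference of two positive measures in $\mathcal V$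 of finite norm. If the requirement that $\|\nu\|=0$ only for $\nu=0$ is dropped, we speak of a *proper seminorm*. **Theorem 6.1.** **1.** Let $S=\mathbb R^d$, $m$ Lebesgue measure, and let $X$ be a Lévy process killed at an independent exponential time of mean $1/\beta$, $0<\beta<\infty$, with transition densities $p_t(x,y)=p_t(y-x)$ as above, so that $u(x,y)=u(y-x)$. Put $\hat u(\xi)=\int e^{i\langle z,\xi\rangle}u(z)\,dz$, $\hat\nu(\xi)=\int e^{i\langle z,\xi\rangle}d\nu(z)$ and $\gamma=|\hat u|*|\hat u|$ (with values in $[0,\infty]$). Then $$\|\nu\|_{\gamma,2}:=\Big(\int|\hat\nu(x)|^2\gamma(x)\,dx\Big)^{1/2}$$ is a proper norm for $\mathcal M(\mathbb R^d)$ with respect to $u$. If $\hat u$ is integrable, then for all $\nu\in\mathcal M(\mathbb R^d)$ it is finite and $$\|\nu\|_{\gamma,2}=\Big(\iint\Big(\int e^{i\langle x-y,q\rangle}|\hat u(q)|\,dq\Big)^2d\nu(x)\,d\nu(y)\Big)^{1/2}.$$ **1a.** In the situation of 1, assume also that the characteristic exponent $\kappa$ of $X$ ($E e^{i\langle\lambda,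 X_t\rangle}=e^{-t\kappa(\lambda)}$, the expectation being over the event that $X$ is alive at time $t$) satisfies $|\operatorname{Im}\kappa(x)|\le C\operatorname{Re}\kappa(x)$ for all $x\in\mathbb R^d$, for some constant $C<1$. Let $\mathcal M_{\gamma,2}$ be the space of differences of positive measures $\nu$ with $\|\nu\|_{\gamma,2}<\infty$. Then for $\nu\in\mathcal M_{\gamma,2}$ the integral $\iint u(x,y)u(y,x)\,d\nu(x)\,d\nu(y)$ converges absolutely and is nonnegative, and $$\|\nu\|_{[2]}:=\Big(\iint u(x,y)u(y,x)\,d\nu(x)\,d\nu(y)\Big)^{1/2}$$ is a proper norm for $\mathcal M_{\gamma,2}$ with respect to $u$. **2.** For general $S$ and $X$, let $w(x,y)=\int_0^\infty\frac{p_s(x,y)}{\sqrt{\pi s}}\,ds$ and $$\|\nu\|_w:=\Big(\iint\Big(\int w(x,y)w(y,z)\,d\nu(y)\Big)^2dm(x)\,dm(z)\Big)^{1/2},$$ where $|\int w(x,y)w(y,z)\,d\nu(y)|$ is given the value $\infty$ when the integral does not converge absolutely. Then $\|\cdot\|_w$ is a proper seminorm for $\mathcal M(S)$ with respect to $u$.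 **3.** For general $S$ and $X$, let $\Phi=\Theta_l\Theta_r$ with $$\Theta_l(x,y)=\int_0^\infty\!\!\int p_{s/2}(x,v)p_{s/2}(y,v)\,dm(v)\,ds,\qquad \Theta_r(x,y)=\int_0^\infty\!\!\int p_{s/2}(v,x)p_{s/2}(v,y)\,dm(v)\,ds,$$ and $$\|\nu\|_\Phi:=\Big(\iint\Phi(x,y)\,d\nu(x)\,d\nu(y)\Big)^{1/2},$$ with the value $\infty$ when the double integral does not converge absolutely. The double integral is nonnegative whenever it converges absolutely, and $\|\cdot\|_\Phi$ is a proper seminorm for $\mathcal M(S)$ with respect to $u$. If, in 2 and 3, $X$ has right continuous paths and there is a right continuous Markov process $\widehat X$ in $S$ in duality with $X$, that is, with transition densities $\hat p_t(x,y)=p_t(y,x)$ with respect to $m$, then $\|\cdot\|_w$ and $\|\cdot\|_\Phi$ are proper norms for $\mathcal M(S)$ with respect to $u$. -/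

import Mathlib

open MeasureTheory ProbabilityTheory Set Filter Topology
open scoped ENNReal NNReal

noncomputable section

namespace ProperNorms

/-! ### Integration against signed measures -/

section Integration

variable {S : Type*} [MeasurableSpace S]

/-- The positive part of the Jordan decomposition of `ν`. -/
def pos (ν : SignedMeasure S) : Measure S := ν.toJordanDecomposition.posPart

/-- The negative part of the Jordan decomposition of `ν`. -/
def neg (ν : SignedMeasure S) : Measure S := ν.toJordanDecomposition.negPart

/-- `∫ f dν = ∫ f dν⁺ - ∫ f dν⁻`. -/
def sint {F : Type*} [NormedAddCommGroup F] [NormedSpace ℝ F]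
    (ν : SignedMeasure S) (f : S → F) : F :=
  (∫ x, f x ∂(pos ν)) - ∫ x, f x ∂(neg ν)

/-- `|∫ f dν|` for `f ≥ 0`, with the value `∞` when the integral does not converge absolutely. -/
def absInt (ν : SignedMeasure S) (f : S → ℝ≥0∞) : ℝ≥0∞ :=
  open Classical in
  if ∫⁻ x, f x ∂ν.totalVariation = ∞ then ∞
  else ENNReal.ofReal |sint ν fun x => (f x).toReal|

/-- Absolute convergence of `∫∫ K(x,y) dν(x) dν(y)`. -/
def FormConverges (K : S → S → ℝ≥0∞) (ν : SignedMeasure S) : Prop :=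
  ∫⁻ x, ∫⁻ y, K x y ∂ν.totalVariation ∂ν.totalVariation < ∞

/-- `∫∫ K(x,y) dν(x) dν(y)`; meaningful when `FormConverges K ν`. -/
def quadForm (K : S → S → ℝ≥0∞) (ν : SignedMeasure S) : ℝ :=
  sint ν fun x => sint ν fun y => (K x y).toReal

/-- `(∫∫ K(x,y) dν(x) dν(y))^{1/2}`, with the value `∞` when the double integral does not
converge absolutely. -/
def quadNorm (K : S → S → ℝ≥0∞) (ν : SignedMeasure S) : ℝ≥0∞ :=
  open Classical in
  if FormConverges K ν then ENNReal.ofReal (Real.sqrt (quadForm K ν)) else ∞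

/-- The product `∏ⱼ u(xⱼ, xⱼ₊₁)` over `n` points, with `xₙ₊₁ = x₁`. -/
def cyclicProd (u : S → S → ℝ≥0∞) {n : ℕ} (x : Fin n → S) : ℝ≥0∞ :=
  ∏ j, u (x j) (x (finRotate n j))

/-- Absolute convergence of `∫ ∏ⱼ u(xⱼ, xⱼ₊₁) ∏ⱼ dνⱼ(xⱼ)`. -/
def CyclicConverges (u : S → S → ℝ≥0∞) {n : ℕ} (ν : Fin n → SignedMeasure S) : Prop :=
  ∫⁻ x, cyclicProd u x ∂(Measure.pi fun j => (ν j).totalVariation) < ∞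

/-- `∫ ∏ⱼ u(xⱼ, xⱼ₊₁) ∏ⱼ dνⱼ(xⱼ)`: the product of the signed measures `νⱼ = νⱼ⁺ - νⱼ⁻` is
expanded by multilinearity. Meaningful when `CyclicConverges u ν`. -/
def cyclicInt (u : S → S → ℝ≥0∞) {n : ℕ} (ν : Fin n → SignedMeasure S) : ℝ :=
  ∑ ε : Fin n → Bool, (∏ j, if ε j then (1 : ℝ) else -1) *
    (∫⁻ x, cyclicProd u x
      ∂(Measure.pi fun j => if ε j then pos (ν j) else neg (ν j))).toReal

/-! ### Proper norms -/

/-- The measures `ν₁ - ν₂` with `ν₁, ν₂ ∈ V` positive and of finite norm. -/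
def finitePart (V : Set (SignedMeasure S)) (N : SignedMeasure S → ℝ≥0∞) :
    Set (SignedMeasure S) :=
  {ν | ∃ ν₁ ∈ V, ∃ ν₂ ∈ V, 0 ≤ ν₁ ∧ 0 ≤ ν₂ ∧ N ν₁ < ∞ ∧ N ν₂ < ∞ ∧ ν = ν₁ - ν₂}

/-- All the properties of a proper norm for the family `V` of finite signed measures with respect
to the kernel `u`, except that only nonzero measures have positive norm. Norms may take the
value `∞`. -/
structure IsProperSeminorm (V : Set (SignedMeasure S)) (u : S → S → ℝ≥0∞)
    (N : SignedMeasure S → ℝ≥0∞) : Prop where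
  smul : ∀ c : ℝ, ∀ ν ∈ V, N (c • ν) = ENNReal.ofReal |c| * N ν
  add_le : ∀ ν ∈ V, ∀ ν' ∈ V, N (ν + ν') ≤ N ν + N ν'
  /-- On differences of positive measures of finite norm the integrals converge absolutely. -/
  converges : ∀ n : ℕ, 2 ≤ n → ∀ ν : Fin n → SignedMeasure S,
    (∀ j, ν j ∈ finitePart V N) → CyclicConverges u ν
  bound : ∃ C : ℝ≥0, ∀ n : ℕ, 2 ≤ n → ∀ ν : Fin n → SignedMeasure S, (∀ j, ν j ∈ V) →
    CyclicConverges u ν → ENNReal.ofReal |cyclicInt u ν| ≤ (C : ℝ≥0∞) ^ n * ∏ j, N (ν j)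

/-- `N` is a proper norm for the family `V` with respect to the kernel `u`. -/
structure IsProperNorm (V : Set (SignedMeasure S)) (u : S → S → ℝ≥0∞)
    (N : SignedMeasure S → ℝ≥0∞) : Prop extends IsProperSeminorm V u N where
  eq_zero : ∀ ν ∈ V, N ν = 0 → ν = 0

/-! ### Transition densities and the kernels built from them -/

/-- `p_t(x,y)`, `t > 0`, are (jointly measurable) transition densities with respect to `m` for the
transition function `T t x A` (the probability to be in `A` at time `t`, when started at `x`). -/
structure IsTransitionDensity (T : ℝ≥0 → S → Set S → ℝ≥0∞) (m : Measure S)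
    (p : ℝ → S → S → ℝ≥0∞) : Prop where
  measurable : Measurable fun a : ℝ × S × S => p a.1 a.2.1 a.2.2
  density : ∀ t : ℝ≥0, 0 < t → ∀ x : S, ∀ A : Set S, MeasurableSet A →
    T t x A = ∫⁻ y in A, p t x y ∂m
  chapman_kolmogorov : ∀ s t : ℝ, 0 < s → 0 < t → ∀ x z : S,
    p (s + t) x z = ∫⁻ y, p s x y * p t y z ∂m

/-- The potential density `u(x,y) = ∫₀^∞ p_t(x,y) dt`. -/
def potential (p : ℝ → S → S → ℝ≥0∞) (x y : S) : ℝ≥0∞ :=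
  ∫⁻ t in Ioi (0 : ℝ), p t x y

/-- `w(x,y) = ∫₀^∞ p_s(x,y) / √(π s) ds`. -/
def rootKernel (p : ℝ → S → S → ℝ≥0∞) (x y : S) : ℝ≥0∞ :=
  ∫⁻ s in Ioi (0 : ℝ), p s x y / ENNReal.ofReal (Real.sqrt (Real.pi * s))

/-- `‖ν‖_w`, the `L²(m × m)` norm of `(x,z) ↦ ∫ w(x,y) w(y,z) dν(y)`. -/
def wNorm (m : Measure S) (p : ℝ → S → S → ℝ≥0∞) (ν : SignedMeasure S) : ℝ≥0∞ :=
  (∫⁻ x, ∫⁻ z, absInt ν (fun y => rootKernel p x y * rootKernel p y z) ^ 2 ∂m ∂m) ^ (1 / 2 : ℝ)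

/-- `Θ_l(x,y) = ∫₀^∞ ∫ p_{s/2}(x,v) p_{s/2}(y,v) dm(v) ds`. -/
def thetaL (m : Measure S) (p : ℝ → S → S → ℝ≥0∞) (x y : S) : ℝ≥0∞ :=
  ∫⁻ s in Ioi (0 : ℝ), ∫⁻ v, p (s / 2) x v * p (s / 2) y v ∂m

/-- `Θ_r(x,y) = ∫₀^∞ ∫ p_{s/2}(v,x) p_{s/2}(v,y) dm(v) ds`. -/
def thetaR (m : Measure S) (p : ℝ → S → S → ℝ≥0∞) (x y : S) : ℝ≥0∞ :=
  ∫⁻ s in Ioi (0 : ℝ), ∫⁻ v, p (s / 2) v x * p (s / 2) v y ∂m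

/-- `Φ = Θ_l Θ_r`. -/
def phi (m : Measure S) (p : ℝ → S → S → ℝ≥0∞) (x y : S) : ℝ≥0∞ :=
  thetaL m p x y * thetaR m p x y

/-- `‖ν‖_Φ = (∫∫ Φ(x,y) dν(x) dν(y))^{1/2}`. -/
def phiNorm (m : Measure S) (p : ℝ → S → S → ℝ≥0∞) (ν : SignedMeasure S) : ℝ≥0∞ :=
  quadNorm (phi m p) ν

end Integration

/-! ### Markov processes -/

/-- The event that `Z` is (alive and) in `A`; the point `∞` of `OnePoint S` is the cemetery. -/
def inEvent {S Ω : Type*} (Z : Ω → OnePoint S) (A : Set S) : Set Ω :=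
  {ω | ∃ y ∈ A, Z ω = (y : OnePoint S)}

/-- A time-homogeneous Markov process `(Ω, ℱ_t, X_t, P^x)` with state space `S`, killed at its
lifetime, after which it stays in the cemetery. -/
structure MarkovProcess (S Ω : Type*) [MeasurableSpace S] [mΩ : MeasurableSpace Ω] where
  law : S → Measure Ω
  isProb : ∀ x, IsProbabilityMeasure (law x)
  filt : Filtration ℝ≥0 mΩ
  path : ℝ≥0 → Ω → OnePoint S
  adapted : ∀ t : ℝ≥0, ∀ A : Set S, MeasurableSet A → MeasurableSet[filt t] (inEvent (path t) A)
  start : ∀ x : S, ∀ᵐ ω ∂law x, path 0 ω = (x : OnePoint S)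
  absorbing : ∀ (s t : ℝ≥0) (ω : Ω), s ≤ t → path s ω = OnePoint.infty → path t ω = OnePoint.infty
  measurable_law : ∀ t : ℝ≥0, ∀ A : Set S, MeasurableSet A →
    Measurable fun x => law x (inEvent (path t) A)
  /-- `P^x(B, X_{s+t} ∈ A) = E^x(B; P^{X_s}(X_t ∈ A))` for `B ∈ ℱ_s`. -/
  markov : ∀ (x : S) (s t : ℝ≥0), ∀ A : Set S, MeasurableSet A → ∀ B : Set Ω, MeasurableSet[filt s] B →
    law x (B ∩ inEvent (path (s + t)) A) =
      ∫⁻ ω in B, (path s ω).elim 0 (fun y => law y (inEvent (path t) A)) ∂law x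

namespace MarkovProcess

variable {S Ω : Type*} [MeasurableSpace S] [MeasurableSpace Ω]

/-- The transition function `P_t(x,A) = P^x(X_t ∈ A)`. -/
def trans (X : MarkovProcess S Ω) (t : ℝ≥0) (x : S) (A : Set S) : ℝ≥0∞ :=
  X.law x (inEvent (X.path t) A)

/-- Almost surely the paths are right continuous. -/
def RightContinuous [TopologicalSpace S] (X : MarkovProcess S Ω) : Prop :=
  ∀ x, ∀ᵐ ω ∂X.law x, ∀ t, ContinuousWithinAt (fun s => X.path s ω) (Ici t) t

end MarkovProcess

/-! ### Exponentially killed Lévy processes and Fourier transforms -/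

section Levy

variable {Ω : Type*} [MeasurableSpace Ω] {d : ℕ}

/-- A Lévy process in `ℝ^d` started at `0` (a right continuous version is not required: continuity
in probability suffices). -/
structure IsLevy (Y : ℝ≥0 → Ω → EuclideanSpace ℝ (Fin d)) (P : Measure Ω) : Prop where
  measurable : ∀ t, Measurable (Y t)
  zero : ∀ᵐ ω ∂P, Y 0 ω = 0
  indep : HasIndepIncrements Y P
  stationary : ∀ s t, P.map (fun ω => Y (s + t) ω - Y s ω) = P.map (Y t)
  continuous : ∀ t, TendstoInMeasure P Y (𝓝 t) (Y t)

/-- `Y` is a Lévy process, and `ζ` an independent exponential time with mean `1/β`. The process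
`Y`, killed at time `ζ`, is the exponentially killed Lévy process. -/
structure IsKilledLevy (Y : ℝ≥0 → Ω → EuclideanSpace ℝ (Fin d)) (ζ : Ω → ℝ) (β : ℝ)
    (P : Measure Ω) : Prop where
  levy : IsLevy Y P
  measurable : Measurable ζ
  rate_pos : 0 < β
  law : P.map ζ = expMeasure β
  indep : IndepFun ζ (fun ω t => Y t ω) P

/-- The transition function of `Y` killed at `ζ`: `P(t < ζ, x + Y_t ∈ A)`. -/
def killedTrans (Y : ℝ≥0 → Ω → EuclideanSpace ℝ (Fin d)) (ζ : Ω → ℝ) (P : Measure Ω)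
    (t : ℝ≥0) (x : EuclideanSpace ℝ (Fin d)) (A : Set (EuclideanSpace ℝ (Fin d))) : ℝ≥0∞ :=
  P {ω | (t : ℝ) < ζ ω ∧ x + Y t ω ∈ A}

/-- `κ` is the characteristic exponent of `Y` killed at `ζ`: `E(e^{iξX_t}) = e^{-tκ(ξ)}`, where the
expectation is over `{t < ζ}`. -/
def IsCharExponent (Y : ℝ≥0 → Ω → EuclideanSpace ℝ (Fin d)) (ζ : Ω → ℝ) (P : Measure Ω)
    (κ : EuclideanSpace ℝ (Fin d) → ℂ) : Prop :=
  ∀ (t : ℝ≥0) (ξ : EuclideanSpace ℝ (Fin d)),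
    ∫ ω in {ω | (t : ℝ) < ζ ω}, Complex.exp (Complex.I * (inner ℝ ξ (Y t ω) : ℝ)) ∂P
      = Complex.exp (-(t : ℝ) * κ ξ)

/-- `û(ξ) = ∫ e^{i⟨z,ξ⟩} u(z) dz`. -/
def fourierFun (u : EuclideanSpace ℝ (Fin d) → ℝ≥0∞) (ξ : EuclideanSpace ℝ (Fin d)) : ℂ :=
  ∫ z, Complex.exp (Complex.I * (inner ℝ z ξ : ℝ)) * ((u z).toReal : ℂ)

/-- `ν̂(ξ) = ∫ e^{i⟨z,ξ⟩} dν(z)`. -/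
def fourierMeas (ν : SignedMeasure (EuclideanSpace ℝ (Fin d))) (ξ : EuclideanSpace ℝ (Fin d)) :
    ℂ :=
  sint ν fun z => Complex.exp (Complex.I * (inner ℝ z ξ : ℝ))

/-- `γ = |û| * |û|`. -/
def gam (uhat : EuclideanSpace ℝ (Fin d) → ℂ) (x : EuclideanSpace ℝ (Fin d)) : ℝ≥0∞ :=
  ∫⁻ y, ‖uhat (x - y)‖ₑ * ‖uhat y‖ₑ

/-- `‖ν‖_{γ,2} = (∫ |ν̂(x)|² γ(x) dx)^{1/2}`. -/
def gammaNorm (uhat : EuclideanSpace ℝ (Fin d) → ℂ)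
    (ν : SignedMeasure (EuclideanSpace ℝ (Fin d))) : ℝ≥0∞ :=
  (∫⁻ x, ‖fourierMeas ν x‖ₑ ^ 2 * gam uhat x) ^ (1 / 2 : ℝ)

end Levy

/-- `‖ν‖_{[2]} = (∫∫ u(x,y) u(y,x) dν(x) dν(y))^{1/2}`. -/
def sectNorm {S : Type*} [MeasurableSpace S] (u : S → S → ℝ≥0∞) (ν : SignedMeasure S) : ℝ≥0∞ :=
  quadNorm (fun x y => u x y * u y x) ν

end ProperNorms

end

open ProperNorms

/-! One mechanism carries all four norms. In suitable variables a cyclic integral is the trace of a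
product of square-integrable kernels, one for each measure, and such a trace is at most the product
of the L² norms of the kernels as soon as there are two of them (`lintegral_ring_le`). This is where
the shape C^n ∏‖νⱼ‖ and the restriction n ≥ 2 come from.

General state spaces. Suppose that u(x,y) = ∫ a(x,h) b(y,h) dμ(h). Inserting this in every factor
and integrating out the points xⱼ first leaves a cycle in the variables hⱼ, whose edges are the
kernels ∫ b(x,h) a(x,h') dνⱼ(x) (`lintegral_cyclicProd`). The L² norm of the absolute value of this
kernel, `mixedNorm`, therefore bounds the cyclic integrals with C = 1, and so does every larger norm
(`isProperSeminorm_of_mixedNorm_le`). For ‖·‖_w take a(x,h) = w(x,h) and b(y,h) = w(h,y): the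
convolution square of 1/√(πs) is 1, so that w composed with itself is u. For ‖·‖_Φ split p_s at its
midpoint, h = (s,v). There the square of the mixed norm unfolds to ∫∫ Φ dν dν whenever this
converges absolutely, which also shows that the form is nonnegative.

Definiteness. If the norm vanishes, then for almost every h the measures b(·,h)ν⁺ and b(·,h)ν⁻ have
the same potentials. Right continuity of X makes a measure recoverable from its potentials
(`measure_eq_of_lintegral_density_eq`), so the two coincide; being mutually singular, they are zero.
By right continuity of the dual process ∫ b(x,h) dμ(h) > 0 for every x, hence |ν| = 0. For ‖·‖_w the
densities ∫ p_t(y,z) dμ(y) must first be extracted from ∫ w(y,z) dμ(y), by the first passage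
identity of the stable subordinator of index 1/2 (`ae_lintegral_density_eq`).

Lévy processes. Formally, Parseval's identity turns (2π)^{dn} times the cyclic integral into ∫ ∏
û(λⱼ) ∏ ν̂ⱼ(λⱼ - λⱼ₋₁) dλ. This is again a cycle, and distributing |û|^{1/2} over its edges gives
the norm ‖·‖_{γ,2} (`lintegral_enorm_cycleSymbol_le`). To justify the identity, shift the edges by
wⱼ. The shifted cyclic integral is an integrable function of w with the right Fourier transform, but
inversion yields its values for almost all w only. Averaging over w with the weights q_δ(wⱼ)
replaces u by q_δ * u = ∫_δ^∞ q_t dt, which increases to u as δ decreases to 0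
(`IsSmoothing.sum_lintegral_cyclicProd`). Since û has no zeros, γ is positive and the norm is
definite. Finally û = 1/κ, and the sector condition makes Re(û(a)û(b)) comparable to |û(a)û(b)|, so
that the cyclic form with n = 2 is a norm equivalent to ‖·‖_{γ,2}
(`IsSmoothing.isProperNorm_sectNorm`). -/

namespace ProperNorms

/-! ### Jordan decompositions, and |∫ f dν| as a difference of integrals in [0,∞] -/

section SignedMeasures

variable {S : Type*} [MeasurableSpace S]

instance pos.instIsFiniteMeasure (ν : SignedMeasure S) : IsFiniteMeasure (pos ν) :=
  ν.toJordanDecomposition.posPart_finite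

instance neg.instIsFiniteMeasure (ν : SignedMeasure S) : IsFiniteMeasure (neg ν) :=
  ν.toJordanDecomposition.negPart_finite

theorem totalVariation_eq (ν : SignedMeasure S) : ν.totalVariation = pos ν + neg ν := rfl

theorem eq_pos_sub_neg (ν : SignedMeasure S) :
    ν = (pos ν).toSignedMeasure - (neg ν).toSignedMeasure :=
  (SignedMeasure.toSignedMeasure_toJordanDecomposition ν).symm

/-- The identity ν⁺ - ν⁻ = μ₁ - μ₂ with the subtractions moved across, so that it can be integrated
in [0,∞]. -/
theorem pos_add_eq_neg_add {ν : SignedMeasure S} {μ₁ μ₂ : Measure S} [IsFiniteMeasure μ₁]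
    [IsFiniteMeasure μ₂] (h : ν = μ₁.toSignedMeasure - μ₂.toSignedMeasure) :
    pos ν + μ₂ = neg ν + μ₁ := by
  ext A hA
  have h1 := congrArg (fun ρ : SignedMeasure S => ρ A) h
  have h2 := congrArg (fun ρ : SignedMeasure S => ρ A) (eq_pos_sub_neg ν)
  simp only [Measure.toSignedMeasure_sub_apply hA] at h1 h2
  rw [h1] at h2
  have : (pos ν + μ₂).real A = (neg ν + μ₁).real A := by
    rw [measureReal_add_apply, measureReal_add_apply]; linarith
  exact (measureReal_eq_measureReal_iff).1 this

theorem pos_le_left {ν : SignedMeasure S} {μ₁ μ₂ : Measure S} [IsFiniteMeasure μ₁]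
    [IsFiniteMeasure μ₂] (h : ν = μ₁.toSignedMeasure - μ₂.toSignedMeasure) : pos ν ≤ μ₁ := by
  have : pos ν = μ₁ - μ₂ := by
    rw [pos, h, Measure.toJordanDecomposition_toSignedMeasure_sub]; rfl
  rw [this]; exact Measure.sub_le

theorem neg_le_right {ν : SignedMeasure S} {μ₁ μ₂ : Measure S} [IsFiniteMeasure μ₁]
    [IsFiniteMeasure μ₂] (h : ν = μ₁.toSignedMeasure - μ₂.toSignedMeasure) : neg ν ≤ μ₂ := by
  have : neg ν = μ₂ - μ₁ := by
    rw [neg, h, Measure.toJordanDecomposition_toSignedMeasure_sub]; rfl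
  rw [this]; exact Measure.sub_le

theorem totalVariation_le {ν : SignedMeasure S} {μ₁ μ₂ : Measure S} [IsFiniteMeasure μ₁]
    [IsFiniteMeasure μ₂] (h : ν = μ₁.toSignedMeasure - μ₂.toSignedMeasure) :
    ν.totalVariation ≤ μ₁ + μ₂ :=
  add_le_add (pos_le_left h) (neg_le_right h)

theorem add_eq_pos_sub_neg (ν ν' : SignedMeasure S) :
    ν + ν' = (pos ν + pos ν').toSignedMeasure - (neg ν + neg ν').toSignedMeasure := by
  conv_lhs => rw [eq_pos_sub_neg ν, eq_pos_sub_neg ν']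
  rw [Measure.toSignedMeasure_add, Measure.toSignedMeasure_add]
  abel

theorem totalVariation_add_le (ν ν' : SignedMeasure S) :
    (ν + ν').totalVariation ≤ ν.totalVariation + ν'.totalVariation := by
  refine (totalVariation_le (add_eq_pos_sub_neg ν ν')).trans_eq ?_
  rw [totalVariation_eq, totalVariation_eq]
  abel

theorem neg_eq_zero_of_nonneg {ν : SignedMeasure S} (h : 0 ≤ ν) : neg ν = 0 := by
  have h' : 0 ≤[Set.univ] ν := by simpa using h
  have : ν = (ν.toMeasureOfZeroLE Set.univ MeasurableSet.univ h').toSignedMeasure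
      - (0 : Measure S).toSignedMeasure := by
    rw [SignedMeasure.toMeasureOfZeroLE_toSignedMeasure, Measure.toSignedMeasure_zero, sub_zero]
  exact le_antisymm (neg_le_right this) (Measure.zero_le _)

theorem totalVariation_of_nonneg {ν : SignedMeasure S} (h : 0 ≤ ν) :
    ν.totalVariation = pos ν := by
  rw [totalVariation_eq, neg_eq_zero_of_nonneg h, add_zero]

/-- Dominates a difference of positive measures of finite norm by a single positive measure, whose
norm is finite by subadditivity. -/
theorem totalVariation_sub_le {ν₁ ν₂ : SignedMeasure S} (h₁ : 0 ≤ ν₁) (h₂ : 0 ≤ ν₂) :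
    (ν₁ - ν₂).totalVariation ≤ (ν₁ + ν₂).totalVariation := by
  have e₁ : ν₁ = (pos ν₁).toSignedMeasure := by
    conv_lhs => rw [eq_pos_sub_neg ν₁]
    simp [neg_eq_zero_of_nonneg h₁]
  have e₂ : ν₂ = (pos ν₂).toSignedMeasure := by
    conv_lhs => rw [eq_pos_sub_neg ν₂]
    simp [neg_eq_zero_of_nonneg h₂]
  have h : ν₁ - ν₂ = (pos ν₁).toSignedMeasure - (pos ν₂).toSignedMeasure := by
    rw [← e₁, ← e₂]
  refine (totalVariation_le h).trans ?_
  have h3 : ν₁ + ν₂ = (pos ν₁ + pos ν₂).toSignedMeasure - (0 : Measure S).toSignedMeasure := by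
    rw [Measure.toSignedMeasure_add, ← e₁, ← e₂, Measure.toSignedMeasure_zero, sub_zero]
  have h4 := pos_add_eq_neg_add h3
  rw [neg_eq_zero_of_nonneg (add_nonneg h₁ h₂), add_zero, zero_add] at h4
  rw [totalVariation_of_nonneg (add_nonneg h₁ h₂), h4]

theorem pos_smul_of_nonneg {c : ℝ} (hc : 0 ≤ c) (ν : SignedMeasure S) :
    pos (c • ν) = c.toNNReal • pos ν ∧ neg (c • ν) = c.toNNReal • neg ν := by
  simp only [pos, neg, SignedMeasure.toJordanDecomposition_smul_real]
  exact ⟨JordanDecomposition.real_smul_posPart_nonneg _ _ hc,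
    JordanDecomposition.real_smul_negPart_nonneg _ _ hc⟩

theorem pos_smul_of_neg {c : ℝ} (hc : c < 0) (ν : SignedMeasure S) :
    pos (c • ν) = (-c).toNNReal • neg ν ∧ neg (c • ν) = (-c).toNNReal • pos ν := by
  simp only [pos, neg, SignedMeasure.toJordanDecomposition_smul_real]
  exact ⟨JordanDecomposition.real_smul_posPart_neg ν.toJordanDecomposition _ hc,
    JordanDecomposition.real_smul_negPart_neg ν.toJordanDecomposition _ hc⟩

theorem eq_zero_of_totalVariation_eq_zero {ν : SignedMeasure S} (h : ν.totalVariation = 0) :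
    ν = 0 := by
  ext A hA
  exact ν.null_of_totalVariation_zero (by simp [h])

theorem eq_zero_of_pos_eq_neg {ν : SignedMeasure S} (h : pos ν = neg ν) : ν = 0 := by
  rw [eq_pos_sub_neg ν]
  have : (pos ν).toSignedMeasure = (neg ν).toSignedMeasure := by
    ext A hA; simp [hA, h]
  rw [this, sub_self]

theorem pos_mutuallySingular_neg (ν : SignedMeasure S) : (pos ν).MutuallySingular (neg ν) :=
  ν.toJordanDecomposition.mutuallySingular

theorem pos_le_totalVariation (ν : SignedMeasure S) : pos ν ≤ ν.totalVariation :=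
  Measure.le_add_right le_rfl

theorem neg_le_totalVariation (ν : SignedMeasure S) : neg ν ≤ ν.totalVariation :=
  Measure.le_add_left le_rfl

theorem pos_of_zero : pos (0 : SignedMeasure S) = 0 := by
  rw [pos, SignedMeasure.toJordanDecomposition_zero]; rfl

theorem neg_of_zero : neg (0 : SignedMeasure S) = 0 := by
  rw [neg, SignedMeasure.toJordanDecomposition_zero]; rfl

/-- `|a - b|`, with the value `∞` when `a` or `b` is infinite. -/
noncomputable def gap (a b : ℝ≥0∞) : ℝ≥0∞ :=
  open Classical in if a + b = ∞ then ∞ else ENNReal.ofReal |a.toReal - b.toReal|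

theorem gap_of_ne_top {a b : ℝ≥0∞} (ha : a ≠ ∞) (hb : b ≠ ∞) :
    gap a b = ENNReal.ofReal |a.toReal - b.toReal| := by
  simp [gap, ha, hb]

theorem gap_comm (a b : ℝ≥0∞) : gap a b = gap b a := by
  rw [gap, gap, add_comm, abs_sub_comm]

theorem gap_zero_right (a : ℝ≥0∞) : gap a 0 = a := by
  by_cases h : a = ∞
  · simp [gap, h]
  · simp [gap, h]

theorem gap_eq_zero {a b : ℝ≥0∞} (h : gap a b = 0) : a ≠ ∞ ∧ a = b := by
  by_cases h' : a + b = ∞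
  · simp [gap, h'] at h
  · have ha : a ≠ ∞ := fun e => h' (by simp [e])
    have hb : b ≠ ∞ := fun e => h' (by simp [e])
    rw [gap_of_ne_top ha hb, ENNReal.ofReal_eq_zero, abs_nonpos_iff, sub_eq_zero] at h
    exact ⟨ha, (ENNReal.toReal_eq_toReal_iff' ha hb).1 h⟩

theorem measurable_gap : Measurable fun x : ℝ≥0∞ × ℝ≥0∞ => gap x.1 x.2 := by
  unfold gap
  refine Measurable.ite (measurableSet_eq_fun (by fun_prop) (by fun_prop)) (by fun_prop) ?_
  exact ENNReal.measurable_ofReal.comp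
    ((measurable_fst.ennreal_toReal.sub measurable_snd.ennreal_toReal).abs)

theorem gap_smul {c : ℝ≥0∞} (hc : c ≠ ∞) (hc0 : c ≠ 0) (a b : ℝ≥0∞) :
    gap (c * a) (c * b) = c * gap a b := by
  by_cases h : a + b = ∞
  · have : c * a + c * b = ∞ := by rw [← mul_add, h, ENNReal.mul_top hc0]
    simp [gap, h, this, ENNReal.mul_top hc0]
  · have ha : a ≠ ∞ := fun e => h (by simp [e])
    have hb : b ≠ ∞ := fun e => h (by simp [e])
    rw [gap_of_ne_top ha hb, gap_of_ne_top (ENNReal.mul_ne_top hc ha) (ENNReal.mul_ne_top hc hb),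
      ENNReal.toReal_mul, ENNReal.toReal_mul, ← mul_sub, abs_mul,
      ENNReal.ofReal_mul (abs_nonneg _), abs_of_nonneg ENNReal.toReal_nonneg,
      ENNReal.ofReal_toReal hc]

/-- Meant for integrals with respect to ν + ν', whose Jordan parts are smaller than the sums of the
parts of ν and ν' because of cancellation. The additive identity carries the inequality; the two
bounds only guarantee that `A` and `B` are finite. -/
theorem gap_triangle {A B a a' b b' : ℝ≥0∞} (h : A + (b + b') = B + (a + a')) (hA : A ≤ a + a')
    (hB : B ≤ b + b') : gap A B ≤ gap a b + gap a' b' := by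
  by_cases h1 : a + b = ∞
  · simp [gap, h1]
  by_cases h2 : a' + b' = ∞
  · simp [gap, h2]
  simp only [ENNReal.add_eq_top, not_or] at h1 h2
  have hA' : A ≠ ∞ := ne_top_of_le_ne_top (by simp [h1, h2]) hA
  have hB' : B ≠ ∞ := ne_top_of_le_ne_top (by simp [h1, h2]) hB
  rw [gap_of_ne_top hA' hB', gap_of_ne_top h1.1 h1.2, gap_of_ne_top h2.1 h2.2,
    ← ENNReal.ofReal_add (abs_nonneg _) (abs_nonneg _)]
  refine ENNReal.ofReal_le_ofReal ?_
  have h3 := congrArg ENNReal.toReal h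
  rw [ENNReal.toReal_add hA' (by simp [h1, h2]), ENNReal.toReal_add h1.2 h2.2,
    ENNReal.toReal_add hB' (by simp [h1, h2]), ENNReal.toReal_add h1.1 h2.1] at h3
  have : A.toReal - B.toReal = (a.toReal - b.toReal) + (a'.toReal - b'.toReal) := by linarith
  rw [this]; exact abs_add_le _ _

theorem absInt_eq_gap (ν : SignedMeasure S) {f : S → ℝ≥0∞} (hf : Measurable f) :
    absInt ν f = gap (∫⁻ x, f x ∂(pos ν)) (∫⁻ x, f x ∂(neg ν)) := by
  have e : ∫⁻ x, f x ∂ν.totalVariation = ∫⁻ x, f x ∂(pos ν) + ∫⁻ x, f x ∂(neg ν) := by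
    rw [totalVariation_eq, lintegral_add_measure]
  unfold absInt gap
  rw [e]
  split_ifs with h
  · rfl
  · simp only [ENNReal.add_eq_top, not_or] at h
    rw [sint, integral_toReal hf.aemeasurable (ae_lt_top hf h.1),
      integral_toReal hf.aemeasurable (ae_lt_top hf h.2)]

theorem absInt_add_le (ν ν' : SignedMeasure S) {f : S → ℝ≥0∞} (hf : Measurable f) :
    absInt (ν + ν') f ≤ absInt ν f + absInt ν' f := by
  rw [absInt_eq_gap _ hf, absInt_eq_gap _ hf, absInt_eq_gap _ hf]
  have h := add_eq_pos_sub_neg ν ν'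
  refine gap_triangle ?_ ?_ ?_
  · have := congrArg (fun ρ : Measure S => ∫⁻ x, f x ∂ρ) (pos_add_eq_neg_add h)
    simpa only [lintegral_add_measure] using this
  · rw [← lintegral_add_measure]; exact lintegral_mono' (pos_le_left h) le_rfl
  · rw [← lintegral_add_measure]; exact lintegral_mono' (neg_le_right h) le_rfl

theorem absInt_zero {f : S → ℝ≥0∞} : absInt 0 f = 0 := by
  simp [absInt, SignedMeasure.totalVariation_zero, sint, pos_of_zero, neg_of_zero]

theorem absInt_smul {c : ℝ} (hc : c ≠ 0) (ν : SignedMeasure S) {f : S → ℝ≥0∞} (hf : Measurable f) :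
    absInt (c • ν) f = ENNReal.ofReal |c| * absInt ν f := by
  rw [absInt_eq_gap _ hf, absInt_eq_gap _ hf]
  rcases hc.lt_or_gt with h | h
  · rw [(pos_smul_of_neg h ν).1, (pos_smul_of_neg h ν).2, lintegral_smul_measure,
      lintegral_smul_measure, gap_comm, abs_of_neg h, ENNReal.ofReal]
    exact gap_smul ENNReal.coe_ne_top (by simpa using h) _ _
  · rw [(pos_smul_of_nonneg h.le ν).1, (pos_smul_of_nonneg h.le ν).2, lintegral_smul_measure,
      lintegral_smul_measure, abs_of_pos h, ENNReal.ofReal]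
    exact gap_smul ENNReal.coe_ne_top (by simpa using h) _ _

theorem absInt_of_nonneg {ν : SignedMeasure S} (h : 0 ≤ ν) {f : S → ℝ≥0∞} (hf : Measurable f) :
    absInt ν f = ∫⁻ x, f x ∂ν.totalVariation := by
  rw [absInt_eq_gap _ hf, totalVariation_of_nonneg h, neg_eq_zero_of_nonneg h,
    lintegral_zero_measure, gap_zero_right]

end SignedMeasures

end ProperNorms

namespace ProperNorms

/-! ### Integrals over finite products of measures -/

section ProductMeasures

theorem lintegral_pi_succ {n : ℕ} {H : Type*} [MeasurableSpace H] (μ : Fin (n + 1) → Measure H)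
    [∀ j, SigmaFinite (μ j)] {g : H × (Fin n → H) → ℝ≥0∞} (hg : Measurable g) :
    ∫⁻ z, g (z (Fin.last n), fun i => z i.castSucc) ∂Measure.pi μ =
      ∫⁻ z, ∫⁻ t, g (t, z) ∂μ (Fin.last n) ∂Measure.pi fun i : Fin n => μ i.castSucc := by
  have h := (measurePreserving_piFinSuccAbove μ (Fin.last n)).lintegral_comp hg
  simp only [Fin.succAbove_last] at h
  rw [← lintegral_prod_symm g hg.aemeasurable, ← h]
  refine lintegral_congr fun z => ?_
  simp only [MeasurableEquiv.piFinSuccAbove, Fin.insertNthEquiv_last, MeasurableEquiv.coe_mk]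
  rfl

theorem lintegral_pi_prod {n : ℕ} {H : Type*} [MeasurableSpace H] (μ : Fin n → Measure H)
    [∀ j, SigmaFinite (μ j)] {f : Fin n → H → ℝ≥0∞} (hf : ∀ j, Measurable (f j)) :
    ∫⁻ z, ∏ j, f j (z j) ∂Measure.pi μ = ∏ j, ∫⁻ x, f j x ∂μ j := by
  induction n with
  | zero => simp
  | succ n ih =>
    have h := lintegral_pi_succ μ
      (g := fun p => (∏ j : Fin n, f j.castSucc (p.2 j)) * f (Fin.last n) p.1)
      (by fun_prop)
    simp only [Fin.prod_univ_castSucc]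
    rw [h, ← ih (fun i => μ i.castSucc) fun j => hf j.castSucc]
    rw [← lintegral_mul_const _ (by fun_prop)]
    exact lintegral_congr fun z =>
      lintegral_const_mul (∏ j : Fin n, f j.castSucc (z j)) (hf (Fin.last n))

/-- Tonelli's theorem allows the measures to be enlarged one coordinate at a time. -/
theorem lintegral_pi_mono {n : ℕ} {H : Type*} [MeasurableSpace H] {μ ρ : Fin n → Measure H}
    [∀ j, SigmaFinite (μ j)] [∀ j, SigmaFinite (ρ j)] (h : ∀ j, μ j ≤ ρ j)
    {g : (Fin n → H) → ℝ≥0∞} (hg : Measurable g) :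
    ∫⁻ z, g z ∂Measure.pi μ ≤ ∫⁻ z, g z ∂Measure.pi ρ := by
  induction n with
  | zero => rw [Measure.pi_of_empty μ, Measure.pi_of_empty ρ]
  | succ n ih =>
    let e := MeasurableEquiv.piFinSuccAbove (fun _ : Fin (n + 1) => H) (Fin.last n)
    have hg' : Measurable fun p : H × (Fin n → H) => g (e.symm p) := hg.comp e.symm.measurable
    have key : ∀ z : Fin (n + 1) → H, g z = g (e.symm (z (Fin.last n), fun i => z i.castSucc)) := by
      intro z
      congr 1
      rw [MeasurableEquiv.eq_symm_apply]
      simp only [e, MeasurableEquiv.piFinSuccAbove, Fin.insertNthEquiv_last, MeasurableEquiv.coe_mk]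
      rfl
    rw [lintegral_congr key, lintegral_congr key, lintegral_pi_succ μ hg', lintegral_pi_succ ρ hg']
    refine (lintegral_mono fun z => lintegral_mono' (h _) le_rfl).trans ?_
    exact ih (fun j => h _) (Measurable.lintegral_prod_left' hg')

end ProductMeasures

/-! ### The trace inequality for cycles of square-integrable kernels -/

section Ring

variable {H : Type*} [MeasurableSpace H] {μ : Measure H} [SigmaFinite μ]

/-- The `L²(μ × μ)` norm of a kernel. -/
noncomputable def kernelNorm (μ : Measure H) (F : H × H → ℝ≥0∞) : ℝ≥0∞ :=
  (∫⁻ p, F p ^ 2 ∂μ.prod μ) ^ (1 / 2 : ℝ)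

theorem lintegral_mul_le_sqrt {X : Type*} [MeasurableSpace X] (ρ : Measure X) {f g : X → ℝ≥0∞}
    (hf : AEMeasurable f ρ) (hg : AEMeasurable g ρ) :
    ∫⁻ x, f x * g x ∂ρ ≤
      (∫⁻ x, f x ^ 2 ∂ρ) ^ (1 / 2 : ℝ) * (∫⁻ x, g x ^ 2 ∂ρ) ^ (1 / 2 : ℝ) := by
  have h := ENNReal.lintegral_mul_le_Lp_mul_Lq ρ Real.HolderConjugate.two_two hf hg
  simpa using h

theorem rpow_half_sq (a : ℝ≥0∞) : (a ^ (1 / 2 : ℝ)) ^ 2 = a := by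
  rw [← ENNReal.rpow_natCast, ← ENNReal.rpow_mul]; simp

theorem sq_rpow_half (a : ℝ≥0∞) : (a ^ 2) ^ (1 / 2 : ℝ) = a := by
  rw [← ENNReal.rpow_natCast, ← ENNReal.rpow_mul]; simp

/-- Submultiplicativity of the Hilbert–Schmidt norm: after Cauchy–Schwarz in the middle variable the
integral over the two ends factors. -/
theorem kernelNorm_comp_le {F G : H × H → ℝ≥0∞} (hF : Measurable F) (hG : Measurable G) :
    kernelNorm μ (fun p => ∫⁻ t, F (p.1, t) * G (t, p.2) ∂μ) ≤ kernelNorm μ F * kernelNorm μ G := by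
  unfold kernelNorm
  rw [← ENNReal.mul_rpow_of_nonneg _ _ (by norm_num)]
  refine ENNReal.rpow_le_rpow ?_ (by norm_num)
  calc ∫⁻ p, (∫⁻ t, F (p.1, t) * G (t, p.2) ∂μ) ^ 2 ∂μ.prod μ
      ≤ ∫⁻ p, (∫⁻ t, F (p.1, t) ^ 2 ∂μ) * (∫⁻ t, G (t, p.2) ^ 2 ∂μ) ∂μ.prod μ := by
        refine lintegral_mono fun p => ?_
        have := lintegral_mul_le_sqrt μ (f := fun t => F (p.1, t)) (g := fun t => G (t, p.2))
          (by fun_prop) (by fun_prop)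
        refine (pow_le_pow_left' this 2).trans_eq ?_
        rw [mul_pow, rpow_half_sq, rpow_half_sq]
    _ = _ := by
        rw [lintegral_prod_mul (f := fun x => ∫⁻ t, F (x, t) ^ 2 ∂μ)
          (g := fun y => ∫⁻ t, G (t, y) ^ 2 ∂μ)
          (Measurable.lintegral_prod_right' (f := fun p : H × H => F p ^ 2) (by fun_prop)).aemeasurable
          (Measurable.lintegral_prod_left' (f := fun p : H × H => G p ^ 2) (by fun_prop)).aemeasurable,
          lintegral_prod (fun p => F p ^ 2) (by fun_prop),
          lintegral_prod_symm (fun p => G p ^ 2) (by fun_prop)]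

/-- Integrating out the last vertex composes the two kernels that meet there, which shortens the
cycle by one edge. The closing kernel `G` is arbitrary because the composition becomes the new
closing kernel. With two edges left the claim is Cauchy–Schwarz. -/
theorem lintegral_chain_le (n : ℕ) {F : Fin (n + 1) → H × H → ℝ≥0∞} (hF : ∀ j, Measurable (F j))
    {G : H × H → ℝ≥0∞} (hG : Measurable G) :
    ∫⁻ z : Fin (n + 2) → H, (∏ j : Fin (n + 1), F j (z j.castSucc, z j.succ)) *
      G (z (Fin.last _), z 0) ∂Measure.pi (fun _ => μ) ≤
      (∏ j, kernelNorm μ (F j)) * kernelNorm μ G := by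
  induction n generalizing G with
  | zero =>
    have h := (measurePreserving_finTwoArrow (α := H) μ).lintegral_comp
      (f := fun p => F 0 (p.1, p.2) * G (p.2, p.1)) (by fun_prop)
    have e : ∀ z : Fin 2 → H, (∏ j : Fin 1, F j (z j.castSucc, z j.succ)) *
      G (z (Fin.last _), z 0) = F 0 ((MeasurableEquiv.finTwoArrow z).1,
        (MeasurableEquiv.finTwoArrow z).2) * G ((MeasurableEquiv.finTwoArrow z).2,
        (MeasurableEquiv.finTwoArrow z).1) := by
      intro z; simp [MeasurableEquiv.finTwoArrow]
    refine ((lintegral_congr e).trans h).trans_le ?_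
    refine (lintegral_mul_le_sqrt _ (by fun_prop) (by fun_prop)).trans_eq ?_
    have h2 : ∫⁻ p : H × H, G (p.2, p.1) ^ 2 ∂μ.prod μ = ∫⁻ p, G p ^ 2 ∂μ.prod μ :=
      lintegral_prod_swap (fun p : H × H => G p ^ 2)
    rw [h2]
    simp [kernelNorm]
  | succ n ih =>
    have h := lintegral_pi_succ (fun _ : Fin (n + 3) => μ)
      (g := fun p => (∏ j : Fin (n + 1), F j.castSucc (p.2 j.castSucc, p.2 j.succ)) *
        (F (Fin.last _) (p.2 (Fin.last _), p.1) * G (p.1, p.2 0))) (by fun_prop)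
    have e : ∀ z : Fin (n + 3) → H, (∏ j : Fin (n + 2), F j (z j.castSucc, z j.succ)) *
      G (z (Fin.last _), z 0) =
      (∏ j : Fin (n + 1), F j.castSucc (z j.castSucc.castSucc, z j.succ.castSucc)) *
        (F (Fin.last _) (z (Fin.last _).castSucc, z (Fin.last _)) *
          G (z (Fin.last _), z (Fin.castSucc 0))) := by
      intro z
      rw [Fin.prod_univ_castSucc, mul_assoc]
      rfl
    rw [lintegral_congr e, h]
    have hG' : Measurable fun p : H × H => ∫⁻ t, F (Fin.last _) (p.1, t) * G (t, p.2) ∂μ :=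
      Measurable.lintegral_prod_right'
        (f := fun q : (H × H) × H => F (Fin.last _) (q.1.1, q.2) * G (q.2, q.1.2)) (by fun_prop)
    have h3 := ih (fun j => hF j.castSucc) hG'
    refine (lintegral_congr fun z : Fin (n + 2) → H => lintegral_const_mul (μ := μ)
      (∏ j : Fin (n + 1), F j.castSucc (z j.castSucc, z j.succ))
      (f := fun t => F (Fin.last _) (z (Fin.last _), t) * G (t, z 0)) (by fun_prop)).trans_le
      (h3.trans ?_)
    rw [Fin.prod_univ_castSucc (fun j : Fin (n + 1 + 1) => kernelNorm μ (F j)), mul_assoc]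
    exact mul_le_mul' le_rfl (kernelNorm_comp_le (μ := μ) (hF _) hG)

/-- A trace is bounded by Hilbert–Schmidt norms. A single kernel has no such bound on its diagonal,
hence the requirement of two edges. -/
theorem lintegral_ring_le {n : ℕ} (hn : 2 ≤ n) {F : Fin n → H × H → ℝ≥0∞}
    (hF : ∀ j, Measurable (F j)) :
    ∫⁻ z : Fin n → H, ∏ j, F j (z j, z (finRotate n j)) ∂Measure.pi (fun _ => μ) ≤
      ∏ j, kernelNorm μ (F j) := by
  obtain ⟨k, rfl⟩ := Nat.exists_eq_add_of_le' hn
  rw [Fin.prod_univ_castSucc (n := k + 1) (fun j => kernelNorm μ (F j))]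
  refine le_trans (le_of_eq (lintegral_congr fun z => ?_))
    (lintegral_chain_le k (fun j => hF j.castSucc) (hF (Fin.last _)))
  rw [Fin.prod_univ_castSucc]
  congr 1
  · refine Finset.prod_congr rfl fun j _ => ?_
    rw [finRotate_apply, Fin.coeSucc_eq_succ]
  · rw [finRotate_last]

end Ring

end ProperNorms

namespace ProperNorms

/-! ### Quadratic forms, and expansion of products over signs -/

section Forms

variable {S : Type*} [MeasurableSpace S]

/-- `∫∫ K(x,y) dμ₁(x) dμ₂(y)`. -/
noncomputable def bil (K : S → S → ℝ≥0∞) (μ₁ μ₂ : Measure S) : ℝ≥0∞ :=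
  ∫⁻ x, ∫⁻ y, K x y ∂μ₂ ∂μ₁

theorem bil_mono (K : S → S → ℝ≥0∞) {μ₁ μ₂ ρ₁ ρ₂ : Measure S} (h₁ : μ₁ ≤ ρ₁) (h₂ : μ₂ ≤ ρ₂) :
    bil K μ₁ μ₂ ≤ bil K ρ₁ ρ₂ :=
  lintegral_mono' h₁ fun _ => lintegral_mono' h₂ le_rfl

theorem quadForm_eq {K : S → S → ℝ≥0∞} (hK : Measurable fun p : S × S => K p.1 p.2)
    {ν : SignedMeasure S} (h : FormConverges K ν) :
    quadForm K ν = (bil K (pos ν) (pos ν)).toReal - (bil K (pos ν) (neg ν)).toReal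
      - ((bil K (neg ν) (pos ν)).toReal - (bil K (neg ν) (neg ν)).toReal) := by
  have hpos := pos_le_totalVariation ν
  have hneg := neg_le_totalVariation ν
  have fin : ∀ ρ₁ ρ₂ : Measure S, ρ₁ ≤ ν.totalVariation → ρ₂ ≤ ν.totalVariation →
      ∫⁻ x, ∫⁻ y, K x y ∂ρ₂ ∂ρ₁ ≠ ∞ := fun ρ₁ ρ₂ h₁ h₂ => ((bil_mono K h₁ h₂).trans_lt h).ne
  have mK : ∀ x, Measurable (K x) := fun x => hK.comp measurable_prodMk_left
  have mI : ∀ (ρ : Measure S) [SFinite ρ], Measurable fun x => ∫⁻ y, K x y ∂ρ := fun ρ _ =>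
    Measurable.lintegral_prod_right' hK
  have inner : ∀ (ρ : Measure S), ρ ≤ ν.totalVariation →
      ∫ x, sint ν (fun y => (K x y).toReal) ∂ρ =
        (bil K ρ (pos ν)).toReal - (bil K ρ (neg ν)).toReal := by
    intro ρ hρ
    have e : (fun x => sint ν fun y => (K x y).toReal) =ᵐ[ρ] fun x =>
        (∫⁻ y, K x y ∂(pos ν)).toReal - (∫⁻ y, K x y ∂(neg ν)).toReal := by
      filter_upwards [ae_lt_top (mI (pos ν)) (fin ρ _ hρ hpos),
        ae_lt_top (mI (neg ν)) (fin ρ _ hρ hneg)] with x hx hx'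
      rw [sint, integral_toReal (mK x).aemeasurable (ae_lt_top (mK x) hx.ne),
        integral_toReal (mK x).aemeasurable (ae_lt_top (mK x) hx'.ne)]
    rw [integral_congr_ae e, integral_sub
      (integrable_toReal_of_lintegral_ne_top (mI _).aemeasurable (fin ρ _ hρ hpos))
      (integrable_toReal_of_lintegral_ne_top (mI _).aemeasurable (fin ρ _ hρ hneg)),
      integral_toReal (mI _).aemeasurable (ae_lt_top (mI _) (fin ρ _ hρ hpos)),
      integral_toReal (mI _).aemeasurable (ae_lt_top (mI _) (fin ρ _ hρ hneg))]
    rfl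
  rw [quadForm]
  nth_rewrite 1 [sint]
  rw [inner _ hpos, inner _ hneg]

theorem formConverges_smul {K : S → S → ℝ≥0∞} {ν : SignedMeasure S} (h : FormConverges K ν)
    (c : ℝ) : FormConverges K (c • ν) := by
  have : (c • ν).totalVariation = c.nnabs • ν.totalVariation := by
    rcases lt_or_ge c 0 with hc | hc
    · rw [totalVariation_eq, totalVariation_eq, (pos_smul_of_neg hc ν).1, (pos_smul_of_neg hc ν).2,
        ← smul_add, add_comm]
      congr 1; ext; simp [hc.le, abs_of_neg hc]
    · rw [totalVariation_eq, totalVariation_eq, (pos_smul_of_nonneg hc ν).1,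
        (pos_smul_of_nonneg hc ν).2, ← smul_add]
      congr 1; ext; simp [hc]
  unfold FormConverges at *
  rw [this, lintegral_smul_measure]
  simp_rw [lintegral_smul_measure]
  have e : ∫⁻ x, c.nnabs • ∫⁻ y, K x y ∂ν.totalVariation ∂ν.totalVariation =
    c.nnabs * ∫⁻ x, ∫⁻ y, K x y ∂ν.totalVariation ∂ν.totalVariation :=
    lintegral_const_mul' _ _ ENNReal.coe_ne_top
  rw [e]
  exact ENNReal.mul_lt_top ENNReal.coe_lt_top (ENNReal.mul_lt_top ENNReal.coe_lt_top h)

theorem lintegral_cyclicProd_two {u : S → S → ℝ≥0∞} (hu : Measurable fun p : S × S => u p.1 p.2)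
    (ρ : Fin 2 → Measure S) [∀ j, SigmaFinite (ρ j)] :
    ∫⁻ x, cyclicProd u x ∂Measure.pi ρ = bil (fun x y => u x y * u y x) (ρ 0) (ρ 1) := by
  have h := (measurePreserving_piFinTwo ρ).lintegral_comp
    (f := fun p : S × S => u p.1 p.2 * u p.2 p.1)
    (hu.mul (hu.comp (measurable_snd.prodMk measurable_fst)))
  rw [bil, ← lintegral_prod (fun p : S × S => u p.1 p.2 * u p.2 p.1)
    (hu.mul (hu.comp (measurable_snd.prodMk measurable_fst))).aemeasurable, ← h]
  refine lintegral_congr fun z => ?_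
  simp [cyclicProd, Fin.prod_univ_two, MeasurableEquiv.piFinTwo]

theorem cyclicConverges_two_iff {u : S → S → ℝ≥0∞} (hu : Measurable fun p : S × S => u p.1 p.2)
    (ν : SignedMeasure S) :
    CyclicConverges u (fun _ : Fin 2 => ν) ↔ FormConverges (fun x y => u x y * u y x) ν := by
  rw [CyclicConverges, lintegral_cyclicProd_two hu]
  rfl

theorem quadForm_eq_cyclicInt {u : S → S → ℝ≥0∞} (hu : Measurable fun p : S × S => u p.1 p.2)
    {ν : SignedMeasure S} (h : FormConverges (fun x y => u x y * u y x) ν) :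
    quadForm (fun x y => u x y * u y x) ν = cyclicInt u (fun _ : Fin 2 => ν) := by
  rw [quadForm_eq (hu.mul (hu.comp (measurable_snd.prodMk measurable_fst))) h, cyclicInt]
  have hfin : ∀ ε : Fin 2 → Bool, ∀ j, SigmaFinite (if ε j then pos ν else neg ν) := by
    intro ε j; split_ifs <;> infer_instance
  simp_rw [lintegral_cyclicProd_two hu]
  rw [← (finTwoArrowEquiv Bool).symm.sum_comp]
  simp [Fintype.sum_prod_type, Fin.prod_univ_two]
  ring

theorem sum_signs_mul_prod {R : Type*} [CommRing R] {n : ℕ} (A B : Fin n → R) :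
    ∑ ε : Fin n → Bool, (∏ j, if ε j then (1 : R) else -1) * ∏ j, (if ε j then A j else B j) =
      ∏ j, (A j - B j) := by
  have : ∀ j, A j - B j = ∑ b : Bool, (if b then (1 : R) else -1) * (if b then A j else B j) := by
    intro j; simp [sub_eq_add_neg]
  simp_rw [this]
  rw [Finset.prod_univ_sum]
  simp only [Finset.prod_mul_distrib, Fintype.piFinset_univ]

/-- Only the mixed products are assumed finite, not the numbers themselves. If some A i + B i is
zero, every product vanishes. Otherwise ∏ (A j + B j), being the sum of all the products, is finite
with nonzero factors, so each factor is finite and the sum over signs is ∏ (A j - B j). -/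
theorem abs_sum_signs_le {n : ℕ} {A B : Fin n → ℝ≥0∞}
    (h : ∀ ε : Fin n → Bool, ∏ j, (if ε j then A j else B j) ≠ ∞) :
    ENNReal.ofReal |∑ ε : Fin n → Bool, (∏ j, if ε j then (1 : ℝ) else -1) *
      (∏ j, (if ε j then A j else B j)).toReal| ≤ ∏ j, gap (A j) (B j) := by
  by_cases h0 : ∃ i, A i + B i = 0
  · obtain ⟨i, hi⟩ := h0
    simp only [add_eq_zero] at hi
    have : ∀ ε : Fin n → Bool, ∏ j, (if ε j then A j else B j) = 0 := fun ε =>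
      Finset.prod_eq_zero (Finset.mem_univ i) (by split_ifs <;> simp [hi])
    simp [this]
  · push Not at h0
    have hsum : ∏ j, (A j + B j) ≠ ∞ := by
      have : ∀ j, A j + B j = ∑ b : Bool, (if b then A j else B j) := by intro j; simp
      simp_rw [this]
      rw [Finset.prod_univ_sum]
      exact ENNReal.sum_ne_top.2 fun ε _ => h ε
    have hAB : ∀ i, A i + B i ≠ ∞ := by
      intro i hi
      apply hsum
      rw [← Finset.mul_prod_erase _ _ (Finset.mem_univ i), hi]
      exact ENNReal.top_mul (Finset.prod_ne_zero_iff.2 fun j _ => h0 j)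
    have hA : ∀ i, A i ≠ ∞ := fun i e => hAB i (by simp [e])
    have hB : ∀ i, B i ≠ ∞ := fun i e => hAB i (by simp [e])
    simp_rw [gap_of_ne_top (hA _) (hB _)]
    rw [← ENNReal.ofReal_prod_of_nonneg fun _ _ => abs_nonneg _, ← Finset.abs_prod,
      ← sum_signs_mul_prod]
    refine le_of_eq ?_
    congr 3 with ε
    rw [ENNReal.toReal_prod]
    congr 1
    exact Finset.prod_congr rfl fun j _ => by split_ifs <;> rfl

end Forms

end ProperNorms

namespace ProperNorms

/-! ### Potentials that factor through an auxiliary space -/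

section Factorization

variable {S H : Type*} [MeasurableSpace S] [MeasurableSpace H]

/-- The kernel `(h, h') ↦ ∫ b(x,h) a(x,h') dρ(x)`. -/
noncomputable def mixed (a b : S → H → ℝ≥0∞) (ρ : Measure S) (p : H × H) : ℝ≥0∞ :=
  ∫⁻ x, b x p.1 * a x p.2 ∂ρ

/-- The `L²` norm of `(h, h') ↦ |∫ b(x,h) a(x,h') dν(x)|`. -/
noncomputable def mixedNorm (μ : Measure H) (a b : S → H → ℝ≥0∞) (ν : SignedMeasure S) : ℝ≥0∞ :=
  kernelNorm μ fun p => absInt ν fun x => b x p.1 * a x p.2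

variable {a b : S → H → ℝ≥0∞} (ha : Measurable fun p : S × H => a p.1 p.2)
  (hb : Measurable fun p : S × H => b p.1 p.2)

include ha hb in
theorem measurable_mixed (ρ : Measure S) [SFinite ρ] : Measurable (mixed a b ρ) :=
  Measurable.lintegral_prod_right' (f := fun q : (H × H) × S => b q.2 q.1.1 * a q.2 q.1.2)
    (by fun_prop)

include ha hb in
theorem absInt_mixed (ν : SignedMeasure S) (p : H × H) :
    absInt ν (fun x => b x p.1 * a x p.2) = gap (mixed a b (pos ν) p) (mixed a b (neg ν) p) :=
  absInt_eq_gap ν (by fun_prop)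

include ha hb in
theorem measurable_absInt_mixed (ν : SignedMeasure S) :
    Measurable fun p : H × H => absInt ν fun x => b x p.1 * a x p.2 := by
  simp_rw [absInt_mixed ha hb ν]
  exact measurable_gap.comp ((measurable_mixed ha hb _).prodMk (measurable_mixed ha hb _))

include ha hb in
theorem mixedNorm_add_le (μ : Measure H) (ν ν' : SignedMeasure S) :
    mixedNorm μ a b (ν + ν') ≤ mixedNorm μ a b ν + mixedNorm μ a b ν' := by
  have h := ENNReal.lintegral_Lp_add_le (μ := μ.prod μ) (p := 2)
    (measurable_absInt_mixed ha hb ν).aemeasurable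
    (measurable_absInt_mixed ha hb ν').aemeasurable (by norm_num)
  simp only [Pi.add_apply, ENNReal.rpow_two] at h
  refine le_trans ?_ h
  refine ENNReal.rpow_le_rpow (lintegral_mono fun p => ?_) (by norm_num)
  exact pow_le_pow_left' (absInt_add_le ν ν' (by fun_prop)) 2

include ha hb in
theorem mixedNorm_smul (μ : Measure H) (c : ℝ) (ν : SignedMeasure S) :
    mixedNorm μ a b (c • ν) = ENNReal.ofReal |c| * mixedNorm μ a b ν := by
  rcases eq_or_ne c 0 with rfl | hc
  · simp [mixedNorm, kernelNorm, absInt_zero]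
  · unfold mixedNorm kernelNorm
    have e : ∀ p : H × H, absInt (c • ν) (fun x => b x p.1 * a x p.2) ^ 2 =
        ENNReal.ofReal |c| ^ 2 * absInt ν (fun x => b x p.1 * a x p.2) ^ 2 := by
      intro p
      rw [absInt_smul hc ν (by fun_prop), mul_pow]
    simp_rw [e]
    rw [lintegral_const_mul' _ _ (by simp), ENNReal.mul_rpow_of_nonneg _ _ (by norm_num), sq_rpow_half]

variable {μ : Measure H} [SigmaFinite μ] {u : S → S → ℝ≥0∞}
  (hu : ∀ x y, u x y = ∫⁻ h, a x h * b y h ∂μ)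

include ha hb hu in
-- The point xⱼ occurs in a(xⱼ,hⱼ), from the edge that leaves it, and in b(xⱼ,hⱼ₋₁), from the edge
-- that enters it. Integrating it out therefore leaves an edge from hⱼ₋₁ to hⱼ.
theorem lintegral_cyclicProd {n : ℕ} (ρ : Fin n → Measure S) [∀ j, IsFiniteMeasure (ρ j)] :
    ∫⁻ x, cyclicProd u x ∂Measure.pi ρ =
      ∫⁻ h, ∏ j, mixed a b (ρ (finRotate n j)) (h j, h (finRotate n j))
        ∂Measure.pi fun _ : Fin n => μ := by
  have e1 : ∀ x : Fin n → S, cyclicProd u x =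
      ∫⁻ h, ∏ j, (a (x j) (h j) * b (x (finRotate n j)) (h j)) ∂Measure.pi fun _ => μ := by
    intro x
    rw [lintegral_pi_prod (fun _ => μ) (f := fun j t => a (x j) t * b (x (finRotate n j)) t)
      (fun j => by fun_prop)]
    simp_rw [cyclicProd, hu]
  have e2 : ∀ (x : Fin n → S) (h : Fin n → H),
      ∏ j, (a (x j) (h j) * b (x (finRotate n j)) (h j)) =
        ∏ j, (b (x j) (h ((finRotate n).symm j)) * a (x j) (h j)) := by
    intro x h
    rw [Finset.prod_mul_distrib, Finset.prod_mul_distrib, mul_comm]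
    congr 1
    rw [← Equiv.prod_comp (finRotate n).symm]
    simp only [Equiv.apply_symm_apply]
  simp_rw [e1, e2]
  rw [lintegral_lintegral_swap]
  · refine lintegral_congr fun h => ?_
    rw [lintegral_pi_prod ρ (f := fun j t => b t (h ((finRotate n).symm j)) * a t (h j))
      (fun j => by fun_prop), ← Equiv.prod_comp (finRotate n)]
    simp only [mixed, Equiv.symm_apply_apply]
  · refine Measurable.aemeasurable ?_
    refine Finset.measurable_prod _ fun j _ => ?_
    have h1 : Measurable fun p : (Fin n → S) × (Fin n → H) => (p.1 j, p.2 ((finRotate n).symm j)) := by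
      fun_prop
    have h2 : Measurable fun p : (Fin n → S) × (Fin n → H) => (p.1 j, p.2 j) := by
      fun_prop
    exact (hb.comp h1).mul (ha.comp h2)

include ha hb hu in
theorem measurable_of_factorization : Measurable fun p : S × S => u p.1 p.2 := by
  simp_rw [hu]
  exact Measurable.lintegral_prod_right' (f := fun q : (S × S) × H => a q.1.1 q.2 * b q.1.2 q.2)
    (by fun_prop)

theorem measurable_cyclicProd (hu : Measurable fun p : S × S => u p.1 p.2) (n : ℕ) :
    Measurable fun x : Fin n → S => cyclicProd u x := by
  refine Finset.measurable_prod _ fun j _ => ?_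
  exact hu.comp (g := fun p : S × S => u p.1 p.2)
    (f := fun x : Fin n → S => (x j, x (finRotate n j))) (by fun_prop)

theorem lintegral_cyclicProd_signs_lt_top (hu : Measurable fun p : S × S => u p.1 p.2) {n : ℕ}
    {ν : Fin n → SignedMeasure S} (h : CyclicConverges u ν) (ε : Fin n → Bool) :
    ∫⁻ x, cyclicProd u x ∂(Measure.pi fun j => if ε j then pos (ν j) else neg (ν j)) < ∞ := by
  have : ∀ j, IsFiniteMeasure (if ε j then pos (ν j) else neg (ν j)) := by
    intro j; split_ifs <;> infer_instance
  refine lt_of_le_of_lt (lintegral_pi_mono (fun j => ?_) (measurable_cyclicProd hu n)) h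
  split_ifs
  exacts [pos_le_totalVariation _, neg_le_totalVariation _]

include ha hb hu in
-- The signs are summed at fixed h, before absolute values are taken: the sum is a product of
-- differences, so that the cancellation inside each νⱼ is kept. The trace inequality is applied to
-- the absolute values of these differences.
theorem abs_cyclicInt_le {n : ℕ} (hn : 2 ≤ n) {ν : Fin n → SignedMeasure S}
    (h : CyclicConverges u ν) :
    ENNReal.ofReal |cyclicInt u ν| ≤ ∏ j, mixedNorm μ a b (ν j) := by
  have mu := measurable_of_factorization ha hb hu
  let P : (Fin n → Bool) → (Fin n → H) → ℝ≥0∞ := fun ε h =>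
    ∏ j, if ε (finRotate n j) then mixed a b (pos (ν (finRotate n j))) (h j, h (finRotate n j))
      else mixed a b (neg (ν (finRotate n j))) (h j, h (finRotate n j))
  have hP : ∀ ε, ∫⁻ x, cyclicProd u x
      ∂(Measure.pi fun j => if ε j then pos (ν j) else neg (ν j)) =
        ∫⁻ h, P ε h ∂Measure.pi fun _ => μ := by
    intro ε
    have : ∀ j, IsFiniteMeasure (if ε j then pos (ν j) else neg (ν j)) := by
      intro j; split_ifs <;> infer_instance
    rw [lintegral_cyclicProd ha hb hu]
    refine lintegral_congr fun h => Finset.prod_congr rfl fun j _ => ?_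
    split_ifs <;> rfl
  have mP : ∀ ε, Measurable (P ε) := by
    intro ε
    refine Finset.measurable_prod _ fun j _ => ?_
    have m1 : Measurable fun h : Fin n → H => (h j, h (finRotate n j)) := by fun_prop
    split_ifs
    exacts [(measurable_mixed ha hb _).comp m1, (measurable_mixed ha hb _).comp m1]
  have fP : ∀ ε, ∫⁻ h, P ε h ∂(Measure.pi fun _ => μ) ≠ ∞ := fun ε => by
    rw [← hP]; exact (lintegral_cyclicProd_signs_lt_top mu h ε).ne
  have e : cyclicInt u ν = ∫ h, ∑ ε : Fin n → Bool,
      (∏ j, if ε j then (1 : ℝ) else -1) * (P ε h).toReal ∂Measure.pi fun _ => μ := by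
    rw [integral_finsetSum _ fun ε _ => (integrable_toReal_of_lintegral_ne_top
      (mP ε).aemeasurable (fP ε)).const_mul _, cyclicInt]
    refine Finset.sum_congr rfl fun ε _ => ?_
    rw [integral_const_mul, integral_toReal (mP ε).aemeasurable (ae_lt_top (mP ε) (fP ε)), hP]
  rw [e, ← Real.norm_eq_abs, ofReal_norm]
  refine (enorm_integral_le_lintegral_enorm _).trans ?_
  let F : Fin n → H × H → ℝ≥0∞ := fun j p =>
    absInt (ν (finRotate n j)) fun x => b x p.1 * a x p.2
  have hF : ∀ j, Measurable (F j) := fun j => measurable_absInt_mixed ha hb _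
  have key : ∫⁻ h, ‖∑ ε : Fin n → Bool, (∏ j, if ε j then (1 : ℝ) else -1) * (P ε h).toReal‖ₑ
      ∂(Measure.pi fun _ : Fin n => μ) ≤
      ∫⁻ h, ∏ j, F j (h j, h (finRotate n j)) ∂(Measure.pi fun _ => μ) := by
    refine lintegral_mono_ae ?_
    -- For almost every h all 2^n products are finite, which is exactly what `abs_sum_signs_le`
    -- needs.
    filter_upwards [ae_all_iff.2 fun ε => ae_lt_top (mP ε) (fP ε)] with h hfin
    rw [← ofReal_norm, Real.norm_eq_abs]
    let A : Fin n → ℝ≥0∞ := fun j =>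
      mixed a b (pos (ν j)) (h ((finRotate n).symm j), h j)
    let B : Fin n → ℝ≥0∞ := fun j =>
      mixed a b (neg (ν j)) (h ((finRotate n).symm j), h j)
    have hAB : ∀ ε : Fin n → Bool, P ε h = ∏ j, if ε j then A j else B j := by
      intro ε
      rw [← Equiv.prod_comp (finRotate n)]
      simp only [A, B, P, Equiv.symm_apply_apply]
    have := abs_sum_signs_le (A := A) (B := B) fun ε => by rw [← hAB]; exact (hfin ε).ne
    simp_rw [← hAB] at this
    refine this.trans_eq ?_
    rw [← Equiv.prod_comp (finRotate n)]
    refine Finset.prod_congr rfl fun j _ => ?_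
    simp only [F, absInt_mixed ha hb, A, B, Equiv.symm_apply_apply]
  refine key.trans ((lintegral_ring_le hn hF).trans_eq ?_)
  exact Equiv.prod_comp (finRotate n) fun j => mixedNorm μ a b (ν j)

include ha hb hu in
-- For positive measures nothing cancels: the mixed kernel is its own absolute value, so a finite
-- mixed norm bounds the absolute integral.
theorem cyclicConverges_of_le {n : ℕ} (hn : 2 ≤ n) {ν ρ : Fin n → SignedMeasure S}
    (h : ∀ j, (ν j).totalVariation ≤ (ρ j).totalVariation) (hpos : ∀ j, 0 ≤ ρ j)
    (hfin : ∀ j, mixedNorm μ a b (ρ j) < ∞) : CyclicConverges u ν := by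
  have mu := measurable_of_factorization ha hb hu
  refine (lintegral_pi_mono h (measurable_cyclicProd mu n)).trans_lt ?_
  rw [lintegral_cyclicProd ha hb hu]
  refine (lintegral_ring_le hn fun j => measurable_mixed ha hb _).trans_lt ?_
  refine ENNReal.prod_lt_top fun j _ => ?_
  refine lt_of_eq_of_lt ?_ (hfin (finRotate n j))
  unfold mixedNorm
  congr 1
  ext p
  rw [absInt_of_nonneg (hpos _) (by fun_prop)]
  rfl

theorem exists_le_of_mem_finitePart {V : Set (SignedMeasure S)} {N : SignedMeasure S → ℝ≥0∞}
    {ν : SignedMeasure S} (h : ν ∈ finitePart V N)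
    (hN : ∀ ν ∈ V, ∀ ν' ∈ V, N (ν + ν') ≤ N ν + N ν') :
    ∃ ρ : SignedMeasure S, ν.totalVariation ≤ ρ.totalVariation ∧ 0 ≤ ρ ∧ N ρ < ∞ := by
  obtain ⟨ν₁, h₁, ν₂, h₂, p₁, p₂, f₁, f₂, rfl⟩ := h
  exact ⟨ν₁ + ν₂, totalVariation_sub_le p₁ p₂, add_nonneg p₁ p₂,
    (hN _ h₁ _ h₂).trans_lt (ENNReal.add_lt_top.2 ⟨f₁, f₂⟩)⟩

include ha hb hu in
-- Domination suffices, so this serves both ‖·‖_w, which is a mixed norm, and ‖·‖_Φ, which is set to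
-- ∞ when its form diverges.
theorem isProperSeminorm_of_mixedNorm_le {N : SignedMeasure S → ℝ≥0∞}
    (hsmul : ∀ (c : ℝ) ν, N (c • ν) = ENNReal.ofReal |c| * N ν)
    (hadd : ∀ ν ν', N (ν + ν') ≤ N ν + N ν') (hN : ∀ ν, mixedNorm μ a b ν ≤ N ν) :
    IsProperSeminorm univ u N where
  smul c ν _ := hsmul c ν
  add_le ν _ ν' _ := hadd ν ν'
  converges n hn ν hν := by
    choose ρ h1 h2 h3 using fun j =>
      exists_le_of_mem_finitePart (hν j) fun ν _ ν' _ => hadd ν ν'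
    exact cyclicConverges_of_le ha hb hu hn h1 h2 fun j => (hN _).trans_lt (h3 j)
  bound := ⟨1, fun n hn ν _ h => by
    simpa using (abs_cyclicInt_le ha hb hu hn h).trans (Finset.prod_le_prod' fun j _ => hN (ν j))⟩

end Factorization

end ProperNorms

namespace ProperNorms

/-! ### Quadratic forms that are squares of mixed norms -/

section FactorizedForms

variable {S H : Type*} [MeasurableSpace S] [MeasurableSpace H] {a b : S → H → ℝ≥0∞}
  (ha : Measurable fun p : S × H => a p.1 p.2) (hb : Measurable fun p : S × H => b p.1 p.2)
  {μ : Measure H} [SigmaFinite μ] {K : S → S → ℝ≥0∞}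
  (hK : ∀ x y, K x y = (∫⁻ h, a x h * a y h ∂μ) * ∫⁻ h, b x h * b y h ∂μ)

include ha hb hK in
-- `K` is a Gram kernel: with f(x) the function (h,h') ↦ b(x,h) a(x,h'), the value K(x,y) is the L²
-- inner product of f(x) and f(y).
theorem bil_eq_lintegral_mixed (ρ₁ ρ₂ : Measure S) [SFinite ρ₁] [SFinite ρ₂] :
    bil K ρ₁ ρ₂ = ∫⁻ p, mixed a b ρ₁ p * mixed a b ρ₂ p ∂μ.prod μ := by
  have e : ∀ x y, K x y = ∫⁻ p : H × H, (b x p.1 * a x p.2) * (b y p.1 * a y p.2) ∂μ.prod μ := by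
    intro x y
    have : ∀ p : H × H, (b x p.1 * a x p.2) * (b y p.1 * a y p.2) =
      (b x p.1 * b y p.1) * (a x p.2 * a y p.2) := fun p => by ring
    simp_rw [this]
    rw [lintegral_prod_mul (f := fun h => b x h * b y h) (g := fun h => a x h * a y h)
      (by fun_prop) (by fun_prop), hK, mul_comm]
  unfold bil
  simp_rw [e]
  have m1 : Measurable fun q : (S × S) × (H × H) =>
      (b q.1.1 q.2.1 * a q.1.1 q.2.2) * (b q.1.2 q.2.1 * a q.1.2 q.2.2) := by fun_prop
  have step : ∀ x, ∫⁻ y, ∫⁻ p : H × H, (b x p.1 * a x p.2) * (b y p.1 * a y p.2) ∂μ.prod μ ∂ρ₂ =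
      ∫⁻ p : H × H, (b x p.1 * a x p.2) * mixed a b ρ₂ p ∂μ.prod μ := by
    intro x
    rw [lintegral_lintegral_swap (by fun_prop)]
    refine lintegral_congr fun p => ?_
    rw [lintegral_const_mul _ (by fun_prop)]
    rfl
  simp_rw [step]
  have mm := measurable_mixed ha hb ρ₂
  rw [lintegral_lintegral_swap (by fun_prop)]
  refine lintegral_congr fun p => ?_
  rw [lintegral_mul_const _ (by fun_prop)]
  rfl

include ha hb hK in
theorem formConverges_iff_kernelNorm (ν : SignedMeasure S) :
    FormConverges K ν ↔ kernelNorm μ (mixed a b ν.totalVariation) < ∞ := by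
  have := bil_eq_lintegral_mixed ha hb hK ν.totalVariation ν.totalVariation
  unfold FormConverges kernelNorm
  unfold bil at this
  rw [this, ENNReal.rpow_lt_top_iff_of_pos (by norm_num)]
  simp_rw [sq]

omit [MeasurableSpace H] in
theorem mixed_add_measure (ρ₁ ρ₂ : Measure S) (p : H × H) :
    mixed a b (ρ₁ + ρ₂) p = mixed a b ρ₁ p + mixed a b ρ₂ p := lintegral_add_measure _ _ _

omit [MeasurableSpace H] in
theorem mixed_mono {ρ₁ ρ₂ : Measure S} (h : ρ₁ ≤ ρ₂) (p : H × H) :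
    mixed a b ρ₁ p ≤ mixed a b ρ₂ p := lintegral_mono' h le_rfl

omit [SigmaFinite μ] in
theorem kernelNorm_mono {F G : H × H → ℝ≥0∞} (h : ∀ p, F p ≤ G p) :
    kernelNorm μ F ≤ kernelNorm μ G :=
  ENNReal.rpow_le_rpow (lintegral_mono fun p => pow_le_pow_left' (h p) 2) (by norm_num)

omit [SigmaFinite μ] in
theorem kernelNorm_add_le {F G : H × H → ℝ≥0∞} (hF : Measurable F) (hG : Measurable G) :
    kernelNorm μ (fun p => F p + G p) ≤ kernelNorm μ F + kernelNorm μ G := by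
  have h := ENNReal.lintegral_Lp_add_le (μ := μ.prod μ) (p := 2)
    hF.aemeasurable hG.aemeasurable (by norm_num)
  simp only [Pi.add_apply, ENNReal.rpow_two] at h
  exact h

include ha hb hK in
-- Absolute convergence says that the mixed kernel of |ν| lies in L², a property that Minkowski's
-- inequality passes on to sums.
theorem formConverges_add {ν ν' : SignedMeasure S} (h : FormConverges K ν)
    (h' : FormConverges K ν') : FormConverges K (ν + ν') := by
  rw [formConverges_iff_kernelNorm ha hb hK] at *
  refine lt_of_le_of_lt (kernelNorm_mono fun p => ?_)
    ((kernelNorm_add_le (measurable_mixed ha hb _) (measurable_mixed ha hb _)).trans_lt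
      (ENNReal.add_lt_top.2 ⟨h, h'⟩))
  rw [← mixed_add_measure]
  exact mixed_mono (totalVariation_add_le ν ν') p

include ha hb hK in
-- The four parts of the Gram form are integrable by absolute convergence, and under the integral
-- they combine to a square. The nonnegativity of the form rests on this.
theorem quadForm_eq_integral_sq {ν : SignedMeasure S} (h : FormConverges K ν) :
    quadForm K ν = ∫ p, ((mixed a b (pos ν) p).toReal - (mixed a b (neg ν) p).toReal) ^ 2
      ∂μ.prod μ ∧ kernelNorm μ (mixed a b (pos ν)) < ∞ ∧ kernelNorm μ (mixed a b (neg ν)) < ∞ := by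
  have mK : Measurable fun p : S × S => K p.1 p.2 := by
    simp_rw [hK]
    exact (Measurable.lintegral_prod_right' (f := fun q : (S × S) × H => a q.1.1 q.2 * a q.1.2 q.2)
      (by fun_prop)).mul (Measurable.lintegral_prod_right'
        (f := fun q : (S × S) × H => b q.1.1 q.2 * b q.1.2 q.2) (by fun_prop))
  have m1 := measurable_mixed ha hb (pos ν)
  have m2 := measurable_mixed ha hb (neg ν)
  have n1 : kernelNorm μ (mixed a b (pos ν)) < ∞ :=
    (kernelNorm_mono (mixed_mono (pos_le_totalVariation ν))).trans_lt
      ((formConverges_iff_kernelNorm ha hb hK ν).1 h)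
  have n2 : kernelNorm μ (mixed a b (neg ν)) < ∞ :=
    (kernelNorm_mono (mixed_mono (neg_le_totalVariation ν))).trans_lt
      ((formConverges_iff_kernelNorm ha hb hK ν).1 h)
  refine ⟨?_, n1, n2⟩
  have fin : ∀ ρ₁ ρ₂ : Measure S, [SFinite ρ₁] → [SFinite ρ₂] → ρ₁ ≤ ν.totalVariation →
      ρ₂ ≤ ν.totalVariation → ∫⁻ p, mixed a b ρ₁ p * mixed a b ρ₂ p ∂μ.prod μ ≠ ∞ := by
    intro ρ₁ ρ₂ _ _ h₁ h₂
    rw [← bil_eq_lintegral_mixed ha hb hK]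
    exact ((bil_mono K h₁ h₂).trans_lt h).ne
  have hp := pos_le_totalVariation ν
  have hn := neg_le_totalVariation ν
  have I : ∀ ρ₁ ρ₂ : Measure S, [SFinite ρ₁] → [SFinite ρ₂] → ρ₁ ≤ ν.totalVariation →
      ρ₂ ≤ ν.totalVariation → Integrable (fun p => (mixed a b ρ₁ p * mixed a b ρ₂ p).toReal)
        (μ.prod μ) := fun ρ₁ ρ₂ _ _ h₁ h₂ =>
    integrable_toReal_of_lintegral_ne_top
      ((measurable_mixed ha hb ρ₁).mul (measurable_mixed ha hb ρ₂)).aemeasurable (fin ρ₁ ρ₂ h₁ h₂)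
  have B : ∀ ρ₁ ρ₂ : Measure S, [SFinite ρ₁] → [SFinite ρ₂] → ρ₁ ≤ ν.totalVariation →
      ρ₂ ≤ ν.totalVariation → (bil K ρ₁ ρ₂).toReal =
        ∫ p, (mixed a b ρ₁ p * mixed a b ρ₂ p).toReal ∂μ.prod μ := by
    intro ρ₁ ρ₂ _ _ h₁ h₂
    have m := (measurable_mixed ha hb ρ₁).mul (measurable_mixed ha hb ρ₂)
    rw [bil_eq_lintegral_mixed ha hb hK]
    exact (integral_toReal m.aemeasurable (ae_lt_top m (fin ρ₁ ρ₂ h₁ h₂))).symm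
  rw [quadForm_eq mK h, B _ _ hp hp, B _ _ hp hn, B _ _ hn hp, B _ _ hn hn,
    ← integral_sub (I _ _ hp hp) (I _ _ hp hn), ← integral_sub (I _ _ hn hp) (I _ _ hn hn)]
  refine (integral_sub ((I _ _ hp hp).sub (I _ _ hp hn))
    ((I _ _ hn hp).sub (I _ _ hn hn))).symm.trans ?_
  refine integral_congr_ae (Eventually.of_forall fun p => ?_)
  simp only [ENNReal.toReal_mul, Pi.sub_apply]
  ring

include ha hb hK in
theorem quadForm_nonneg {ν : SignedMeasure S} (h : FormConverges K ν) : 0 ≤ quadForm K ν := by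
  rw [(quadForm_eq_integral_sq ha hb hK h).1]
  exact integral_nonneg fun p => sq_nonneg _

omit [SigmaFinite μ] in
theorem ae_lt_top_of_kernelNorm_lt_top {F : H × H → ℝ≥0∞} (hF : Measurable F)
    (h : kernelNorm μ F < ∞) : ∀ᵐ p ∂μ.prod μ, F p < ∞ := by
  rw [kernelNorm, ENNReal.rpow_lt_top_iff_of_pos (by norm_num)] at h
  filter_upwards [ae_lt_top (by fun_prop) h.ne] with p hp
  by_contra hc
  simp [not_lt_top_iff.1 hc] at hp

include ha hb hK in
theorem quadNorm_eq_mixedNorm {ν : SignedMeasure S} (h : FormConverges K ν) :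
    quadNorm K ν = mixedNorm μ a b ν := by
  obtain ⟨e, n1, n2⟩ := quadForm_eq_integral_sq ha hb hK h
  rw [quadNorm, if_pos h, Real.sqrt_eq_rpow,
    ← ENNReal.ofReal_rpow_of_nonneg (quadForm_nonneg ha hb hK h) (by norm_num), mixedNorm,
    kernelNorm, e]
  congr 1
  have m1 := measurable_mixed ha hb (pos ν)
  have m2 := measurable_mixed ha hb (neg ν)
  have e2 : ∫⁻ p, absInt ν (fun x => b x p.1 * a x p.2) ^ 2 ∂μ.prod μ = ∫⁻ p, ENNReal.ofReal
      (((mixed a b (pos ν) p).toReal - (mixed a b (neg ν) p).toReal) ^ 2) ∂μ.prod μ := by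
    refine lintegral_congr_ae ?_
    filter_upwards [ae_lt_top_of_kernelNorm_lt_top m1 n1,
      ae_lt_top_of_kernelNorm_lt_top m2 n2] with p hp hp'
    rw [absInt_mixed ha hb, gap_of_ne_top hp.ne hp'.ne, ← ENNReal.ofReal_pow (abs_nonneg _), sq_abs]
  rw [e2]
  refine ofReal_integral_eq_lintegral_ofReal ?_ (Eventually.of_forall fun p => sq_nonneg _)
  have ms : AEStronglyMeasurable (fun p => (mixed a b (pos ν) p).toReal -
      (mixed a b (neg ν) p).toReal) (μ.prod μ) :=
    (m1.ennreal_toReal.sub m2.ennreal_toReal).aestronglyMeasurable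
  have L : ∀ {F : H × H → ℝ≥0∞}, Measurable F → kernelNorm μ F < ∞ →
      MemLp (fun p => (F p).toReal) 2 (μ.prod μ) := by
    intro F hF hF'
    refine (memLp_two_iff_integrable_sq hF.ennreal_toReal.aestronglyMeasurable).2 ?_
    simp_rw [← ENNReal.toReal_pow]
    refine integrable_toReal_of_lintegral_ne_top (by fun_prop) ?_
    rw [kernelNorm, ENNReal.rpow_lt_top_iff_of_pos (by norm_num)] at hF'
    exact hF'.ne
  exact (memLp_two_iff_integrable_sq ms).1 ((L m1 n1).sub (L m2 n2))

include ha hb hK in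
-- The two agree when the form converges absolutely. Otherwise the right side is ∞, while
-- cancellation may keep the left side finite.
theorem mixedNorm_le_quadNorm (ν : SignedMeasure S) : mixedNorm μ a b ν ≤ quadNorm K ν := by
  by_cases h : FormConverges K ν
  · rw [quadNorm_eq_mixedNorm ha hb hK h]
  · rw [quadNorm, if_neg h]; exact le_top

include ha hb hK in
theorem quadNorm_add_le (ν ν' : SignedMeasure S) :
    quadNorm K (ν + ν') ≤ quadNorm K ν + quadNorm K ν' := by
  by_cases h : FormConverges K ν
  · by_cases h' : FormConverges K ν'
    · rw [quadNorm_eq_mixedNorm ha hb hK h, quadNorm_eq_mixedNorm ha hb hK h',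
        quadNorm_eq_mixedNorm ha hb hK (formConverges_add ha hb hK h h')]
      exact mixedNorm_add_le ha hb μ ν ν'
    · rw [quadNorm, quadNorm, quadNorm, if_neg h']; simp
  · rw [quadNorm, quadNorm, if_neg h]; simp

include ha hb hK in
theorem quadNorm_smul (c : ℝ) (ν : SignedMeasure S) :
    quadNorm K (c • ν) = ENNReal.ofReal |c| * quadNorm K ν := by
  by_cases h : FormConverges K ν
  · rw [quadNorm_eq_mixedNorm ha hb hK h, quadNorm_eq_mixedNorm ha hb hK (formConverges_smul h c),
      mixedNorm_smul ha hb]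
  · rcases eq_or_ne c 0 with rfl | hc
    · have h0 : FormConverges K (0 : SignedMeasure S) := by
        simp [FormConverges, SignedMeasure.totalVariation_zero]
      rw [zero_smul, quadNorm_eq_mixedNorm ha hb hK h0]
      have := mixedNorm_smul ha hb μ 0 0
      simpa using this
    · have h' : ¬ FormConverges K (c • ν) := fun h' => h (by
        have := formConverges_smul h' c⁻¹
        rwa [smul_smul, inv_mul_cancel₀ hc, one_smul] at this)
      rw [quadNorm, quadNorm, if_neg h, if_neg h', ENNReal.mul_top (by simpa using hc)]

include ha hb hK in
theorem isProperSeminorm_quadNorm {u : S → S → ℝ≥0∞}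
    (hu : ∀ x y, u x y = ∫⁻ h, a x h * b y h ∂μ) :
    IsProperSeminorm univ u (quadNorm K) :=
  isProperSeminorm_of_mixedNorm_le ha hb hu (quadNorm_smul ha hb hK) (quadNorm_add_le ha hb hK)
    (mixedNorm_le_quadNorm ha hb hK)

end FactorizedForms

end ProperNorms

namespace ProperNorms

/-! ### Arcsine integrals for the stable subordinator of index 1/2 -/

section ArcsineIntegrals

/-- The integrand is the derivative of arcsin ∘ v, which rises from -π/2 to π/2. It may blow up at
both ends; its integrability follows from its sign and the continuity of the primitive. -/
theorem lintegral_arcsin_deriv {a b : ℝ} (hab : a < b) {v v' : ℝ → ℝ} (hc : ContinuousOn v (Icc a b))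
    (ha : v a = -1) (hb : v b = 1) (hd : ∀ t ∈ Ioo a b, HasDerivAt v (v' t) t)
    (hv : ∀ t ∈ Ioo a b, v t ∈ Ioo (-1 : ℝ) 1) (hv' : ∀ t ∈ Ioo a b, 0 ≤ v' t) :
    ∫⁻ t in Ioo a b, ENNReal.ofReal (v' t / Real.sqrt (1 - v t ^ 2)) = ENNReal.ofReal Real.pi := by
  have hF : ContinuousOn (fun t => Real.arcsin (v t)) (Icc a b) :=
    Real.continuous_arcsin.comp_continuousOn hc
  have hD : ∀ t ∈ Ioo a b, HasDerivAt (fun t => Real.arcsin (v t))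
      (v' t / Real.sqrt (1 - v t ^ 2)) t := by
    intro t ht
    have := (Real.hasDerivAt_arcsin (hv t ht).1.ne' (hv t ht).2.ne).comp t (hd t ht)
    exact this.congr_deriv (by ring)
  have h0 : ∀ t ∈ Ioo a b, 0 ≤ v' t / Real.sqrt (1 - v t ^ 2) := fun t ht =>
    div_nonneg (hv' t ht) (Real.sqrt_nonneg _)
  have hI := intervalIntegral.integrableOn_deriv_of_nonneg hF hD h0
  have hint := intervalIntegral.integral_eq_sub_of_hasDerivAt_of_le hab.le hF hD
    ((intervalIntegrable_iff_integrableOn_Ioc_of_le hab.le).2 hI)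
  rw [intervalIntegral.integral_of_le hab.le, integral_Ioc_eq_integral_Ioo, ha, hb,
    Real.arcsin_one, Real.arcsin_neg_one] at hint
  rw [← ofReal_integral_eq_lintegral_ofReal (hI.mono_set Ioo_subset_Ioc_self)
    ((ae_restrict_iff' measurableSet_Ioo).2 (Eventually.of_forall h0)), hint]
  congr 1; ring

/-- `1 / √(π t)`. -/
noncomputable def rootWeight (t : ℝ) : ℝ≥0∞ := (ENNReal.ofReal (Real.sqrt (Real.pi * t)))⁻¹

theorem measurable_rootWeight : Measurable rootWeight := by
  unfold rootWeight; fun_prop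

theorem rootWeight_eq {t : ℝ} (ht : 0 < t) :
    rootWeight t = ENNReal.ofReal (Real.sqrt (Real.pi * t))⁻¹ := by
  rw [rootWeight, ENNReal.ofReal_inv_of_pos (by positivity)]

/-- The total mass of the arcsine law on (0,r), which v = 2s/r - 1 carries to (-1,1). Thus 1/√(πt),
the potential density of the subordinator, is a convolution square root of the constant 1. -/
theorem lintegral_rootWeight_mul {r : ℝ} (hr : 0 < r) :
    ∫⁻ s in Ioo 0 r, rootWeight s * rootWeight (r - s) = 1 := by
  have h := lintegral_arcsin_deriv hr (v := fun s => 2 * s / r - 1) (v' := fun _ => 2 / r)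
    (by fun_prop) (by simp) (by field_simp; norm_num)
    (fun t _ => by
      have := (((hasDerivAt_id t).const_mul 2).div_const r).sub_const 1
      simpa using this)
    (fun t ht => by
      constructor
      · have : 0 < 2 * t / r := by have := ht.1; positivity
        linarith
      · have : 2 * t / r < 2 := by rw [div_lt_iff₀ hr]; linarith [ht.2]
        linarith) (fun _ _ => by positivity)
  have hpi : ENNReal.ofReal Real.pi ≠ 0 := by simp [Real.pi_pos]
  have e : ∀ s ∈ Ioo 0 r, rootWeight s * rootWeight (r - s) = (ENNReal.ofReal Real.pi)⁻¹ *
      ENNReal.ofReal (2 / r / Real.sqrt (1 - (2 * s / r - 1) ^ 2)) := by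
    intro s hs
    have h1 : 0 < s := hs.1
    have h2 : 0 < r - s := sub_pos.2 hs.2
    rw [rootWeight_eq h1, rootWeight_eq h2, ← ENNReal.ofReal_inv_of_pos Real.pi_pos,
      ← ENNReal.ofReal_mul (by positivity), ← ENNReal.ofReal_mul (by positivity)]
    congr 1
    have e1 : 1 - (2 * s / r - 1) ^ 2 = (2 / r) ^ 2 * (s * (r - s)) := by field_simp; ring
    have e3 : Real.sqrt ((2 / r) ^ 2 * (s * (r - s))) = 2 / r * Real.sqrt (s * (r - s)) := by
      rw [Real.sqrt_mul (by positivity), Real.sqrt_sq (by positivity)]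
    rw [e1, e3, ← mul_inv,
      ← Real.sqrt_mul (by positivity)]
    have e2 : Real.pi * s * (Real.pi * (r - s)) = Real.pi ^ 2 * (s * (r - s)) := by ring
    rw [e2, Real.sqrt_mul (by positivity), Real.sqrt_sq Real.pi_pos.le]
    have : 0 < Real.sqrt (s * (r - s)) := by positivity
    field_simp
  rw [setLIntegral_congr_fun measurableSet_Ioo e, lintegral_const_mul' _ _ (by simp [Real.pi_pos]),
    h, ENNReal.inv_mul_cancel hpi (by simp)]

/-- The density of the first jump over `b` of the range of a stable subordinator of index `1/2`. -/
noncomputable def overshoot (b t : ℝ) : ℝ≥0∞ :=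
  ENNReal.ofReal (if b < t then Real.sqrt b / (Real.pi * t * Real.sqrt (t - b)) else 0)

theorem measurable_overshoot (b : ℝ) : Measurable (overshoot b) := by
  unfold overshoot
  refine ENNReal.measurable_ofReal.comp (Measurable.ite measurableSet_Ioi ?_ measurable_const)
  fun_prop

/-- The strong Markov property of the subordinator at its first passage over b: potential density
beyond b is overshoot law followed by potential density. The Möbius function 2r(t - b)/(t(r - b)) -
1 maps (b,r) to (-1,1) and reduces the integral to the arcsine law. -/
theorem lintegral_overshoot_mul {b r : ℝ} (hb : 0 < b) (hr : 0 < r) :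
    ∫⁻ t in Ioo 0 r, overshoot b t * rootWeight (r - t) = if b < r then rootWeight r else 0 := by
  split_ifs with hbr
  · have hrb : 0 < r - b := sub_pos.2 hbr
    have h := lintegral_arcsin_deriv hbr (v := fun t => 2 * r * (t - b) / (t * (r - b)) - 1)
      (v' := fun t => 2 * r * b / (t ^ 2 * (r - b)))
      (ContinuousOn.sub (ContinuousOn.div (by fun_prop) (by fun_prop) fun t ht => by
        have : 0 < t := hb.trans_le ht.1
        positivity) continuousOn_const) (by simp) (by field_simp; norm_num)
      (fun t ht => by
        have ht0 : 0 < t := hb.trans ht.1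
        have h1 : HasDerivAt (fun t => 2 * r * (t - b)) (2 * r * 1) t :=
          ((hasDerivAt_id t).sub_const b).const_mul (2 * r)
        have h2 : HasDerivAt (fun t => t * (r - b)) (1 * (r - b)) t :=
          (hasDerivAt_id t).mul_const (r - b)
        have := (h1.div h2 (by positivity)).sub_const 1
        exact this.congr_deriv (by field_simp; ring))
      (fun t ht => by
        have ht0 : 0 < t := hb.trans ht.1
        have htb : 0 < t - b := sub_pos.2 ht.1
        have hrt : 0 < r - t := sub_pos.2 ht.2
        constructor
        · have : 0 < 2 * r * (t - b) / (t * (r - b)) := by positivity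
          linarith
        · have : 2 * r * (t - b) / (t * (r - b)) < 2 := by
            rw [div_lt_iff₀ (by positivity)]; nlinarith
          linarith) (fun t ht => by have := hb.trans ht.1; positivity)
    have hsplit : ∫⁻ t in Ioo 0 r, overshoot b t * rootWeight (r - t) =
        ∫⁻ t in Ioo b r, overshoot b t * rootWeight (r - t) := by
      rw [← Ioc_union_Ioo_eq_Ioo hb.le hbr, lintegral_union measurableSet_Ioo
        (Set.disjoint_left.2 fun t h1 h2 => not_lt_of_ge h1.2 h2.1)]
      have : ∫⁻ t in Ioc 0 b, overshoot b t * rootWeight (r - t) = ∫⁻ t in Ioc 0 b, 0 :=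
        setLIntegral_congr_fun measurableSet_Ioc fun t ht => by
          simp [overshoot, not_lt_of_ge ht.2]
      rw [this]; simp
    have hpi : ENNReal.ofReal Real.pi ≠ 0 := by simp [Real.pi_pos]
    have e : ∀ t ∈ Ioo b r, overshoot b t * rootWeight (r - t) =
        (ENNReal.ofReal Real.pi)⁻¹ * rootWeight r * ENNReal.ofReal (2 * r * b / (t ^ 2 * (r - b)) /
          Real.sqrt (1 - (2 * r * (t - b) / (t * (r - b)) - 1) ^ 2)) := by
      intro t ht
      have ht0 : 0 < t := hb.trans ht.1
      have htb : 0 < t - b := sub_pos.2 ht.1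
      have hrt : 0 < r - t := sub_pos.2 ht.2
      rw [overshoot, if_pos ht.1, rootWeight_eq hr, rootWeight_eq hrt,
        ← ENNReal.ofReal_inv_of_pos Real.pi_pos,
        ← ENNReal.ofReal_mul (by positivity), ← ENNReal.ofReal_mul (by positivity),
        ← ENNReal.ofReal_mul (by positivity)]
      congr 1
      have e1 : 1 - (2 * r * (t - b) / (t * (r - b)) - 1) ^ 2 =
          (2 / (t * (r - b))) ^ 2 * (r * b * (t - b) * (r - t)) := by field_simp; ring
      have e3 : Real.sqrt ((2 / (t * (r - b))) ^ 2 * (r * b * (t - b) * (r - t))) =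
          2 / (t * (r - b)) * (Real.sqrt r * Real.sqrt b * Real.sqrt (t - b) * Real.sqrt (r - t)) := by
        rw [Real.sqrt_mul (by positivity), Real.sqrt_sq (by positivity),
          Real.sqrt_mul (by positivity), Real.sqrt_mul (by positivity), Real.sqrt_mul (by positivity)]
      rw [e1, e3, Real.sqrt_mul Real.pi_pos.le, Real.sqrt_mul Real.pi_pos.le]
      have s1 := Real.sqrt_pos.2 hr
      have s2 := Real.sqrt_pos.2 hb
      have s3 := Real.sqrt_pos.2 htb
      have s4 := Real.sqrt_pos.2 hrt
      have s5 := Real.sqrt_pos.2 Real.pi_pos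
      have q1 := Real.sq_sqrt hr.le
      have q2 := Real.sq_sqrt hb.le
      field_simp
      rw [q1, q2]
    rw [hsplit, setLIntegral_congr_fun measurableSet_Ioo e, lintegral_const_mul'
      _ _ (by simp [rootWeight_eq hr, ← ENNReal.ofReal_inv_of_pos Real.pi_pos, ENNReal.mul_eq_top]), h, mul_right_comm, ENNReal.inv_mul_cancel hpi (by simp), one_mul]
  · have : ∫⁻ t in Ioo 0 r, overshoot b t * rootWeight (r - t) = ∫⁻ t in Ioo 0 r, 0 :=
      setLIntegral_congr_fun measurableSet_Ioo fun t ht => by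
        simp [overshoot, not_lt_of_ge (ht.2.le.trans (not_lt.1 hbr))]
    rw [this]; simp

end ArcsineIntegrals

end ProperNorms

namespace ProperNorms

/-! ### Time-weighted kernels, and the seminorm properties of ‖·‖_w and ‖·‖_Φ -/

section Kernels

variable {S : Type*} [MeasurableSpace S]

/-- `∫₀^∞ α(t) p_t(x,y) dt`. -/
noncomputable def timeKernel (p : ℝ → S → S → ℝ≥0∞) (α : ℝ → ℝ≥0∞) (x y : S) : ℝ≥0∞ :=
  ∫⁻ t in Ioi (0 : ℝ), α t * p t x y

variable {T : ℝ≥0 → S → Set S → ℝ≥0∞} {m : Measure S} [SigmaFinite m] {p : ℝ → S → S → ℝ≥0∞}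
  (hp : IsTransitionDensity T m p)

omit [MeasurableSpace S] in
theorem rootKernel_eq (x y : S) : rootKernel p x y = timeKernel p rootWeight x y := by
  unfold rootKernel timeKernel rootWeight
  simp_rw [div_eq_mul_inv, mul_comm]

include hp in
omit [SigmaFinite m] in
theorem IsTransitionDensity.measurable_comp {X : Type*} [MeasurableSpace X] {f : X → ℝ}
    {g h : X → S} (hf : Measurable f) (hg : Measurable g) (hh : Measurable h) :
    Measurable fun a => p (f a) (g a) (h a) :=
  hp.measurable.comp (hf.prodMk (hg.prodMk hh))

include hp in
omit [SigmaFinite m] in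
theorem measurable_timeKernel {α : ℝ → ℝ≥0∞} (hα : Measurable α) :
    Measurable fun q : S × S => timeKernel p α q.1 q.2 := by
  refine Measurable.lintegral_prod_right' (f := fun r : (S × S) × ℝ => α r.2 * p r.2 r.1.1 r.1.2) ?_
  exact (by fun_prop : Measurable fun r : (S × S) × ℝ => α r.2).mul
    (hp.measurable_comp (by fun_prop) (by fun_prop) (by fun_prop))

include hp in
-- By the Chapman–Kolmogorov equation composition in space becomes convolution of the weights in
-- time, after the substitution r = s + t.
theorem lintegral_timeKernel_mul {α β : ℝ → ℝ≥0∞} (hα : Measurable α) (hβ : Measurable β)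
    (x y : S) : ∫⁻ z, timeKernel p α x z * timeKernel p β z y ∂m =
      timeKernel p (fun r => ∫⁻ s in Ioo 0 r, α s * β (r - s)) x y := by
  have mx : Measurable fun q : S × ℝ => α q.2 * p q.2 x q.1 :=
    (by fun_prop : Measurable fun q : S × ℝ => α q.2).mul
      (hp.measurable_comp (by fun_prop) (by fun_prop) (by fun_prop))
  have my : Measurable fun q : S × ℝ => β q.2 * p q.2 q.1 y :=
    (by fun_prop : Measurable fun q : S × ℝ => β q.2).mul
      (hp.measurable_comp (by fun_prop) (by fun_prop) (by fun_prop))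
  have mK : Measurable fun z => timeKernel p β z y := my.lintegral_prod_right'
  calc ∫⁻ z, timeKernel p α x z * timeKernel p β z y ∂m
      = ∫⁻ z, (∫⁻ s in Ioi (0 : ℝ), α s * p s x z * timeKernel p β z y) ∂m := by
        refine lintegral_congr fun z => ?_
        exact (lintegral_mul_const (f := fun s => α s * p s x z) _
          (mx.comp measurable_prodMk_left)).symm
    _ = ∫⁻ s in Ioi (0 : ℝ), ∫⁻ z, α s * p s x z * timeKernel p β z y ∂m :=
        lintegral_lintegral_swap (mx.mul (mK.comp measurable_fst)).aemeasurable
    _ = ∫⁻ s in Ioi (0 : ℝ), ∫⁻ t in Ioi (0 : ℝ), α s * β t * p (s + t) x y := by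
        refine setLIntegral_congr_fun measurableSet_Ioi fun s hs => ?_
        have e : ∀ z, α s * p s x z * timeKernel p β z y =
            ∫⁻ t in Ioi (0 : ℝ), α s * p s x z * (β t * p t z y) := fun z =>
          (lintegral_const_mul _ (my.comp measurable_prodMk_left)).symm
        simp_rw [e]
        rw [lintegral_lintegral_swap]
        · refine setLIntegral_congr_fun measurableSet_Ioi fun t ht => ?_
          have e2 : ∀ z, α s * p s x z * (β t * p t z y) = α s * β t * (p s x z * p t z y) :=
            fun z => by ring
          simp_rw [e2]
          rw [lintegral_const_mul, hp.chapman_kolmogorov s t hs ht]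
          exact (hp.measurable_comp measurable_const measurable_const measurable_id).mul
            (hp.measurable_comp measurable_const measurable_id measurable_const)
        · refine Measurable.aemeasurable ?_
          exact (measurable_const.mul (hp.measurable_comp measurable_const measurable_const
            measurable_fst)).mul my
    _ = ∫⁻ s in Ioi (0 : ℝ), ∫⁻ r, (Ioi s).indicator (fun r => α s * β (r - s) * p r x y) r := by
        refine setLIntegral_congr_fun measurableSet_Ioi fun s hs => ?_
        rw [← lintegral_indicator measurableSet_Ioi, ← lintegral_sub_right_eq_self _ s]
        refine lintegral_congr fun r => ?_
        simp [indicator, sub_pos]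
    _ = ∫⁻ r, ∫⁻ s in Ioi (0 : ℝ), (Ioi s).indicator (fun r => α s * β (r - s) * p r x y) r := by
        rw [lintegral_lintegral_swap]
        refine Measurable.aemeasurable ?_
        have : (Function.uncurry fun s r => (Ioi s).indicator (fun r => α s * β (r - s) * p r x y) r)
          = fun q : ℝ × ℝ => {q : ℝ × ℝ | q.1 < q.2}.indicator
            (fun q => α q.1 * β (q.2 - q.1) * p q.2 x y) q := by
          ext q; simp [indicator, Function.uncurry]
        rw [this]
        refine Measurable.indicator ?_ (measurableSet_lt measurable_fst measurable_snd)
        exact (by fun_prop : Measurable fun q : ℝ × ℝ => α q.1 * β (q.2 - q.1)).mul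
          (hp.measurable_comp measurable_snd measurable_const measurable_const)
    _ = _ := by
        rw [timeKernel, ← lintegral_indicator measurableSet_Ioi]
        refine lintegral_congr fun r => ?_
        by_cases hr : 0 < r
        · rw [indicator_of_mem (show r ∈ Ioi (0 : ℝ) from hr), ← lintegral_mul_const _ (by fun_prop),
            ← lintegral_indicator measurableSet_Ioi, ← lintegral_indicator measurableSet_Ioo]
          refine lintegral_congr fun s => ?_
          by_cases h0 : 0 < s <;> by_cases hsr : s < r <;> simp [indicator, h0, hsr]
        · rw [indicator_of_notMem (by simpa using hr)]
          have : ∫⁻ s in Ioi (0 : ℝ), (Ioi s).indicator (fun r => α s * β (r - s) * p r x y) r =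
              ∫⁻ s in Ioi (0 : ℝ), 0 := setLIntegral_congr_fun measurableSet_Ioi fun s hs => by
            have : ¬ s < r := fun h => hr (lt_trans hs h)
            simp [indicator, this]
          rw [this]; simp

omit [MeasurableSpace S] in
theorem timeKernel_congr {α β : ℝ → ℝ≥0∞} (h : ∀ t, 0 < t → α t = β t) (x y : S) :
    timeKernel p α x y = timeKernel p β x y :=
  setLIntegral_congr_fun measurableSet_Ioi fun t ht => by simp only [h t ht]

omit [MeasurableSpace S] in
theorem potential_eq (x y : S) : potential p x y = timeKernel p 1 x y := by
  simp [potential, timeKernel]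

include hp in
-- The convolution identity for 1/√(πt) makes `rootKernel` a square root of the potential operator.
theorem potential_eq_lintegral_rootKernel (x y : S) :
    potential p x y = ∫⁻ z, rootKernel p x z * rootKernel p z y ∂m := by
  simp_rw [rootKernel_eq]
  rw [lintegral_timeKernel_mul hp measurable_rootWeight measurable_rootWeight, potential_eq]
  exact timeKernel_congr (fun t ht => by simp [lintegral_rootWeight_mul ht]) x y

include hp in
omit [SigmaFinite m] in
theorem measurable_rootKernel : Measurable fun q : S × S => rootKernel p q.1 q.2 := by
  simp_rw [rootKernel_eq]
  exact measurable_timeKernel hp measurable_rootWeight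

include hp in
theorem wNorm_eq_mixedNorm (ν : SignedMeasure S) : wNorm m p ν =
    mixedNorm m (fun y h => rootKernel p y h) (fun y h => rootKernel p h y) ν := by
  have mw := measurable_rootKernel hp
  rw [wNorm, mixedNorm, kernelNorm, lintegral_prod]
  exact ((measurable_absInt_mixed (a := fun y h => rootKernel p y h)
    (b := fun y h => rootKernel p h y) mw (mw.comp measurable_swap) ν).pow_const 2).aemeasurable

include hp in
theorem isProperSeminorm_wNorm : IsProperSeminorm univ (potential p) (wNorm m p) := by
  have mw := measurable_rootKernel hp
  have mw' : Measurable fun q : S × S => rootKernel p q.2 q.1 := mw.comp measurable_swap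
  rw [funext (wNorm_eq_mixedNorm hp)]
  exact isProperSeminorm_of_mixedNorm_le (b := fun y h => rootKernel p h y) mw mw'
    (potential_eq_lintegral_rootKernel hp)
    (mixedNorm_smul mw mw' m) (mixedNorm_add_le mw mw' m) fun ν => le_rfl

/-- The time-space reference measure. -/
noncomputable abbrev timeSpace (m : Measure S) : Measure (ℝ × S) :=
  (volume.restrict (Ioi (0 : ℝ))).prod m

/-- `p_{s/2}(x,v)` as a function of `x` and `(s,v)`. -/
noncomputable def halfForward (p : ℝ → S → S → ℝ≥0∞) (x : S) (h : ℝ × S) : ℝ≥0∞ := p (h.1 / 2) x h.2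

/-- `p_{s/2}(v,x)` as a function of `x` and `(s,v)`. -/
noncomputable def halfBackward (p : ℝ → S → S → ℝ≥0∞) (x : S) (h : ℝ × S) : ℝ≥0∞ := p (h.1 / 2) h.2 x

include hp in
omit [SigmaFinite m] in
theorem measurable_halfForward : Measurable fun q : S × (ℝ × S) => halfForward p q.1 q.2 :=
  hp.measurable_comp (by fun_prop) (by fun_prop) (by fun_prop)

include hp in
omit [SigmaFinite m] in
theorem measurable_halfBackward : Measurable fun q : S × (ℝ × S) => halfBackward p q.1 q.2 :=
  hp.measurable_comp (by fun_prop) (by fun_prop) (by fun_prop)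

include hp in
theorem phi_eq (x y : S) : phi m p x y =
    (∫⁻ h, halfForward p x h * halfForward p y h ∂timeSpace m) *
      ∫⁻ h, halfBackward p x h * halfBackward p y h ∂timeSpace m := by
  have m1 := measurable_halfForward hp
  have m2 := measurable_halfBackward hp
  rw [phi, thetaL, thetaR, lintegral_prod _ (by fun_prop), lintegral_prod _ (by fun_prop)]
  rfl

include hp in
-- Chapman–Kolmogorov at the midpoint of [0,s], with s kept as a coordinate of the auxiliary space.
theorem potential_eq_lintegral_half (x y : S) : potential p x y =
    ∫⁻ h, halfForward p x h * halfBackward p y h ∂timeSpace m := by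
  have m1 := measurable_halfForward hp
  have m2 := measurable_halfBackward hp
  rw [potential, lintegral_prod _ (by fun_prop)]
  refine setLIntegral_congr_fun measurableSet_Ioi fun t ht => ?_
  have := hp.chapman_kolmogorov (t / 2) (t / 2) (half_pos ht) (half_pos ht) x y
  rw [add_halves] at this
  exact this

include hp in
theorem isProperSeminorm_phiNorm : IsProperSeminorm univ (potential p) (phiNorm m p) :=
  isProperSeminorm_quadNorm (measurable_halfForward hp) (measurable_halfBackward hp) (phi_eq hp)
    (potential_eq_lintegral_half hp)

include hp in
theorem quadForm_phi_nonneg {ν : SignedMeasure S} (h : FormConverges (phi m p) ν) :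
    0 ≤ quadForm (phi m p) ν :=
  quadForm_nonneg (measurable_halfForward hp) (measurable_halfBackward hp) (phi_eq hp) h

end Kernels

end ProperNorms

namespace ProperNorms

/-! ### Consequences of right continuity at time zero -/

section Uniqueness

variable {S Ω : Type*} [TopologicalSpace S] [MeasurableSpace S] [BorelSpace S] [MeasurableSpace Ω]
  {X : MarkovProcess S Ω}

omit [TopologicalSpace S] [BorelSpace S] in
theorem MarkovProcess.measurableSet_inEvent (X : MarkovProcess S Ω) (t : ℝ≥0) {A : Set S}
    (hA : MeasurableSet A) : MeasurableSet (inEvent (X.path t) A) :=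
  X.filt.le t _ (X.adapted t A hA)

omit [BorelSpace S] in
theorem MarkovProcess.RightContinuous.ae_tendsto (hX : X.RightContinuous) (y : S) :
    ∀ᵐ ω ∂X.law y, Tendsto (fun t => X.path t ω) (𝓝[>] 0) (𝓝 (y : OnePoint S)) := by
  filter_upwards [hX y, X.start y] with ω h1 h2
  have := h1 0
  rw [ContinuousWithinAt, h2] at this
  exact this.mono_left (nhdsWithin_mono _ Ioi_subset_Ici_self)

/-- Almost every path from y remains in O during a short time, because O is open in the one-point
extension too; dominated convergence gives the limit. -/
theorem MarkovProcess.RightContinuous.tendsto_trans_compl (hX : X.RightContinuous) {y : S}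
    {O : Set S} (hO : IsOpen O) (hy : y ∈ O) :
    Tendsto (fun t => X.trans t y Oᶜ) (𝓝[>] 0) (𝓝 0) := by
  have := X.isProb y
  have hm : ∀ t, MeasurableSet (inEvent (X.path t) Oᶜ) := fun t =>
    X.measurableSet_inEvent t hO.measurableSet.compl
  have e : ∀ t, X.trans t y Oᶜ = ∫⁻ ω, (inEvent (X.path t) Oᶜ).indicator 1 ω ∂X.law y := fun t => by
    rw [lintegral_indicator_one (hm t)]; rfl
  simp_rw [e]
  have h0 : (0 : ℝ≥0∞) = ∫⁻ _, 0 ∂X.law y := by simp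
  rw [h0]
  refine tendsto_lintegral_filter_of_dominated_convergence (fun _ => 1)
    (Eventually.of_forall fun t => measurable_one.indicator (hm t))
    (Eventually.of_forall fun t => Eventually.of_forall fun ω => indicator_le_self' (by simp) ω)
    (by simp) ?_
  filter_upwards [hX.ae_tendsto y] with ω hω
  have hO' : IsOpen ((fun z : S => (z : OnePoint S)) '' O) :=
    OnePoint.isOpenEmbedding_coe.isOpenMap O hO
  refine tendsto_const_nhds.congr' ?_
  filter_upwards [hω.eventually (hO'.mem_nhds (mem_image_of_mem _ hy))] with t ht
  rw [indicator_of_notMem]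
  rintro ⟨z, hz, hz'⟩
  obtain ⟨z', h1, h2⟩ := ht
  rw [hz'] at h2
  rw [OnePoint.coe_injective h2] at h1
  exact hz h1

omit [BorelSpace S] in
theorem MarkovProcess.RightContinuous.tendsto_trans_univ (hX : X.RightContinuous) (y : S) :
    Tendsto (fun t => X.trans t y univ) (𝓝[>] 0) (𝓝 1) := by
  have := X.isProb y
  have hm : ∀ t, MeasurableSet (inEvent (X.path t) univ) := fun t =>
    X.measurableSet_inEvent t MeasurableSet.univ
  have e : ∀ t, X.trans t y univ = ∫⁻ ω, (inEvent (X.path t) univ).indicator 1 ω ∂X.law y :=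
    fun t => by rw [lintegral_indicator_one (hm t)]; rfl
  simp_rw [e]
  have h0 : (1 : ℝ≥0∞) = ∫⁻ _, 1 ∂X.law y := by simp
  rw [h0]
  refine tendsto_lintegral_filter_of_dominated_convergence (fun _ => 1)
    (Eventually.of_forall fun t => measurable_one.indicator (hm t))
    (Eventually.of_forall fun t => Eventually.of_forall fun ω => indicator_le_self' (by simp) ω)
    (by simp) ?_
  filter_upwards [hX.ae_tendsto y] with ω hω
  refine tendsto_const_nhds.congr' ?_
  filter_upwards [hω.eventually (OnePoint.isOpenEmbedding_coe.isOpen_range.mem_nhds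
    (mem_range_self y))] with t ht
  obtain ⟨z, hz⟩ := ht
  rw [indicator_of_mem]
  · rfl
  · exact ⟨z, mem_univ _, hz.symm⟩

theorem tendsto_toNNReal_nhdsGT : Tendsto Real.toNNReal (𝓝[>] 0) (𝓝[>] 0) := by
  refine tendsto_nhdsWithin_iff.2 ⟨?_, ?_⟩
  · have := continuous_real_toNNReal.tendsto 0
    rw [Real.toNNReal_zero] at this
    exact this.mono_left nhdsWithin_le_nhds
  · filter_upwards [self_mem_nhdsWithin] with t ht
    exact Real.toNNReal_pos.2 ht

variable {m : Measure S} [SigmaFinite m] {p : ℝ → S → S → ℝ≥0∞}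
  (hp : IsTransitionDensity X.trans m p)

include hp in
omit [TopologicalSpace S] [BorelSpace S] [SigmaFinite m] in
theorem setLIntegral_density {t : ℝ} (ht : 0 < t) (y : S) {A : Set S} (hA : MeasurableSet A) :
    ∫⁻ z in A, p t y z ∂m = X.trans t.toNNReal y A := by
  rw [hp.density t.toNNReal (Real.toNNReal_pos.2 ht) y A hA, Real.coe_toNNReal t ht.le]

include hp in
omit [TopologicalSpace S] [BorelSpace S] [SigmaFinite m] in
theorem lintegral_density_le_one {t : ℝ} (ht : 0 < t) (y : S) : ∫⁻ z, p t y z ∂m ≤ 1 := by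
  have := X.isProb y
  rw [← setLIntegral_univ, setLIntegral_density hp ht y MeasurableSet.univ]
  exact prob_le_one

include hp in
omit [SigmaFinite m] in
theorem tendsto_setLIntegral_density_compl (hX : X.RightContinuous) {y : S} {O : Set S}
    (hO : IsOpen O) (hy : y ∈ O) :
    Tendsto (fun t => ∫⁻ z in Oᶜ, p t y z ∂m) (𝓝[>] 0) (𝓝 0) := by
  refine ((hX.tendsto_trans_compl hO hy).comp tendsto_toNNReal_nhdsGT).congr' ?_
  filter_upwards [self_mem_nhdsWithin] with t ht
  exact (setLIntegral_density hp ht y hO.measurableSet.compl).symm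

/-- A property of almost every time holds at arbitrarily small times, which is enough to compare
limits already known to exist. -/
theorem frequently_of_ae_Ioi {P : ℝ → Prop} (h : ∀ᵐ t ∂volume.restrict (Ioi (0 : ℝ)), P t) :
    ∃ᶠ t in 𝓝[>] (0 : ℝ), P t := by
  rw [ae_restrict_iff' measurableSet_Ioi] at h
  rw [Filter.frequently_iff]
  intro U hU
  obtain ⟨ε, hε, hεU⟩ := mem_nhdsGT_iff_exists_Ioo_subset.1 hU
  have : volume (Ioo 0 ε) ≠ 0 := by simpa using hε
  obtain ⟨t, ht, ht'⟩ := ((frequently_ae_mem_iff.2 this).and_eventually h).exists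
  exact ⟨t, hεU ht, ht' ht.1⟩

include hp in
omit [TopologicalSpace S] [BorelSpace S] in
theorem lintegral_timeKernel_mul_fun {α : ℝ → ℝ≥0∞} (hα : Measurable α) {f : S → ℝ≥0∞}
    (hf : Measurable f) (y : S) : ∫⁻ z, timeKernel p α y z * f z ∂m =
      ∫⁻ t in Ioi (0 : ℝ), α t * ∫⁻ z, p t y z * f z ∂m := by
  have mp3 : Measurable fun q : ℝ × S × S => p q.1 q.2.1 q.2.2 := hp.measurable
  have e0 : ∀ z, timeKernel p α y z * f z = ∫⁻ t in Ioi (0 : ℝ), α t * (p t y z * f z) := fun z => by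
    simp_rw [← mul_assoc]
    exact (lintegral_mul_const (f := fun s => α s * p s y z) _ (by fun_prop)).symm
  simp_rw [e0]
  refine (lintegral_lintegral_swap (Measurable.aemeasurable ?_)).trans ?_
  · have : Measurable fun q : S × ℝ => α q.2 * (p q.2 y q.1 * f q.1) := by fun_prop
    exact this
  · exact lintegral_congr fun t => lintegral_const_mul _ (by fun_prop)

include hp in
omit [BorelSpace S] in
-- A vanishing integral would mean that the process started at y is dead at almost every time,
-- whereas its survival probability tends to 1.
theorem lintegral_timeKernel_mul_ne_zero (hX : X.RightContinuous) {α : ℝ → ℝ≥0∞}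
    (hα : Measurable α) (hα0 : ∀ t, 0 < t → α t ≠ 0) {f : S → ℝ≥0∞} (hf : Measurable f)
    (hf0 : ∀ᵐ z ∂m, f z ≠ 0) (y : S) : ∫⁻ z, timeKernel p α y z * f z ∂m ≠ 0 := by
  intro h0
  have mp3 : Measurable fun q : ℝ × S × S => p q.1 q.2.1 q.2.2 := hp.measurable
  rw [lintegral_timeKernel_mul_fun hp hα hf] at h0
  have h0 := (lintegral_eq_zero_iff (hα.mul (Measurable.lintegral_prod_left'
    (f := fun q : S × ℝ => p q.2 y q.1 * f q.1) (by fun_prop)))).1 h0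
  have h1 : ∀ᵐ t ∂volume.restrict (Ioi (0 : ℝ)), X.trans t.toNNReal y univ = 0 := by
    filter_upwards [h0, ae_restrict_mem measurableSet_Ioi] with t ht ht0
    have ht0' : 0 < t := ht0
    rw [← setLIntegral_density hp ht0' y MeasurableSet.univ, setLIntegral_univ,
      lintegral_eq_zero_iff (by fun_prop)]
    simp only [Pi.zero_apply, Pi.mul_apply, mul_eq_zero, hα0 t ht0', false_or] at ht
    rw [lintegral_eq_zero_iff (by fun_prop)] at ht
    filter_upwards [ht, hf0] with z hz hz'
    simpa [hz'] using hz
  have := tendsto_nhds_unique_of_frequently_eq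
    ((hX.tendsto_trans_univ y).comp tendsto_toNNReal_nhdsGT) (tendsto_const_nhds (x := 0))
    (frequently_of_ae_Ioi h1)
  exact one_ne_zero this

include hp in
omit [SigmaFinite m] in
-- As g ≤ 1, P_t(fg)(y) differs from f(y) P_t g(y) by at most P_t d(y) with d = |f - f(y)|, and this
-- error tends to 0 by right continuity. No continuity of `g` is needed.
theorem tendsto_lintegral_density_mul (hX : X.RightContinuous) {f : S → ℝ≥0} (hf : Continuous f)
    {M : ℝ≥0} (hM : ∀ z, f z ≤ M) {g : S → ℝ≥0∞} (hg : Measurable g) (hg1 : ∀ z, g z ≤ 1) {y : S}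
    (hgy : Tendsto (fun t => ∫⁻ z, p t y z * g z ∂m) (𝓝[>] 0) (𝓝 (g y))) :
    Tendsto (fun t => ∫⁻ z, p t y z * (f z * g z) ∂m) (𝓝[>] 0) (𝓝 (f y * g y)) := by
  have mp : ∀ t, Measurable (p t y) := fun t =>
    hp.measurable_comp measurable_const measurable_const measurable_id
  have mf := hf.measurable
  let d : S → ℝ≥0∞ := fun z => (nndist (f z) (f y) : ℝ≥0)
  have md : Measurable d := by
    have : Continuous fun z => nndist (f z) (f y) := by fun_prop
    exact this.measurable.coe_nnreal_ennreal
  have hd : Tendsto (fun t => ∫⁻ z, p t y z * d z ∂m) (𝓝[>] 0) (𝓝 0) := by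
    refine ENNReal.tendsto_nhds_zero.2 fun ε hε => ?_
    obtain ⟨δ, hδ0, hδ⟩ : ∃ δ : ℝ≥0, 0 < δ ∧ (δ : ℝ≥0∞) + δ ≤ ε := by
      obtain ⟨δ, h1, h2⟩ := ENNReal.lt_iff_exists_nnreal_btwn.1 (ENNReal.half_pos hε.ne')
      refine ⟨δ, by simpa using h1, ?_⟩
      calc (δ : ℝ≥0∞) + δ ≤ ε / 2 + ε / 2 := add_le_add h2.le h2.le
        _ = ε := ENNReal.add_halves ε
    -- On `O` the oscillation of f is below δ; outside it d ≤ 2M, and the mass that P_t carries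
    -- there tends to 0.
    let O : Set S := {z | nndist (f z) (f y) < δ}
    have hO : IsOpen O := isOpen_lt (by fun_prop) continuous_const
    have hyO : y ∈ O := by simpa [O] using hδ0
    have hlim := ENNReal.Tendsto.const_mul (a := ((M : ℝ≥0∞) + M))
      (tendsto_setLIntegral_density_compl hp hX hO hyO) (Or.inr (by simp))
    rw [mul_zero] at hlim
    filter_upwards [ENNReal.tendsto_nhds_zero.1 hlim δ (by simpa using hδ0),
      self_mem_nhdsWithin] with t h1 ht
    have ht0 : 0 < t := ht
    refine le_trans ?_ hδ
    rw [← lintegral_add_compl _ hO.measurableSet]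
    refine add_le_add ?_ (le_trans ?_ h1)
    · calc ∫⁻ z in O, p t y z * d z ∂m ≤ ∫⁻ z in O, p t y z * δ ∂m := by
            refine setLIntegral_mono' hO.measurableSet fun z hz => ?_
            gcongr
            exact ENNReal.coe_le_coe.2 (le_of_lt hz)
        _ ≤ ∫⁻ z, p t y z * δ ∂m := setLIntegral_le_lintegral _ _
        _ = (∫⁻ z, p t y z ∂m) * δ := lintegral_mul_const _ (mp t)
        _ ≤ 1 * δ := by gcongr; exact lintegral_density_le_one hp ht0 y
        _ = δ := one_mul _
    · rw [← lintegral_const_mul _ (mp t)]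
      refine lintegral_mono fun z => ?_
      rw [mul_comm]
      gcongr
      rw [← ENNReal.coe_add]
      refine ENNReal.coe_le_coe.2 ?_
      have := nndist_triangle_right (f z) (f y) 0
      rw [NNReal.nndist_zero_eq_val', NNReal.nndist_zero_eq_val'] at this
      exact this.trans (add_le_add (hM z) (hM y))
  have hfd : ∀ z, (f z : ℝ≥0∞) ≤ f y + d z ∧ (f y : ℝ≥0∞) ≤ f z + d z := by
    intro z
    constructor
    · rw [← ENNReal.coe_add]
      refine ENNReal.coe_le_coe.2 ?_
      exact NNReal.le_add_nndist _ _
    · rw [← ENNReal.coe_add]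
      refine ENNReal.coe_le_coe.2 ?_
      rw [nndist_comm]
      exact NNReal.le_add_nndist _ _
  have hmain := ENNReal.Tendsto.const_mul (a := (f y : ℝ≥0∞)) hgy (Or.inr (by simp))
  have up : ∀ t, ∫⁻ z, p t y z * (f z * g z) ∂m ≤
      f y * (∫⁻ z, p t y z * g z ∂m) + ∫⁻ z, p t y z * d z ∂m := by
    intro t
    rw [← lintegral_const_mul _ (by fun_prop), ← lintegral_add_right _ (by fun_prop)]
    refine lintegral_mono fun z => ?_
    calc p t y z * (f z * g z) ≤ p t y z * ((f y + d z) * g z) := by gcongr; exact (hfd z).1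
      _ = f y * (p t y z * g z) + p t y z * (d z * g z) := by ring
      _ ≤ f y * (p t y z * g z) + p t y z * (d z * 1) := by gcongr; exact hg1 z
      _ = _ := by rw [mul_one]
  have low : ∀ t, f y * (∫⁻ z, p t y z * g z ∂m) ≤
      ∫⁻ z, p t y z * (f z * g z) ∂m + ∫⁻ z, p t y z * d z ∂m := by
    intro t
    rw [← lintegral_const_mul _ (by fun_prop), ← lintegral_add_right _ (by fun_prop)]
    refine lintegral_mono fun z => ?_
    calc f y * (p t y z * g z) ≤ (f z + d z) * (p t y z * g z) := by gcongr; exact (hfd z).2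
      _ = p t y z * (f z * g z) + p t y z * (d z * g z) := by ring
      _ ≤ p t y z * (f z * g z) + p t y z * (d z * 1) := by gcongr; exact hg1 z
      _ = _ := by rw [mul_one]
  have t1 : Tendsto (fun t => f y * (∫⁻ z, p t y z * g z ∂m) - ∫⁻ z, p t y z * d z ∂m) (𝓝[>] 0)
      (𝓝 (f y * g y - 0)) :=
    ENNReal.Tendsto.sub hmain hd (Or.inr (by simp))
  have t2 := hmain.add hd
  rw [tsub_zero] at t1
  rw [add_zero] at t2
  exact tendsto_of_tendsto_of_tendsto_of_le_of_le t1 t2 (fun t => tsub_le_iff_right.2 (low t)) up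

/-- `e^{-t}` -/
noncomputable def expWeight (t : ℝ) : ℝ≥0∞ := ENNReal.ofReal (Real.exp (-t))

theorem measurable_expWeight : Measurable expWeight := by unfold expWeight; fun_prop

theorem expWeight_add (s t : ℝ) : expWeight (s + t) = expWeight s * expWeight t := by
  rw [expWeight, expWeight, expWeight, ← ENNReal.ofReal_mul (Real.exp_nonneg _), ← Real.exp_add]
  congr 2; ring

include hp in
omit [TopologicalSpace S] [BorelSpace S] in
-- Shifts the time integral of the 1-resolvent g of `k` by t. The right side increases to g(y) as t
-- decreases to 0, so this expresses that g is 1-excessive.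
theorem expWeight_mul_lintegral_density {k : S → ℝ≥0∞} (hk : Measurable k) {t : ℝ} (ht : 0 < t)
    (y : S) :
    expWeight t * ∫⁻ z, p t y z * (∫⁻ x, timeKernel p expWeight z x * k x ∂m) ∂m =
      ∫⁻ r in Ioi t, expWeight r * ∫⁻ x, p r y x * k x ∂m := by
  have me := measurable_expWeight
  have mp3 : Measurable fun q : ℝ × S × S => p q.1 q.2.1 q.2.2 := hp.measurable
  have mI : Measurable fun q : ℝ × S => ∫⁻ x, p q.1 q.2 x * k x ∂m :=
    Measurable.lintegral_prod_right' (f := fun r : (ℝ × S) × S => p r.1.1 r.1.2 r.2 * k r.2)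
      ((hp.measurable_comp (by fun_prop) (by fun_prop) (by fun_prop)).mul (by fun_prop))
  have mt : ∀ t, Measurable fun z => p t y z := fun t =>
    hp.measurable_comp measurable_const measurable_const measurable_id
  have e2 : ∫⁻ z, p t y z * (∫⁻ x, timeKernel p expWeight z x * k x ∂m) ∂m =
      ∫⁻ s in Ioi (0 : ℝ), expWeight s * ∫⁻ x, p (t + s) y x * k x ∂m := by
    have : ∀ z, p t y z * (∫⁻ x, timeKernel p expWeight z x * k x ∂m) =
        ∫⁻ s in Ioi (0 : ℝ), p t y z * (expWeight s * ∫⁻ x, p s z x * k x ∂m) := by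
      intro z
      rw [lintegral_timeKernel_mul_fun hp me hk, lintegral_const_mul]
      exact me.mul (mI.comp (measurable_id.prodMk measurable_const))
    simp_rw [this]
    rw [lintegral_lintegral_swap]
    · refine setLIntegral_congr_fun measurableSet_Ioi fun s hs => ?_
      have ms : Measurable fun q : S × S => p s q.1 q.2 :=
        hp.measurable_comp measurable_const measurable_fst measurable_snd
      have mts := mt t
      have : ∀ z, p t y z * (expWeight s * ∫⁻ x, p s z x * k x ∂m) =
          expWeight s * ∫⁻ x, p t y z * (p s z x * k x) ∂m := by
        intro z
        rw [lintegral_const_mul _ (by fun_prop)]; ring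
      simp_rw [this]
      rw [lintegral_const_mul _ (Measurable.lintegral_prod_right'
        (f := fun q : S × S => p t y q.1 * (p s q.1 q.2 * k q.2)) (by fun_prop)),
        lintegral_lintegral_swap (by fun_prop)]
      congr 1
      refine lintegral_congr fun x => ?_
      simp_rw [← mul_assoc]
      rw [lintegral_mul_const _ (by fun_prop), hp.chapman_kolmogorov t s ht hs]
    · refine Measurable.aemeasurable ?_
      refine ((mt t).comp measurable_fst).mul ((me.comp measurable_snd).mul ?_)
      exact mI.comp (measurable_snd.prodMk measurable_fst)
  have mR : Measurable fun r => expWeight r * ∫⁻ x, p r y x * k x ∂m :=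
    me.mul (mI.comp (measurable_id.prodMk measurable_const))
  rw [e2, ← lintegral_const_mul, ← lintegral_indicator measurableSet_Ioi,
    ← lintegral_indicator measurableSet_Ioi]
  · refine Eq.trans ?_ (lintegral_add_left_eq_self _ t)
    refine lintegral_congr fun s => ?_
    by_cases hs : 0 < s
    · simp [indicator, hs, expWeight_add, mul_assoc]
    · simp [indicator, hs]
  · exact me.mul (mI.comp ((measurable_const_add t).prodMk measurable_const))

end Uniqueness

end ProperNorms

namespace ProperNorms

/-! ### A measure is determined by its transition densities -/

section Determination

theorem lintegral_expWeight : ∫⁻ t in Ioi (0 : ℝ), expWeight t = 1 := by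
  unfold expWeight
  rw [← ofReal_integral_eq_lintegral_ofReal (integrableOn_exp_neg_Ioi 0)
    (Eventually.of_forall fun t => (Real.exp_pos _).le), integral_exp_neg_Ioi_zero]
  simp

theorem expWeight_neg_mul (t : ℝ) : expWeight (-t) * expWeight t = 1 := by
  rw [← expWeight_add]; simp [expWeight]

variable {S Ω : Type*} [TopologicalSpace S] [MeasurableSpace S] [BorelSpace S] [MeasurableSpace Ω]
  {X : MarkovProcess S Ω} {m : Measure S} [SigmaFinite m] {p : ℝ → S → S → ℝ≥0∞}
  (hp : IsTransitionDensity X.trans m p)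

include hp in
-- The measures may be infinite, so they are first multiplied by the 1-resolvent g of a function k
-- so small that g is integrable. For bounded continuous f, P_t(fg) tends to fg and is dominated by
-- a multiple of g. Since ∫ P_t(fg) dμ depends on μ only through the densities ∫ p_t(y,·) dμ(y), the
-- limits for μ₁ and μ₂ agree. As 0 < g < ∞, the factor g can be divided out.
theorem measure_eq_of_lintegral_density_eq [LocallyCompactSpace S] [T2Space S]
    [SecondCountableTopology S] (hX : X.RightContinuous) {μ₁ μ₂ : Measure S} [SFinite μ₁]
    [SFinite μ₂] (h₁ : ∀ᵐ z ∂m, ∫⁻ y, timeKernel p expWeight y z ∂μ₁ < ∞)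
    (h₂ : ∀ᵐ z ∂m, ∫⁻ y, timeKernel p expWeight y z ∂μ₂ < ∞)
    (h : ∀ᵐ t ∂volume.restrict (Ioi (0 : ℝ)), ∀ᵐ z ∂m, ∫⁻ y, p t y z ∂μ₁ = ∫⁻ y, p t y z ∂μ₂) :
    μ₁ = μ₂ := by
  have mp3 : Measurable fun q : ℝ × S × S => p q.1 q.2.1 q.2.2 := hp.measurable
  have mv : Measurable fun q : S × S => timeKernel p expWeight q.1 q.2 :=
    measurable_timeKernel hp measurable_expWeight
  let H : Measure S → S → ℝ≥0∞ := fun μ z => ∫⁻ y, timeKernel p expWeight y z ∂μ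
  have mH : ∀ (μ : Measure S) [SFinite μ], Measurable (H μ) := fun μ _ =>
    Measurable.lintegral_prod_left' mv
  obtain ⟨k₀, hk₀, mk₀, ik₀⟩ := exists_pos_lintegral_lt_of_sigmaFinite m (one_ne_zero' ℝ≥0∞)
  -- The denominator bounds ∫ g dμᵢ = ∫ k · H μᵢ dm by ∫ k₀ dm < 1; the minimum with 1 yields g ≤ 1.
  let k : S → ℝ≥0∞ := fun z => min 1 (k₀ z / (1 + H μ₁ z + H μ₂ z))
  have mk : Measurable k := by
    have := mH μ₁
    have := mH μ₂
    fun_prop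
  have hk1 : ∀ z, k z ≤ 1 := fun z => min_le_left _ _
  have hk0 : ∀ᵐ z ∂m, k z ≠ 0 := by
    filter_upwards [h₁, h₂] with z hz1 hz2
    have : (k₀ z : ℝ≥0∞) / (1 + H μ₁ z + H μ₂ z) ≠ 0 := by
      refine (ENNReal.div_pos (by simpa using (hk₀ z).ne') ?_).ne'
      simp [H, hz1.ne, hz2.ne]
    simp [k, this]
  have hkH : ∀ z, k z * (1 + H μ₁ z + H μ₂ z) ≤ k₀ z := fun z =>
    ENNReal.mul_le_of_le_div (min_le_right _ _)
  let g : S → ℝ≥0∞ := fun y => ∫⁻ x, timeKernel p expWeight y x * k x ∂m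
  have mg : Measurable g := Measurable.lintegral_prod_right'
    (f := fun q : S × S => timeKernel p expWeight q.1 q.2 * k q.2) (by fun_prop)
  have hg0 : ∀ y, g y ≠ 0 := lintegral_timeKernel_mul_ne_zero hp hX measurable_expWeight
    (fun t _ => by simp [expWeight, Real.exp_pos]) mk hk0
  have hgeq : ∀ y, g y = ∫⁻ t in Ioi (0 : ℝ), expWeight t * ∫⁻ z, p t y z * k z ∂m :=
    lintegral_timeKernel_mul_fun hp measurable_expWeight mk
  have hPk : ∀ t, 0 < t → ∀ y, ∫⁻ z, p t y z * k z ∂m ≤ 1 := fun t ht y =>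
    (lintegral_mono fun z => mul_le_of_le_one_right' (hk1 z)).trans (lintegral_density_le_one hp ht y)
  have hg1 : ∀ y, g y ≤ 1 := by
    intro y
    rw [hgeq, ← lintegral_expWeight]
    exact setLIntegral_mono' measurableSet_Ioi fun t ht => mul_le_of_le_one_right' (hPk t ht y)
  have hgint : ∀ (μ : Measure S) [SFinite μ], (∀ z, k z * H μ z ≤ k₀ z) → ∫⁻ y, g y ∂μ ≠ ∞ := by
    intro μ _ hμ
    have : ∫⁻ y, g y ∂μ = ∫⁻ z, k z * H μ z ∂m := by
      rw [lintegral_lintegral_swap (by fun_prop)]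
      refine lintegral_congr fun z => ?_
      rw [lintegral_mul_const _ (by fun_prop), mul_comm]
    rw [this]
    exact ((lintegral_mono hμ).trans_lt (ik₀.trans ENNReal.one_lt_top)).ne
  have hg₁ : ∫⁻ y, g y ∂μ₁ ≠ ∞ := hgint μ₁ fun z => le_trans (by gcongr; rw [add_assoc, add_left_comm]; exact le_self_add) (hkH z)
  have hg₂ : ∫⁻ y, g y ∂μ₂ ≠ ∞ := hgint μ₂ fun z => le_trans (by gcongr; exact le_add_self) (hkH z)
  have hPg : ∀ t, 0 < t → ∀ y, ∫⁻ z, p t y z * g z ∂m =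
      expWeight (-t) * ∫⁻ r in Ioi t, expWeight r * ∫⁻ x, p r y x * k x ∂m := by
    intro t ht y
    rw [← expWeight_mul_lintegral_density hp mk ht y, ← mul_assoc, expWeight_neg_mul, one_mul]
  have hPg_le : ∀ t, 0 < t → ∀ y, ∫⁻ z, p t y z * g z ∂m ≤ expWeight (-t) * g y := by
    intro t ht y
    rw [hPg t ht y, hgeq]
    gcongr
  have hPg_tendsto : ∀ y, Tendsto (fun t => ∫⁻ z, p t y z * g z ∂m) (𝓝[>] 0) (𝓝 (g y)) := by
    intro y
    have mG : Measurable fun r => expWeight r * ∫⁻ x, p r y x * k x ∂m :=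
      measurable_expWeight.mul (Measurable.lintegral_prod_right'
        (f := fun q : ℝ × S => p q.1 y q.2 * k q.2) (by fun_prop))
    have t1 : Tendsto (fun t : ℝ => expWeight (-t)) (𝓝[>] 0) (𝓝 1) := by
      have : Continuous fun t : ℝ => expWeight (-t) := by
        unfold expWeight; exact ENNReal.continuous_ofReal.comp (by fun_prop)
      have h := this.tendsto 0
      simp only [expWeight, neg_zero, Real.exp_zero, ENNReal.ofReal_one] at h
      exact h.mono_left nhdsWithin_le_nhds
    have t2 : Tendsto (fun t : ℝ => ∫⁻ r in Ioi t, expWeight r * ∫⁻ x, p r y x * k x ∂m) (𝓝[>] 0)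
        (𝓝 (g y)) := by
      simp_rw [hgeq, ← lintegral_indicator measurableSet_Ioi]
      refine tendsto_lintegral_filter_of_dominated_convergence
        ((Ioi (0 : ℝ)).indicator fun r => expWeight r * ∫⁻ x, p r y x * k x ∂m)
        (Eventually.of_forall fun t => mG.indicator measurableSet_Ioi) ?_ ?_ ?_
      · filter_upwards [self_mem_nhdsWithin] with t ht
        exact Eventually.of_forall fun r =>
          indicator_le_indicator_of_subset (Ioi_subset_Ioi (le_of_lt ht)) (fun _ => bot_le) r
      · rw [lintegral_indicator measurableSet_Ioi, ← hgeq]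
        exact ((hg1 y).trans_lt ENNReal.one_lt_top).ne
      · refine Eventually.of_forall fun r => tendsto_const_nhds.congr' ?_
        rcases lt_or_ge 0 r with hr | hr
        · filter_upwards [Ioo_mem_nhdsGT hr] with t ht
          simp [indicator, hr, ht.2]
        · filter_upwards [self_mem_nhdsWithin] with t ht
          have ht' : 0 < t := ht
          simp [indicator, not_lt_of_ge hr, not_lt_of_ge (hr.trans ht'.le)]
    have t3 := ENNReal.Tendsto.mul t1 (Or.inl one_ne_zero) t2 (Or.inr (by simp))
    rw [one_mul] at t3
    refine t3.congr' ?_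
    filter_upwards [self_mem_nhdsWithin] with t ht
    exact (hPg t ht y).symm
  have key : μ₁.withDensity g = μ₂.withDensity g := by
    let := TopologicalSpace.metrizableSpaceMetric S
    have f₁ : IsFiniteMeasure (μ₁.withDensity g) := isFiniteMeasure_withDensity hg₁
    have f₂ : IsFiniteMeasure (μ₂.withDensity g) := isFiniteMeasure_withDensity hg₂
    refine ext_of_forall_lintegral_eq_of_IsFiniteMeasure fun f => ?_
    have mf : Measurable f := f.continuous.measurable
    have hfM : ∀ z, f z ≤ nndist f 0 := fun z => by
      have := BoundedContinuousFunction.dist_coe_le_dist (f := f) (g := 0) z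
      rw [← NNReal.coe_le_coe]
      simpa [NNReal.dist_eq] using this
    have lim : ∀ (μ : Measure S) [SFinite μ], ∫⁻ y, g y ∂μ ≠ ∞ →
        Tendsto (fun t => ∫⁻ y, (∫⁻ z, p t y z * (f z * g z) ∂m) ∂μ) (𝓝[>] 0)
          (𝓝 (∫⁻ y, f y * g y ∂μ)) := by
      intro μ _ hμ
      -- For t < 1 excessiveness gives P_t g ≤ e^t g ≤ e·g; the factor e appears as `expWeight
      -- (-1)`.
      refine tendsto_lintegral_filter_of_dominated_convergence
        (fun y => (nndist f 0 : ℝ≥0) * (expWeight (-1) * g y)) ?_ ?_ ?_ ?_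
      · refine Eventually.of_forall fun t => ?_
        exact Measurable.lintegral_prod_right' (f := fun q : S × S => p t q.1 q.2 * (f q.2 * g q.2))
          (by fun_prop)
      · filter_upwards [Ioo_mem_nhdsGT one_pos] with t ht
        refine Eventually.of_forall fun y => ?_
        calc ∫⁻ z, p t y z * (f z * g z) ∂m
            ≤ ∫⁻ z, (nndist f 0 : ℝ≥0) * (p t y z * g z) ∂m := by
              refine lintegral_mono fun z => ?_
              rw [mul_left_comm]
              gcongr
              exact hfM z
          _ = (nndist f 0 : ℝ≥0) * ∫⁻ z, p t y z * g z ∂m := lintegral_const_mul _ (by fun_prop)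
          _ ≤ _ := by
              gcongr
              refine (hPg_le t ht.1 y).trans ?_
              gcongr
              unfold expWeight
              exact ENNReal.ofReal_le_ofReal (Real.exp_le_exp.2 (by linarith [ht.2]))
      · rw [lintegral_const_mul _ (by fun_prop), lintegral_const_mul _ mg]
        exact ENNReal.mul_ne_top (by simp) (ENNReal.mul_ne_top (by simp [expWeight]) hμ)
      · exact Eventually.of_forall fun y =>
          tendsto_lintegral_density_mul hp hX f.continuous hfM mg hg1 (hPg_tendsto y)
    have swap : ∀ (μ : Measure S) [SFinite μ] (t : ℝ),
        ∫⁻ y, (∫⁻ z, p t y z * (f z * g z) ∂m) ∂μ = ∫⁻ z, (∫⁻ y, p t y z ∂μ) * (f z * g z) ∂m := by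
      intro μ _ t
      rw [lintegral_lintegral_swap (by fun_prop)]
      exact lintegral_congr fun z => lintegral_mul_const _ (by fun_prop)
    rw [lintegral_withDensity_eq_lintegral_mul _ mg (by fun_prop),
      lintegral_withDensity_eq_lintegral_mul _ mg (by fun_prop)]
    simp only [Pi.mul_apply, mul_comm (g _)]
    refine tendsto_nhds_unique_of_frequently_eq (lim μ₁ hg₁) (lim μ₂ hg₂)
      (frequently_of_ae_Ioi ?_)
    filter_upwards [h] with t ht
    rw [swap, swap]
    refine lintegral_congr_ae ?_
    filter_upwards [ht] with z hz
    rw [hz]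
  have hgt : ∀ y, g y ≠ ∞ := fun y => ((hg1 y).trans_lt ENNReal.one_lt_top).ne
  rw [← withDensity_inv_same (μ := μ₁) mg (Eventually.of_forall hg0) (Eventually.of_forall hgt),
    ← withDensity_inv_same (μ := μ₂) mg (Eventually.of_forall hg0) (Eventually.of_forall hgt), key]

end Determination

end ProperNorms

namespace ProperNorms

/-! ### Definiteness of ‖·‖_w and ‖·‖_Φ -/

section Definiteness

/-- A density keeps the Jordan parts mutually singular, and equal measures that are mutually
singular vanish. -/
theorem lintegral_totalVariation_eq_zero {S : Type*} [MeasurableSpace S] {ν : SignedMeasure S}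
    {f : S → ℝ≥0∞} (h : (pos ν).withDensity f = (neg ν).withDensity f) :
    ∫⁻ x, f x ∂ν.totalVariation = 0 := by
  obtain ⟨A, hA, h1, h2⟩ := pos_mutuallySingular_neg ν
  have p1 : (pos ν).withDensity f A = 0 := withDensity_absolutelyContinuous _ _ h1
  have n2 : (neg ν).withDensity f Aᶜ = 0 := withDensity_absolutelyContinuous _ _ h2
  have p2 : (pos ν).withDensity f univ = 0 := by
    rw [← union_compl_self A]
    exact measure_union_null p1 (h ▸ n2)
  have n1 : (neg ν).withDensity f univ = 0 := h ▸ p2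
  rw [withDensity_apply _ MeasurableSet.univ, Measure.restrict_univ] at p2 n1
  rw [totalVariation_eq, lintegral_add_measure, p2, n1, add_zero]

theorem lintegral_Ioi_comp_half {f : ℝ → ℝ≥0∞} (hf : Measurable f) :
    ∫⁻ t in Ioi (0 : ℝ), f (t / 2) = 2 * ∫⁻ t in Ioi (0 : ℝ), f t := by
  have h := lintegral_map (μ := volume) (f := (Ioi (0 : ℝ)).indicator f) (g := fun t : ℝ => 2⁻¹ * t)
    (hf.indicator measurableSet_Ioi) (by fun_prop)
  have e : Measure.map (fun t : ℝ => 2⁻¹ * t) volume = (2 : ℝ≥0∞) • volume := by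
    have := Real.map_volume_mul_left (a := 2⁻¹) (by norm_num)
    simp only [inv_inv] at this
    rw [this]
    simp
  rw [e, lintegral_smul_measure, lintegral_indicator measurableSet_Ioi, smul_eq_mul] at h
  rw [h, ← lintegral_indicator measurableSet_Ioi]
  refine lintegral_congr fun t => ?_
  simp [indicator, div_eq_inv_mul]

theorem ae_Ioi_comp_double {P : ℝ → Prop} (h : ∀ᵐ t ∂volume.restrict (Ioi (0 : ℝ)), P (t / 2)) :
    ∀ᵐ t ∂volume.restrict (Ioi (0 : ℝ)), P t := by
  rw [ae_restrict_iff' measurableSet_Ioi] at *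
  have q : Measure.QuasiMeasurePreserving (fun t : ℝ => 2 * t) volume volume := by
    refine ⟨by fun_prop, ?_⟩
    rw [Real.map_volume_mul_left (by norm_num)]
    exact Measure.AbsolutelyContinuous.rfl.smul_left _
  filter_upwards [q.ae h] with t ht ht0
  have ht0' : 0 < t := ht0
  simpa using ht (by simpa using ht0')

variable {S Ω : Type*} [TopologicalSpace S] [MeasurableSpace S] [BorelSpace S] [MeasurableSpace Ω]
  {X : MarkovProcess S Ω} {m : Measure S} [SigmaFinite m] {p : ℝ → S → S → ℝ≥0∞}
  (hp : IsTransitionDensity X.trans m p)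

/-- A crude bound, from √(πt) ≤ (πt + 1)/2 ≤ 2(t + 1) ≤ 2e^t. It makes 1-potentials finite wherever
`rootKernel` potentials are. -/
theorem expWeight_le_rootWeight {t : ℝ} (ht : 0 < t) : expWeight t ≤ 2 * rootWeight t := by
  rw [rootWeight_eq ht, expWeight, show (2 : ℝ≥0∞) = ENNReal.ofReal 2 by simp,
    ← ENNReal.ofReal_mul (by norm_num)]
  refine ENNReal.ofReal_le_ofReal ?_
  have h0 : 0 < Real.sqrt (Real.pi * t) := Real.sqrt_pos.2 (by positivity)
  rw [Real.exp_neg, ← div_eq_mul_inv, inv_le_iff_one_le_mul₀ (Real.exp_pos _), div_mul_eq_mul_div,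
    one_le_div h0]
  have h1 : Real.sqrt (Real.pi * t) ≤ (Real.pi * t + 1) / 2 := by
    nlinarith [Real.sq_sqrt (show 0 ≤ Real.pi * t by positivity),
      sq_nonneg (Real.sqrt (Real.pi * t) - 1)]
  have h2 := Real.add_one_le_exp t
  nlinarith [Real.pi_le_four]

theorem lintegral_rootWeight_mul_overshoot {b r : ℝ} (hb : 0 < b) (hr : 0 < r) :
    ∫⁻ s in Ioo 0 r, rootWeight s * overshoot b (r - s) = if b < r then rootWeight r else 0 := by
  rw [← lintegral_overshoot_mul hb hr, ← lintegral_indicator measurableSet_Ioo,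
    ← lintegral_indicator measurableSet_Ioo]
  refine Eq.trans ?_ (lintegral_sub_left_eq_self _ r)
  refine lintegral_congr fun s => ?_
  by_cases h1 : 0 < s <;> by_cases h2 : s < r <;> simp [indicator, h1, h2, mul_comm]

include hp in
omit [TopologicalSpace S] [BorelSpace S] [SigmaFinite m] in
theorem lintegral_timeKernel_left {α : ℝ → ℝ≥0∞} (hα : Measurable α) (μ : Measure S) [SFinite μ]
    (z : S) : ∫⁻ y, timeKernel p α y z ∂μ =
      ∫⁻ t in Ioi (0 : ℝ), α t * ∫⁻ y, p t y z ∂μ := by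
  have mp3 : Measurable fun q : ℝ × S × S => p q.1 q.2.1 q.2.2 := hp.measurable
  unfold timeKernel
  rw [lintegral_lintegral_swap]
  · exact lintegral_congr fun t => lintegral_const_mul _ (by fun_prop)
  · have : Measurable fun q : S × ℝ => α q.2 * p q.2 q.1 z := by fun_prop
    exact this.aemeasurable

/-- `t ↦ 1_{t ≤ b} / √(π t)`. -/
noncomputable def truncWeight (b t : ℝ) : ℝ≥0∞ := (Iic b).indicator rootWeight t

include hp in
omit [TopologicalSpace S] [BorelSpace S] in
-- The contribution of times beyond b is w followed by the overshoot kernel. It is thus expressed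
-- through w itself, and what remains sees only times up to b.
theorem rootKernel_eq_add {b : ℝ} (hb : 0 < b) (y z : S) :
    rootKernel p y z = ∫⁻ x, rootKernel p y x * timeKernel p (overshoot b) x z ∂m +
      timeKernel p (truncWeight b) y z := by
  have mp3 : Measurable fun q : ℝ × S × S => p q.1 q.2.1 q.2.2 := hp.measurable
  have mr := measurable_rootWeight
  have mt : Measurable (truncWeight b) := mr.indicator measurableSet_Iic
  simp_rw [rootKernel_eq]
  rw [lintegral_timeKernel_mul hp measurable_rootWeight (measurable_overshoot b)]
  unfold timeKernel
  rw [← lintegral_add_right _ (by fun_prop)]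
  refine setLIntegral_congr_fun measurableSet_Ioi fun t ht => ?_
  simp only
  rw [lintegral_rootWeight_mul_overshoot hb ht, truncWeight, ← add_mul]
  congr 1
  by_cases h : b < t
  · simp [indicator, h, not_le.2 h]
  · simp [indicator, h, not_lt.1 h]

include hp in
omit [TopologicalSpace S] [BorelSpace S] in
-- The contributions beyond b are integrals of the functions ∫ w(y,x) dμᵢ(y) against the overshoot
-- kernel, hence equal, and finite at the z considered. Subtracting them leaves equal time integrals
-- over (0,b] for every b, with an exceptional set of z that does not depend on b. These determine
-- the density in t almost everywhere.
theorem ae_lintegral_density_eq {μ₁ μ₂ : Measure S} [SFinite μ₁] [SFinite μ₂]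
    (h : ∀ᵐ z ∂m, ∫⁻ y, rootKernel p y z ∂μ₁ ≠ ∞ ∧
      ∫⁻ y, rootKernel p y z ∂μ₁ = ∫⁻ y, rootKernel p y z ∂μ₂) :
    ∀ᵐ t ∂volume.restrict (Ioi (0 : ℝ)), ∀ᵐ z ∂m, ∫⁻ y, p t y z ∂μ₁ = ∫⁻ y, p t y z ∂μ₂ := by
  have mp3 : Measurable fun q : ℝ × S × S => p q.1 q.2.1 q.2.2 := hp.measurable
  have mr := measurable_rootWeight
  have mw := measurable_rootKernel hp
  have mD : ∀ (μ : Measure S) [SFinite μ], Measurable fun q : S × ℝ => ∫⁻ y, p q.2 y q.1 ∂μ :=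
    fun μ _ => Measurable.lintegral_prod_right' (f := fun q : (S × ℝ) × S => p q.1.2 q.2 q.1.1)
      (by fun_prop)
  have m1 := mD μ₁
  have m2 := mD μ₂
  -- The argument works at a fixed z and yields almost every t; joint measurability permits the
  -- exchange of the two quantifiers.
  refine (Measure.ae_ae_comm (p := fun z t => ∫⁻ y, p t y z ∂μ₁ = ∫⁻ y, p t y z ∂μ₂)
    (measurableSet_eq_fun m1 m2)).1 ?_
  filter_upwards [h] with z hz
  have trunc : ∀ b, 0 < b → ∫⁻ y, timeKernel p (truncWeight b) y z ∂μ₁ =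
      ∫⁻ y, timeKernel p (truncWeight b) y z ∂μ₂ := by
    intro b hb
    have mJ : Measurable fun q : S × S => timeKernel p (overshoot b) q.1 q.2 :=
      measurable_timeKernel hp (measurable_overshoot b)
    have mT : Measurable fun q : S × S => timeKernel p (truncWeight b) q.1 q.2 :=
      measurable_timeKernel hp (mr.indicator measurableSet_Iic)
    have dec : ∀ (μ : Measure S) [SFinite μ], ∫⁻ y, rootKernel p y z ∂μ =
        ∫⁻ x, (∫⁻ y, rootKernel p y x ∂μ) * timeKernel p (overshoot b) x z ∂m +
          ∫⁻ y, timeKernel p (truncWeight b) y z ∂μ := by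
      intro μ _
      simp_rw [rootKernel_eq_add hp hb _ z]
      rw [lintegral_add_right _ (by fun_prop), lintegral_lintegral_swap (by fun_prop)]
      congr 1
      exact lintegral_congr fun x => lintegral_mul_const _ (by fun_prop)
    have e : ∫⁻ x, (∫⁻ y, rootKernel p y x ∂μ₁) * timeKernel p (overshoot b) x z ∂m =
        ∫⁻ x, (∫⁻ y, rootKernel p y x ∂μ₂) * timeKernel p (overshoot b) x z ∂m := by
      refine lintegral_congr_ae ?_
      filter_upwards [h] with x hx
      rw [hx.2]
    have d1 := dec μ₁
    have d2 := dec μ₂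
    rw [← e, ← hz.2, d1] at d2
    refine (ENNReal.add_right_inj ?_).1 d2
    refine ne_top_of_le_ne_top hz.1 ?_
    rw [d1]
    exact le_self_add
  let D : Measure S → ℝ → ℝ≥0∞ := fun μ t => rootWeight t * ∫⁻ y, p t y z ∂μ
  have mDz : ∀ (μ : Measure S) [SFinite μ], Measurable (D μ) := fun μ _ =>
    mr.mul ((mD μ).comp measurable_prodMk_left)
  have tot : ∀ (μ : Measure S) [SFinite μ], ∫⁻ t in Ioi (0 : ℝ), D μ t =
      ∫⁻ y, rootKernel p y z ∂μ := by
    intro μ _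
    simp_rw [rootKernel_eq]
    rw [lintegral_timeKernel_left hp mr]
  have f1 : ∫⁻ t in Ioi (0 : ℝ), D μ₁ t ≠ ∞ := by rw [tot]; exact hz.1
  have f2 : ∫⁻ t in Ioi (0 : ℝ), D μ₂ t ≠ ∞ := by rw [tot, ← hz.2]; exact hz.1
  have key : (volume.restrict (Ioi (0 : ℝ))).withDensity (D μ₁) =
      (volume.restrict (Ioi (0 : ℝ))).withDensity (D μ₂) := by
    have := isFiniteMeasure_withDensity f1
    have := isFiniteMeasure_withDensity f2
    refine Measure.ext_of_Iic _ _ fun b => ?_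
    rw [withDensity_apply _ measurableSet_Iic, withDensity_apply _ measurableSet_Iic,
      Measure.restrict_restrict measurableSet_Iic]
    rcases le_or_gt b 0 with hb | hb
    · have : Iic b ∩ Ioi 0 = ∅ := by
        ext t; simp only [mem_inter_iff, mem_Iic, mem_Ioi, mem_empty_iff_false, iff_false]
        intro h; linarith
      rw [this]; simp
    · have e : ∀ (μ : Measure S) [SFinite μ], ∫⁻ t in Iic b ∩ Ioi 0, D μ t =
          ∫⁻ y, timeKernel p (truncWeight b) y z ∂μ := by
        intro μ _
        rw [lintegral_timeKernel_left hp (α := truncWeight b) (mr.indicator measurableSet_Iic),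
          ← Measure.restrict_restrict measurableSet_Iic, ← lintegral_indicator measurableSet_Iic]
        refine lintegral_congr fun t => ?_
        by_cases ht : t ≤ b <;> simp [indicator, truncWeight, ht, D]
      rw [e, e, trunc b hb]
  have hae := (withDensity_eq_iff (mDz μ₁).aemeasurable (mDz μ₂).aemeasurable f1).1 key
  filter_upwards [hae, ae_restrict_mem measurableSet_Ioi] with t ht ht0
  have ht0' : 0 < t := ht0
  have r0 : rootWeight t ≠ 0 := by
    rw [rootWeight_eq ht0']; simpa using (by positivity : 0 < Real.pi * t)
  have r1 : rootWeight t ≠ ∞ := by rw [rootWeight_eq ht0']; simp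
  exact (ENNReal.mul_right_inj r0 r1).1 ht

include hp in
theorem measure_eq_of_lintegral_rootKernel_eq [LocallyCompactSpace S] [T2Space S]
    [SecondCountableTopology S] (hX : X.RightContinuous) {μ₁ μ₂ : Measure S} [SFinite μ₁]
    [SFinite μ₂] (h : ∀ᵐ z ∂m, ∫⁻ y, rootKernel p y z ∂μ₁ ≠ ∞ ∧
      ∫⁻ y, rootKernel p y z ∂μ₁ = ∫⁻ y, rootKernel p y z ∂μ₂) : μ₁ = μ₂ := by
  have fin : ∀ (μ : Measure S) [SFinite μ] (z : S), ∫⁻ y, rootKernel p y z ∂μ ≠ ∞ →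
      ∫⁻ y, timeKernel p expWeight y z ∂μ < ∞ := by
    intro μ _ z hz
    simp_rw [rootKernel_eq] at hz
    rw [lintegral_timeKernel_left hp measurable_rootWeight] at hz
    rw [lintegral_timeKernel_left hp measurable_expWeight]
    calc ∫⁻ t in Ioi (0 : ℝ), expWeight t * ∫⁻ y, p t y z ∂μ
        ≤ ∫⁻ t in Ioi (0 : ℝ), 2 * (rootWeight t * ∫⁻ y, p t y z ∂μ) := by
          refine setLIntegral_mono' measurableSet_Ioi fun t ht => ?_
          rw [← mul_assoc]
          gcongr
          exact expWeight_le_rootWeight ht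
      _ = 2 * ∫⁻ t in Ioi (0 : ℝ), rootWeight t * ∫⁻ y, p t y z ∂μ :=
          lintegral_const_mul' _ _ (by simp)
      _ < ∞ := ENNReal.mul_lt_top (by simp) hz.lt_top
  refine measure_eq_of_lintegral_density_eq hp hX ?_ ?_ (ae_lintegral_density_eq hp h)
  · filter_upwards [h] with z hz using fin μ₁ z hz.1
  · filter_upwards [h] with z hz using fin μ₂ z (hz.2 ▸ hz.1)

variable {Ω' : Type*} [MeasurableSpace Ω'] {X' : MarkovProcess S Ω'}
  (hp' : IsTransitionDensity X'.trans m fun t x y => p t y x)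

include hp hp' in
-- For almost every x the measures w(x,·)ν⁺ and w(x,·)ν⁻ have the same w-potentials, so they agree
-- and vanish. Then ∫ w(x,y) dm(x) = 0 for |ν|-almost every y, while right continuity of the dual
-- process excludes this for every y.
theorem eq_zero_of_wNorm_eq_zero [LocallyCompactSpace S] [T2Space S] [SecondCountableTopology S]
    (hX : X.RightContinuous) (hX' : X'.RightContinuous) {ν : SignedMeasure S}
    (h : wNorm m p ν = 0) : ν = 0 := by
  have mw := measurable_rootKernel hp
  have mw' : Measurable fun q : S × S => rootKernel p q.2 q.1 := mw.comp measurable_swap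
  have hm := measurable_absInt_mixed (b := fun y h => rootKernel p h y) mw mw' ν
  rw [wNorm_eq_mixedNorm hp, mixedNorm, kernelNorm, ENNReal.rpow_eq_zero_iff_of_pos (by norm_num),
    lintegral_eq_zero_iff (hm.pow_const 2)] at h
  have h' : ∀ᵐ x ∂m, ∀ᵐ z ∂m, absInt ν (fun y => rootKernel p x y * rootKernel p y z) = 0 := by
    filter_upwards [Measure.ae_ae_of_ae_prod h] with x hx
    filter_upwards [hx] with z hz
    simpa using hz
  have hzero : ∀ᵐ x ∂m, ∫⁻ y, rootKernel p x y ∂ν.totalVariation = 0 := by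
    filter_upwards [h'] with x hx
    refine lintegral_totalVariation_eq_zero ?_
    refine measure_eq_of_lintegral_rootKernel_eq hp hX ?_
    filter_upwards [hx] with z hz
    rw [absInt_eq_gap ν (by fun_prop)] at hz
    rw [lintegral_withDensity_eq_lintegral_mul _ (by fun_prop) (by fun_prop),
      lintegral_withDensity_eq_lintegral_mul _ (by fun_prop) (by fun_prop)]
    exact gap_eq_zero hz
  have hzero' : ∫⁻ y, ∫⁻ x, rootKernel p x y ∂m ∂ν.totalVariation = 0 := by
    rw [lintegral_lintegral_swap (by fun_prop), lintegral_congr_ae hzero]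
    simp
  have hzero2 := (lintegral_eq_zero_iff (Measurable.lintegral_prod_left' mw)).1 hzero'
  refine eq_zero_of_totalVariation_eq_zero ?_
  rw [← ae_eq_bot, ← Filter.eventually_false_iff_eq_bot]
  filter_upwards [hzero2] with y hy
  have := lintegral_timeKernel_mul_ne_zero hp' hX' measurable_rootWeight
    (fun t ht => by rw [rootWeight_eq ht]; simpa using (by positivity : 0 < Real.pi * t))
    (f := fun _ => 1) measurable_const (by simp) y
  simp only [mul_one] at this
  refine this ?_
  simp_rw [rootKernel_eq] at hy
  exact hy

include hp hp' in
-- The scheme is that for ‖·‖_w, with p_{s/2}(v,·) in the place of w(x,·). The densities at single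
-- times are available directly, but the finiteness of the 1-potentials has to be drawn from the
-- convergence of the form.
theorem eq_zero_of_phiNorm_eq_zero [LocallyCompactSpace S] [T2Space S] [SecondCountableTopology S]
    (hX : X.RightContinuous) (hX' : X'.RightContinuous) {ν : SignedMeasure S}
    (h : phiNorm m p ν = 0) : ν = 0 := by
  have mp3 : Measurable fun q : ℝ × S × S => p q.1 q.2.1 q.2.2 := hp.measurable
  have ma := measurable_halfForward hp
  have mb := measurable_halfBackward hp
  have hc : FormConverges (phi m p) ν := by
    by_contra hc
    rw [phiNorm, quadNorm, if_neg hc] at h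
    exact ENNReal.top_ne_zero h
  rw [phiNorm, quadNorm_eq_mixedNorm ma mb (phi_eq hp) hc, mixedNorm, kernelNorm,
    ENNReal.rpow_eq_zero_iff_of_pos (by norm_num),
    lintegral_eq_zero_iff ((measurable_absInt_mixed ma mb ν).pow_const 2)] at h
  have hfin := (formConverges_iff_kernelNorm ma mb (phi_eq hp) ν).1 hc
  have mT := measurable_mixed ma mb ν.totalVariation
  rw [kernelNorm, ENNReal.rpow_lt_top_iff_of_pos (by norm_num), lintegral_prod _ (by fun_prop)]
    at hfin
  have hfin' := ae_lt_top (Measurable.lintegral_prod_right' (mT.pow_const 2)) hfin.ne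
  have hzero : ∀ᵐ s ∂timeSpace m, ∫⁻ x, halfBackward p x s ∂ν.totalVariation = 0 := by
    filter_upwards [Measure.ae_ae_of_ae_prod h, hfin'] with s hs hs'
    have mbs : Measurable fun x => halfBackward p x s := by fun_prop
    refine lintegral_totalVariation_eq_zero ?_
    have e : ∀ (μ : Measure S) (r : ℝ × S), ∫⁻ y, p (r.1 / 2) y r.2
        ∂μ.withDensity (fun x => halfBackward p x s) =
          mixed (halfForward p) (halfBackward p) μ (s, r) := by
      intro μ r
      rw [lintegral_withDensity_eq_lintegral_mul _ mbs (by fun_prop)]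
      rfl
    have fin : ∀ (μ : Measure S) [SFinite μ], μ ≤ ν.totalVariation → ∀ᵐ z ∂m,
        ∫⁻ y, timeKernel p expWeight y z ∂μ.withDensity (fun x => halfBackward p x s) < ∞ := by
      intro μ _ hμ
      have mD : Measurable fun r : ℝ × S => ∫⁻ y, p r.1 y r.2
          ∂μ.withDensity (fun x => halfBackward p x s) :=
        Measurable.lintegral_prod_right' (f := fun q : (ℝ × S) × S => p q.1.1 q.2 q.1.2)
          (by fun_prop)
      have h1 : ∫⁻ z, (∫⁻ t in Ioi (0 : ℝ), (∫⁻ y, p t y z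
          ∂μ.withDensity (fun x => halfBackward p x s)) ^ 2) ∂m ≠ ∞ := by
        have h2 : ∫⁻ z, (∫⁻ t in Ioi (0 : ℝ), (∫⁻ y, p (t / 2) y z
          ∂μ.withDensity (fun x => halfBackward p x s)) ^ 2) ∂m < ∞ := by
          have : ∫⁻ r, (∫⁻ y, p (r.1 / 2) y r.2
              ∂μ.withDensity (fun x => halfBackward p x s)) ^ 2 ∂timeSpace m < ∞ := by
            refine lt_of_le_of_lt (lintegral_mono fun r => ?_) hs'
            simp only [e]
            exact pow_le_pow_left' (mixed_mono hμ _) 2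
          rw [lintegral_prod_symm _ (by fun_prop)] at this
          exact this
        refine ne_top_of_le_ne_top h2.ne (lintegral_mono fun z => ?_)
        rw [lintegral_Ioi_comp_half (f := fun t => (∫⁻ y, p t y z
          ∂μ.withDensity (fun x => halfBackward p x s)) ^ 2) (by fun_prop), two_mul]
        exact le_self_add
      filter_upwards [ae_lt_top (Measurable.lintegral_prod_left' (mD.pow_const 2)) h1] with z hz
      rw [lintegral_timeKernel_left hp measurable_expWeight]
      have mexp := measurable_expWeight
      -- The form controls the integral of c² over time, c being the density at time t; the
      -- inequality e^{-t} c ≤ e^{-t} + c² turns this into control of the 1-potential.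
      calc ∫⁻ t in Ioi (0 : ℝ), expWeight t * ∫⁻ y, p t y z
            ∂μ.withDensity (fun x => halfBackward p x s)
          ≤ ∫⁻ t in Ioi (0 : ℝ), (expWeight t + (∫⁻ y, p t y z
            ∂μ.withDensity (fun x => halfBackward p x s)) ^ 2) := by
            refine setLIntegral_mono' measurableSet_Ioi fun t ht => ?_
            have ht' : 0 < t := ht
            have h1 : expWeight t ≤ 1 := by
              simp only [expWeight, ENNReal.ofReal_le_one, Real.exp_le_one_iff]; linarith
            generalize ∫⁻ y, p t y z ∂μ.withDensity (fun x => halfBackward p x s) = c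
            rcases le_total c 1 with hc | hc
            · exact (mul_le_of_le_one_right' hc).trans le_self_add
            · calc expWeight t * c ≤ 1 * c := by gcongr
                _ ≤ c * c := by gcongr
                _ = c ^ 2 := (sq c).symm
                _ ≤ _ := le_add_self
        _ = (∫⁻ t in Ioi (0 : ℝ), expWeight t) + ∫⁻ t in Ioi (0 : ℝ), (∫⁻ y, p t y z
            ∂μ.withDensity (fun x => halfBackward p x s)) ^ 2 := lintegral_add_left mexp _
        _ < ∞ := by
            rw [lintegral_expWeight]
            exact ENNReal.add_lt_top.2 ⟨ENNReal.one_lt_top, hz⟩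
    refine measure_eq_of_lintegral_density_eq hp hX (fin _ (pos_le_totalVariation ν))
      (fin _ (neg_le_totalVariation ν)) ?_
    refine ae_Ioi_comp_double ?_
    filter_upwards [Measure.ae_ae_of_ae_prod hs] with t ht
    filter_upwards [ht] with z hz
    have hz' : absInt ν (fun x => halfBackward p x s * halfForward p x (t, z)) = 0 := by
      simpa using hz
    rw [absInt_mixed ma mb ν (s, (t, z))] at hz'
    rw [e _ (t, z), e _ (t, z)]
    exact (gap_eq_zero hz').2
  have hzero' : ∫⁻ x, ∫⁻ s, halfBackward p x s ∂timeSpace m ∂ν.totalVariation = 0 := by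
    rw [lintegral_lintegral_swap (by fun_prop), lintegral_congr_ae hzero]
    simp
  have hzero2 := (lintegral_eq_zero_iff (Measurable.lintegral_prod_right' mb)).1 hzero'
  refine eq_zero_of_totalVariation_eq_zero ?_
  rw [← ae_eq_bot, ← Filter.eventually_false_iff_eq_bot]
  filter_upwards [hzero2] with y hy
  have hne := lintegral_timeKernel_mul_ne_zero hp' hX' (α := 1) measurable_one
    (fun t ht => one_ne_zero) (f := fun _ => 1) measurable_const (by simp) y
  refine hne ?_
  rw [lintegral_timeKernel_mul_fun hp' measurable_one measurable_const]
  simp only [Pi.one_apply, one_mul, mul_one]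
  simp only [Pi.zero_apply] at hy
  rw [lintegral_prod _ (by fun_prop)] at hy
  have := lintegral_Ioi_comp_half (f := fun t => ∫⁻ v, p t v y ∂m)
    (Measurable.lintegral_prod_right' (f := fun q : ℝ × S => p q.1 q.2 y) (by fun_prop))
  have hy' : ∫⁻ t in Ioi (0 : ℝ), (∫⁻ v, p (t / 2) v y ∂m) = 0 := hy
  rw [hy'] at this
  exact (mul_eq_zero.1 this.symm).resolve_left (by simp)

end Definiteness

end ProperNorms

namespace ProperNorms

/-! ### Gaussian summation and Fourier inversion on a power of E -/

section Inversion

variable {ι E : Type*} [Fintype ι] [NormedAddCommGroup E] [InnerProductSpace ℝ E]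

/-- The character `w ↦ exp(i ∑ⱼ ⟨wⱼ, λⱼ⟩)` on a power of an inner product space. -/
noncomputable def piChar (w l : ι → E) : ℂ :=
  ∏ j, Complex.exp (Complex.I * (inner ℝ (w j) (l j) : ℝ))

theorem norm_piChar (w l : ι → E) : ‖piChar w l‖ = 1 := by
  simp only [piChar, norm_prod]
  refine Finset.prod_eq_one fun j _ => ?_
  rw [mul_comm]; exact Complex.norm_exp_ofReal_mul_I _

theorem piChar_add (w w' l : ι → E) : piChar (w + w') l = piChar w l * piChar w' l := by
  simp only [piChar, ← Finset.prod_mul_distrib, ← Complex.exp_add, Pi.add_apply, inner_add_left]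
  push_cast; simp only [mul_add]

theorem piChar_smul (r : ℝ) (w l : ι → E) : piChar (r • w) l = piChar w (r • l) := by
  simp [piChar, inner_smul_left, inner_smul_right]

theorem continuous_piChar : Continuous fun p : (ι → E) × (ι → E) => piChar p.1 p.2 := by
  unfold piChar; fun_prop

theorem continuous_piChar_left (l : ι → E) : Continuous fun w => piChar w l := by
  unfold piChar; fun_prop

theorem continuous_piChar_right (w : ι → E) : Continuous fun l => piChar w l := by
  unfold piChar; fun_prop

/-- The Gaussian `λ ↦ exp(-∑ⱼ ‖λⱼ‖²)`. -/
noncomputable def piGauss (l : ι → E) : ℂ := ∏ j, Complex.exp (-(1 : ℂ) * ‖l j‖ ^ 2)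
omit [InnerProductSpace ℝ E] in
theorem norm_piGauss_le (l : ι → E) : ‖piGauss l‖ ≤ 1 := by
  simp only [piGauss, norm_prod]
  refine Finset.prod_le_one (fun _ _ => norm_nonneg _) fun j _ => ?_
  have : (-(1 : ℂ) * ‖l j‖ ^ 2) = ((-‖l j‖ ^ 2 : ℝ) : ℂ) := by push_cast; ring
  rw [this, ← Complex.ofReal_exp, Complex.norm_real, Real.norm_eq_abs, Real.abs_exp,
    Real.exp_le_one_iff]
  have := sq_nonneg ‖l j‖
  linarith
omit [InnerProductSpace ℝ E] in
theorem continuous_piGauss : Continuous (piGauss : (ι → E) → ℂ) := by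
  unfold piGauss; fun_prop
omit [InnerProductSpace ℝ E] in
theorem piGauss_zero : piGauss (0 : ι → E) = 1 := by simp [piGauss]

variable [FiniteDimensional ℝ E] [MeasurableSpace E] [BorelSpace E]

theorem integrable_piGauss : Integrable (piGauss : (ι → E) → ℂ) := by
  refine Integrable.fintype_prod (f := fun _ (v : E) => Complex.exp (-(1 : ℂ) * ‖v‖ ^ 2))
    fun _ => ?_
  have := GaussianFourier.integrable_cexp_neg_mul_sq_norm_add (V := E) (b := 1) (by simp) 0 0
  simpa using this

/-- The Fourier transform of the Gaussian `piGauss`. -/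
noncomputable def piGaussHat (z : ι → E) : ℂ := ∫ l, piChar z l * piGauss l

theorem piGaussHat_eq (z : ι → E) :
    piGaussHat z = ∏ j, ((Real.pi : ℂ) ^ (Module.finrank ℝ E / 2 : ℂ) *
      Complex.exp (-(1 / 4 : ℂ) * ‖z j‖ ^ 2)) := by
  have : ∀ l : ι → E, piChar z l * piGauss l = ∏ j, Complex.exp (-(1 : ℂ) * ‖l j‖ ^ 2 +
      Complex.I * (inner ℝ (z j) (l j) : ℝ)) := by
    intro l
    simp only [piChar, piGauss, ← Finset.prod_mul_distrib, ← Complex.exp_add]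
    exact Finset.prod_congr rfl fun j _ => by rw [add_comm]
  simp only [piGaussHat, this]
  rw [integral_fintype_prod_volume_eq_prod (fun j (l : E) => Complex.exp (-(1 : ℂ) * ‖l‖ ^ 2 +
      Complex.I * (inner ℝ (z j) l : ℝ)))]
  refine Finset.prod_congr rfl fun j _ => ?_
  rw [GaussianFourier.integral_cexp_neg_mul_sq_norm_add (by simp)]
  simp only [div_one, Complex.I_sq]
  congr 2; ring

theorem integrable_piGaussHat : Integrable (piGaussHat : (ι → E) → ℂ) := by
  simp only [funext piGaussHat_eq]
  refine Integrable.fintype_prod (f := fun _ (v : E) =>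
    ((Real.pi : ℂ) ^ (Module.finrank ℝ E / 2 : ℂ) * Complex.exp (-(1 / 4 : ℂ) * ‖v‖ ^ 2)))
    fun _ => ?_
  have := GaussianFourier.integrable_cexp_neg_mul_sq_norm_add (V := E) (b := 1 / 4) (by norm_num) 0 0
  refine Integrable.const_mul ?_ _
  simpa using this

variable (E) in
/-- The constant of Fourier inversion on `E`. -/
noncomputable def inversionConst : ℂ :=
  (Real.pi : ℂ) ^ (Module.finrank ℝ E / 2 : ℂ) *
    (Real.pi / (1 / 4 : ℂ)) ^ (Module.finrank ℝ E / 2 : ℂ)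

omit [FiniteDimensional ℝ E] [MeasurableSpace E] [BorelSpace E] in
variable (E) in
theorem inversionConst_eq_ofReal : inversionConst E =
    (((Real.pi * (Real.pi / (1 / 4)) ) ^ (Module.finrank ℝ E / 2 : ℝ) : ℝ) : ℂ) := by
  rw [inversionConst, Real.mul_rpow Real.pi_pos.le (by positivity)]
  rw [Complex.ofReal_mul, Complex.ofReal_cpow Real.pi_pos.le, Complex.ofReal_cpow (by positivity)]
  push_cast; rfl

omit [FiniteDimensional ℝ E] [MeasurableSpace E] [BorelSpace E] in
variable (E) in
-- The constant is (2π)^{dim E}; later arguments use only that it is real and positive.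
theorem exists_inversionConst : ∃ c : ℝ, 0 < c ∧ inversionConst E = c :=
  ⟨_, by positivity, inversionConst_eq_ofReal E⟩

theorem integral_piGaussHat :
    ∫ z : ι → E, piGaussHat z = inversionConst E ^ Fintype.card ι := by
  simp only [piGaussHat_eq]
  rw [integral_fintype_prod_volume_eq_pow (fun v : E => ((Real.pi : ℂ) ^
    (Module.finrank ℝ E / 2 : ℂ) * Complex.exp (-(1 / 4 : ℂ) * ‖v‖ ^ 2)))]
  congr 1
  rw [integral_const_mul, GaussianFourier.integral_cexp_neg_mul_sq_norm (by norm_num)]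
  rfl

theorem integral_piChar_mul_piGauss_smul {R : ℝ} (hR : 0 < R) (v : ι → E) :
    ∫ l, piChar v l * piGauss (R⁻¹ • l) =
      (R ^ Module.finrank ℝ (ι → E) : ℝ) • piGaussHat (R • v) := by
  have := Measure.integral_comp_smul (volume : Measure (ι → E))
    (fun l => piChar v (R • l) * piGauss l) R⁻¹
  simp only [smul_smul, mul_inv_cancel₀ hR.ne', one_smul] at this
  rw [this, piGaussHat]
  simp only [piChar_smul]
  congr 1
  rw [inv_pow, inv_inv, abs_of_pos (by positivity)]

/-- Gaussian summation of the inverse Fourier transform. -/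
theorem integral_piChar_mul_gauss {f : (ι → E) → ℂ} (hf : Integrable f) {R : ℝ} (hR : 0 < R)
    (w : ι → E) :
    ∫ l, piChar w l * (∫ w', piChar (-w') l * f w') * piGauss (R⁻¹ • l) =
      ∫ w', f w' * ((R ^ Module.finrank ℝ (ι → E) : ℝ) • piGaussHat (R • (w - w'))) := by
  have hg : Integrable fun l : ι → E => piGauss (R⁻¹ • l) :=
    integrable_piGauss.comp_smul (inv_ne_zero hR.ne')
  have hi : Integrable (fun p : (ι → E) × (ι → E) =>
      piChar (w - p.2) p.1 * (piGauss (R⁻¹ • p.1) * f p.2)) (volume.prod volume) := by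
    refine (hg.mul_prod hf).bdd_mul (c := 1) ?_ (ae_of_all _ fun p => (norm_piChar _ _).le)
    exact (continuous_piChar.comp (by fun_prop :
      Continuous fun p : (ι → E) × (ι → E) => (w - p.2, p.1))).aestronglyMeasurable
  calc ∫ l, piChar w l * (∫ w', piChar (-w') l * f w') * piGauss (R⁻¹ • l)
      = ∫ l, ∫ w', piChar (w - w') l * (piGauss (R⁻¹ • l) * f w') := by
        refine integral_congr_ae (ae_of_all _ fun l => ?_)
        simp only
        rw [mul_assoc, mul_comm (∫ w', _), ← mul_assoc, ← integral_const_mul]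
        refine integral_congr_ae (ae_of_all _ fun w' => ?_)
        simp only [sub_eq_add_neg, piChar_add]; ring
    _ = ∫ w', ∫ l, piChar (w - w') l * (piGauss (R⁻¹ • l) * f w') :=
        integral_integral_swap hi
    _ = _ := by
        refine integral_congr_ae (ae_of_all _ fun w' => ?_)
        simp only
        rw [← integral_piChar_mul_piGauss_smul hR, ← integral_const_mul]
        refine integral_congr_ae (ae_of_all _ fun l => ?_)
        simp only; ring

/-- The rescaled functions `piGaussHat` form an approximate identity up to the constant. Dominated
convergence is applied twice, first in z and then in w'. -/
theorem tendsto_integral_test {f : (ι → E) → ℂ} (hf : Integrable f) {g : (ι → E) → ℝ}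
    (hg : Continuous g) {M : ℝ} (hM : ∀ x, ‖g x‖ ≤ M) :
    Tendsto (fun m : ℕ => ∫ w', f w' * ∫ z : ι → E, (g (w' + ((m + 1 : ℝ)⁻¹) • z) : ℂ) * piGaussHat z)
      atTop (𝓝 (inversionConst E ^ Fintype.card ι * ∫ w, (g w : ℂ) * f w)) := by
  have hM0 : 0 ≤ M := (norm_nonneg _).trans (hM 0)
  have h0 : Tendsto (fun m : ℕ => ((m + 1 : ℝ)⁻¹)) atTop (𝓝 0) := by
    simpa using tendsto_one_div_add_atTop_nhds_zero_nat (𝕜 := ℝ)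
  have inner : ∀ w', Tendsto (fun m : ℕ => ∫ z : ι → E, (g (w' + ((m + 1 : ℝ)⁻¹) • z) : ℂ) * piGaussHat z)
      atTop (𝓝 (∫ z : ι → E, (g w' : ℂ) * piGaussHat z)) := by
    intro w'
    refine tendsto_integral_of_dominated_convergence (fun z => M * ‖piGaussHat z‖) ?_
      (integrable_piGaussHat.norm.const_mul M) ?_ ?_
    · intro m
      exact AEStronglyMeasurable.mul (by fun_prop) integrable_piGaussHat.1
    · refine fun m => ae_of_all _ fun z => ?_
      rw [norm_mul, Complex.norm_real]
      exact mul_le_mul_of_nonneg_right (hM _) (norm_nonneg _)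
    · refine ae_of_all _ fun z => Tendsto.mul_const _ ?_
      have : Tendsto (fun m : ℕ => w' + ((m + 1 : ℝ)⁻¹) • z) atTop (𝓝 w') := by
        simpa using (h0.smul_const z).const_add w'
      exact (Complex.continuous_ofReal.tendsto _).comp ((hg.tendsto _).comp this)
  have bound : ∀ (m : ℕ) w', ‖∫ z, (g (w' + ((m + 1 : ℝ)⁻¹) • z) : ℂ) * piGaussHat z‖ ≤
      M * ∫ z : ι → E, ‖piGaussHat z‖ := by
    intro m w'
    rw [← integral_const_mul]
    refine norm_integral_le_of_norm_le (integrable_piGaussHat.norm.const_mul M)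
      (ae_of_all _ fun z => ?_)
    rw [norm_mul, Complex.norm_real]
    exact mul_le_mul_of_nonneg_right (hM _) (norm_nonneg _)
  have hlim : inversionConst E ^ Fintype.card ι * ∫ w, (g w : ℂ) * f w =
      ∫ w', f w' * ∫ z : ι → E, (g w' : ℂ) * piGaussHat z := by
    rw [← integral_const_mul]
    refine integral_congr_ae (ae_of_all _ fun w => ?_)
    simp only [integral_const_mul, integral_piGaussHat]; ring
  rw [hlim]
  refine tendsto_integral_of_dominated_convergence
    (fun w => ‖f w‖ * (M * ∫ z : ι → E, ‖piGaussHat z‖)) ?_ (hf.norm.mul_const _) ?_ ?_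
  · intro m
    refine hf.1.mul ?_
    refine AEStronglyMeasurable.integral_prod_right' (μ := volume) (ν := volume)
      (f := fun p : (ι → E) × (ι → E) => (g (p.1 + ((m + 1 : ℝ)⁻¹) • p.2) : ℂ) * piGaussHat p.2) ?_
    exact AEStronglyMeasurable.mul (by fun_prop) integrable_piGaussHat.1.comp_snd
  · refine fun m => ae_of_all _ fun w => ?_
    rw [norm_mul]
    exact mul_le_mul_of_nonneg_left (bound m w) (norm_nonneg _)
  · exact ae_of_all _ fun w => (inner w).const_mul _

/-- Fourier inversion, almost everywhere, for an integrable function with integrable Fourier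
transform. -/
theorem ae_fourier_inversion {f : (ι → E) → ℂ} (hf : Integrable f)
    (hf' : Integrable fun l => ∫ w, piChar (-w) l * f w) :
    ∀ᵐ w, inversionConst E ^ Fintype.card ι * f w =
      ∫ l, piChar w l * ∫ w', piChar (-w') l * f w' := by
  set Φ : (ι → E) → ℂ := fun l => ∫ w, piChar (-w) l * f w with hΦ
  have hcont : Continuous fun w => ∫ l, piChar w l * Φ l := by
    refine continuous_of_dominated (bound := fun l => ‖Φ l‖) ?_ ?_ hf'.norm ?_
    · exact fun w => (continuous_piChar_right w).aestronglyMeasurable.mul hf'.1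
    · exact fun w => ae_of_all _ fun l => by rw [norm_mul, norm_piChar, one_mul]
    · exact ae_of_all _ fun l => (continuous_piChar_left l).mul continuous_const
  -- Both sides are tested against smooth g of compact support, with the summation factor `piGauss
  -- (R⁻¹ • l)` inserted. As R grows, Fubini and the approximate identity give the left side,
  -- dominated convergence the right side.
  refine ae_eq_of_integral_contDiff_smul_eq (hf.const_mul _).locallyIntegrable
    hcont.locallyIntegrable fun g hg hgc => ?_
  have hgcont : Continuous g := hg.continuous
  obtain ⟨M, hM⟩ := hgcont.bounded_above_of_compact_support hgc
  have hgi : Integrable g := hgcont.integrable_of_hasCompactSupport hgc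
  have key : ∀ m : ℕ, ∫ w, (g w : ℂ) * ∫ l, piChar w l * Φ l * piGauss ((m + 1 : ℝ)⁻¹ • l) =
      ∫ w', f w' * ∫ z, (g (w' + ((m + 1 : ℝ)⁻¹) • z) : ℂ) * piGaussHat z := by
    intro m
    have hR : (0 : ℝ) < m + 1 := by positivity
    set R : ℝ := m + 1
    set N := Module.finrank ℝ (ι → E)
    obtain ⟨B, hB⟩ : ∃ B, ∀ z : ι → E, ‖piGaussHat z‖ ≤ B := by
      refine ⟨∫ l : ι → E, ‖piGauss l‖, fun z => ?_⟩
      refine norm_integral_le_of_norm_le integrable_piGauss.norm (ae_of_all _ fun l => ?_)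
      rw [norm_mul, norm_piChar, one_mul]
    have hcG : Continuous (piGaussHat : (ι → E) → ℂ) := by
      rw [funext piGaussHat_eq]; fun_prop
    have hi : Integrable (fun p : (ι → E) × (ι → E) =>
        (R ^ N • piGaussHat (R • (p.1 - p.2))) * ((g p.1 : ℂ) * f p.2)) (volume.prod volume) := by
      refine (hgi.ofReal.mul_prod hf).bdd_mul (c := R ^ N * B) ?_ (ae_of_all _ fun p => ?_)
      · have hc : Continuous fun p : (ι → E) × (ι → E) => R ^ N • piGaussHat (R • (p.1 - p.2)) := by
          have := hcG.comp (by fun_prop :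
            Continuous fun p : (ι → E) × (ι → E) => R • (p.1 - p.2))
          exact this.const_smul (R ^ N)
        exact hc.aestronglyMeasurable
      · rw [norm_smul, Real.norm_of_nonneg (by positivity)]
        exact mul_le_mul_of_nonneg_left (hB _) (by positivity)
    calc ∫ w, (g w : ℂ) * ∫ l, piChar w l * Φ l * piGauss (R⁻¹ • l)
        = ∫ w, ∫ w', (R ^ N • piGaussHat (R • (w - w'))) * ((g w : ℂ) * f w') := by
          refine integral_congr_ae (ae_of_all _ fun w => ?_)
          simp only [hΦ]
          rw [integral_piChar_mul_gauss hf hR, ← integral_const_mul]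
          refine integral_congr_ae (ae_of_all _ fun w' => ?_)
          simp only; ring
      _ = ∫ w', ∫ w, (R ^ N • piGaussHat (R • (w - w'))) * ((g w : ℂ) * f w') :=
          integral_integral_swap hi
      _ = _ := by
          refine integral_congr_ae (ae_of_all _ fun w' => ?_)
          simp only
          have e1 := integral_add_left_eq_self (μ := (volume : Measure (ι → E)))
            (fun w => (R ^ N • piGaussHat (R • (w - w'))) * ((g w : ℂ) * f w')) w'
          rw [← e1]
          simp only [add_sub_cancel_left]
          have e2 := Measure.integral_comp_smul (volume : Measure (ι → E))
            (fun z => piGaussHat z * (g (w' + R⁻¹ • z) : ℂ)) R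
          simp only [smul_smul, inv_mul_cancel₀ hR.ne', one_smul] at e2
          rw [abs_of_pos (by positivity), eq_inv_smul_iff₀ (by positivity)] at e2
          calc ∫ x, R ^ N • piGaussHat (R • x) * ((g (w' + x) : ℂ) * f w')
              = ∫ x, f w' * (R ^ N • (piGaussHat (R • x) * (g (w' + x) : ℂ))) := by
                refine integral_congr_ae (ae_of_all _ fun x => ?_)
                simp only [Complex.real_smul]; ring
            _ = f w' * (R ^ N • ∫ x, piGaussHat (R • x) * (g (w' + x) : ℂ)) := by
                rw [integral_const_mul, integral_smul]
            _ = _ := by rw [e2]; simp only [mul_comm]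
  have lim1 := tendsto_integral_test hf hgcont hM
  have lim2 : Tendsto (fun m : ℕ => ∫ w, (g w : ℂ) *
      ∫ l, piChar w l * Φ l * piGauss ((m + 1 : ℝ)⁻¹ • l)) atTop
      (𝓝 (∫ w, (g w : ℂ) * ∫ l, piChar w l * Φ l)) := by
    have h0 : Tendsto (fun m : ℕ => ((m + 1 : ℝ)⁻¹)) atTop (𝓝 0) := by
      simpa using tendsto_one_div_add_atTop_nhds_zero_nat (𝕜 := ℝ)
    have hb : ∀ (m : ℕ) (w l : ι → E), ‖piChar w l * Φ l * piGauss ((m + 1 : ℝ)⁻¹ • l)‖ ≤ ‖Φ l‖ := by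
      intro m w l
      rw [norm_mul, norm_mul, norm_piChar, one_mul]
      exact mul_le_of_le_one_right (norm_nonneg _) (norm_piGauss_le _)
    refine tendsto_integral_of_dominated_convergence (fun w => ‖g w‖ * ∫ l, ‖Φ l‖) ?_
      (hgi.norm.mul_const _) ?_ ?_
    · intro m
      refine (by fun_prop : AEStronglyMeasurable (fun w => (g w : ℂ)) _).mul ?_
      refine AEStronglyMeasurable.integral_prod_right' (μ := volume) (ν := volume)
        (f := fun p : (ι → E) × (ι → E) =>
          piChar p.1 p.2 * Φ p.2 * piGauss ((m + 1 : ℝ)⁻¹ • p.2)) ?_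
      refine (continuous_piChar.aestronglyMeasurable.mul hf'.1.comp_snd).mul ?_
      exact (continuous_piGauss.comp (by fun_prop : Continuous
        fun p : (ι → E) × (ι → E) => (m + 1 : ℝ)⁻¹ • p.2)).aestronglyMeasurable
    · refine fun m => ae_of_all _ fun w => ?_
      rw [norm_mul, Complex.norm_real]
      exact mul_le_mul_of_nonneg_left (norm_integral_le_of_norm_le hf'.norm
        (ae_of_all _ (hb m w))) (norm_nonneg _)
    · refine ae_of_all _ fun w => Tendsto.const_mul _ ?_
      refine tendsto_integral_of_dominated_convergence (fun l => ‖Φ l‖) ?_ hf'.norm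
        (fun m => ae_of_all _ (hb m w)) (ae_of_all _ fun l => ?_)
      · intro m
        refine ((continuous_piChar_right w).aestronglyMeasurable.mul hf'.1).mul ?_
        exact (continuous_piGauss.comp (by fun_prop : Continuous
          fun l : ι → E => (m + 1 : ℝ)⁻¹ • l)).aestronglyMeasurable
      · have : Tendsto (fun m : ℕ => ((m + 1 : ℝ)⁻¹) • l) atTop (𝓝 0) := by
          simpa using h0.smul_const l
        have := (continuous_piGauss.tendsto _).comp this
        rw [piGauss_zero] at this
        simpa using this.const_mul (piChar w l * Φ l)
  simp_rw [key] at lim2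
  have := tendsto_nhds_unique lim1 lim2
  simp only [Complex.real_smul]
  rw [← this, ← integral_const_mul]
  refine integral_congr_ae (ae_of_all _ fun w => ?_)
  simp only; ring

end Inversion

end ProperNorms

namespace ProperNorms

/-! ### Cyclic integrals with shifted edges, and their smoothing -/

section Smoothing

variable {d n : ℕ}

/-- The convolution of two nonnegative functions. -/
noncomputable def convo (k U : EuclideanSpace ℝ (Fin d) → ℝ≥0∞) (z : EuclideanSpace ℝ (Fin d)) : ℝ≥0∞ := ∫⁻ w, k w * U (z - w)

/-- `w ↦ ∫ ∏ⱼ U(xⱼ₊₁ - xⱼ - wⱼ) ∏ⱼ dρⱼ(xⱼ)`. -/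
noncomputable def shiftedCycle (U : EuclideanSpace ℝ (Fin d) → ℝ≥0∞) (ρ : Fin n → Measure (EuclideanSpace ℝ (Fin d))) (w : Fin n → EuclideanSpace ℝ (Fin d)) : ℝ≥0∞ :=
  ∫⁻ x, ∏ j, U (x (finRotate n j) - x j - w j) ∂Measure.pi ρ

/-- `λ ↦ ∏ⱼ h(λⱼ) χⱼ(λⱼ - λⱼ₋₁)`. -/
noncomputable def cycleSymbol (h : EuclideanSpace ℝ (Fin d) → ℂ) (χ : Fin n → EuclideanSpace ℝ (Fin d) → ℂ) (l : Fin n → EuclideanSpace ℝ (Fin d)) : ℂ :=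
  (∏ j, h (l j)) * ∏ j, χ j (l j - l ((finRotate n).symm j))

variable {U : EuclideanSpace ℝ (Fin d) → ℝ≥0∞} (mU : Measurable U) (ρ : Fin n → Measure (EuclideanSpace ℝ (Fin d))) [∀ j, IsFiniteMeasure (ρ j)]

include mU in
theorem measurable_cycle_integrand :
    Measurable fun p : (Fin n → EuclideanSpace ℝ (Fin d)) × (Fin n → EuclideanSpace ℝ (Fin d)) =>
      ∏ j, U (p.2 (finRotate n j) - p.2 j - p.1 j) := by
  refine Finset.measurable_prod _ fun j _ => mU.comp ?_
  fun_prop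

include mU in
theorem measurable_shiftedCycle : Measurable (shiftedCycle U ρ) :=
  Measurable.lintegral_prod_right' (measurable_cycle_integrand mU)

include mU in
theorem lintegral_cycle_integrand (x : Fin n → EuclideanSpace ℝ (Fin d)) :
    ∫⁻ w : Fin n → EuclideanSpace ℝ (Fin d), ∏ j, U (x (finRotate n j) - x j - w j) = ∏ _j : Fin n, ∫⁻ z, U z := by
  rw [volume_pi, lintegral_pi_prod (fun _ => volume) (f := fun j w => U (x (finRotate n j) - x j - w)) fun j => by fun_prop]
  exact Finset.prod_congr rfl fun j _ => lintegral_sub_left_eq_self U _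

include mU in
-- Integrating over the shifts first replaces each factor by the total mass of U. The shifted
-- integral is thus integrable in w even though its value at w = 0 may be infinite.
theorem lintegral_shiftedCycle_ne_top (hU : ∫⁻ z, U z ≠ ∞) :
    ∫⁻ w, shiftedCycle U ρ w ≠ ∞ := by
  simp only [shiftedCycle]
  rw [lintegral_lintegral_swap (measurable_cycle_integrand mU).aemeasurable]
  simp only [lintegral_cycle_integrand mU, lintegral_const]
  exact ENNReal.mul_ne_top (ENNReal.prod_ne_top fun _ _ => hU) (measure_ne_top _ _)

include mU in
theorem integrable_cycle_integrand (hU : ∫⁻ z, U z ≠ ∞) :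
    Integrable (fun p : (Fin n → EuclideanSpace ℝ (Fin d)) × (Fin n → EuclideanSpace ℝ (Fin d)) =>
      ((∏ j, U (p.2 (finRotate n j) - p.2 j - p.1 j)).toReal)) (volume.prod (Measure.pi ρ)) := by
  refine integrable_toReal_of_lintegral_ne_top (measurable_cycle_integrand mU).aemeasurable ?_
  rw [lintegral_prod _ (measurable_cycle_integrand mU).aemeasurable]
  exact lintegral_shiftedCycle_ne_top mU ρ hU

include mU in
theorem toReal_shiftedCycle (hU : ∫⁻ z, U z ≠ ∞) : ∀ᵐ w : Fin n → EuclideanSpace ℝ (Fin d),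
    (shiftedCycle U ρ w).toReal =
      ∫ x, (∏ j, U (x (finRotate n j) - x j - w j)).toReal ∂Measure.pi ρ := by
  filter_upwards [ae_lt_top (measurable_shiftedCycle mU ρ) (lintegral_shiftedCycle_ne_top mU ρ hU)]
    with w hw
  have m := (measurable_cycle_integrand (n := n) mU).comp (measurable_prodMk_left (x := w))
  exact (integral_toReal m.aemeasurable (ae_lt_top m hw.ne)).symm

/-- Summation by parts around the cycle: ∑ ⟨xⱼ₊₁ - xⱼ, λⱼ⟩ = -∑ ⟨xⱼ, λⱼ - λⱼ₋₁⟩. -/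
theorem prod_exp_rotate (x l : Fin n → EuclideanSpace ℝ (Fin d)) :
    ∏ j, Complex.exp (-(Complex.I * (inner ℝ (x (finRotate n j) - x j) (l j) : ℝ))) =
      ∏ j, Complex.exp (Complex.I * (inner ℝ (x j) (l j - l ((finRotate n).symm j)) : ℝ)) := by
  have e : ∏ j, Complex.exp (-(Complex.I * (inner ℝ (x (finRotate n j)) (l j) : ℝ))) =
      ∏ j, Complex.exp (-(Complex.I * (inner ℝ (x j) (l ((finRotate n).symm j)) : ℝ))) := by
    rw [← Equiv.prod_comp (finRotate n) (fun j =>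
      Complex.exp (-(Complex.I * (inner ℝ (x j) (l ((finRotate n).symm j)) : ℝ))))]
    simp only [Equiv.symm_apply_apply]
  have e1 : ∀ j, Complex.exp (-(Complex.I * (inner ℝ (x (finRotate n j) - x j) (l j) : ℝ))) =
      Complex.exp (-(Complex.I * (inner ℝ (x (finRotate n j)) (l j) : ℝ))) *
        Complex.exp (Complex.I * (inner ℝ (x j) (l j) : ℝ)) := by
    intro j
    rw [← Complex.exp_add, inner_sub_left]; congr 1; push_cast; ring
  simp only [e1, Finset.prod_mul_distrib, e]
  rw [← Finset.prod_mul_distrib]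
  refine Finset.prod_congr rfl fun j _ => ?_
  rw [← Complex.exp_add, inner_sub_right]; congr 1; push_cast; ring

theorem integral_piChar_mul_cycle_integrand (x l : Fin n → EuclideanSpace ℝ (Fin d)) :
    ∫ w, piChar (-w) l * ((∏ j, U (x (finRotate n j) - x j - w j)).toReal : ℂ) =
      (∏ j, fourierFun U (l j)) *
        ∏ j, Complex.exp (Complex.I * (inner ℝ (x j) (l j - l ((finRotate n).symm j)) : ℝ)) := by
  have e : ∀ w : Fin n → EuclideanSpace ℝ (Fin d), piChar (-w) l * ((∏ j, U (x (finRotate n j) - x j - w j)).toReal : ℂ) =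
      ∏ j, (Complex.exp (Complex.I * (inner ℝ (-(w j)) (l j) : ℝ)) *
        ((U (x (finRotate n j) - x j - w j)).toReal : ℂ)) := by
    intro w
    rw [ENNReal.toReal_prod, Finset.prod_mul_distrib, piChar]
    push_cast; rfl
  simp only [e]
  rw [integral_fintype_prod_volume_eq_prod (fun j (w : EuclideanSpace ℝ (Fin d)) =>
    Complex.exp (Complex.I * (inner ℝ (-w) (l j) : ℝ)) *
        ((U (x (finRotate n j) - x j - w)).toReal : ℂ)), ← prod_exp_rotate,
    ← Finset.prod_mul_distrib]
  refine Finset.prod_congr rfl fun j _ => ?_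
  rw [fourierFun, ← integral_mul_const,
    ← integral_sub_left_eq_self _ volume (x (finRotate n j) - x j)]
  refine integral_congr_ae (ae_of_all _ fun w => ?_)
  simp only [sub_sub_cancel]
  rw [mul_right_comm, ← Complex.exp_add]
  congr 3
  simp only [inner_sub_left, inner_neg_left]; push_cast; ring

include mU in
/-- The Fourier transform of `shiftedCycle U ρ`. -/
theorem integral_piChar_mul_shiftedCycle (hU : ∫⁻ z, U z ≠ ∞) (l : Fin n → EuclideanSpace ℝ (Fin d)) :
    ∫ w, piChar (-w) l * ((shiftedCycle U ρ w).toReal : ℂ) =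
      cycleSymbol (fourierFun U) (fun j => charFun (ρ j)) l := by
  have hi := (integrable_cycle_integrand mU ρ hU).ofReal (𝕜 := ℂ)
  have hi' : Integrable (fun p : (Fin n → EuclideanSpace ℝ (Fin d)) × (Fin n → EuclideanSpace ℝ (Fin d)) => piChar (-p.1) l *
      (((∏ j, U (p.2 (finRotate n j) - p.2 j - p.1 j)).toReal : ℝ) : ℂ))
      (volume.prod (Measure.pi ρ)) := by
    refine hi.bdd_mul (c := 1) ?_ (ae_of_all _ fun p => (norm_piChar _ _).le)
    exact ((continuous_piChar_left l).comp (by fun_prop :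
      Continuous fun p : (Fin n → EuclideanSpace ℝ (Fin d)) × (Fin n → EuclideanSpace ℝ (Fin d)) => -p.1)).aestronglyMeasurable
  calc ∫ w, piChar (-w) l * ((shiftedCycle U ρ w).toReal : ℂ)
      = ∫ w, ∫ x, piChar (-w) l * (((∏ j, U (x (finRotate n j) - x j - w j)).toReal : ℝ) : ℂ)
          ∂Measure.pi ρ := by
        refine integral_congr_ae ?_
        filter_upwards [toReal_shiftedCycle mU ρ hU] with w hw
        rw [hw, integral_const_mul, integral_complex_ofReal]
    _ = ∫ x : Fin n → EuclideanSpace ℝ (Fin d), (∫ w, piChar (-w) l *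
          (((∏ j, U (x (finRotate n j) - x j - w j)).toReal : ℝ) : ℂ)) ∂Measure.pi ρ := integral_integral_swap hi'
    _ = _ := by
        simp only [integral_piChar_mul_cycle_integrand]
        rw [integral_const_mul, cycleSymbol, integral_fintype_prod_eq_prod (fun j (y : EuclideanSpace ℝ (Fin d)) =>
          Complex.exp (Complex.I * (inner ℝ y (l j - l ((finRotate n).symm j)) : ℝ)))]
        simp only [charFun_apply, mul_comm Complex.I]

theorem integrable_toReal_shiftedCycle {U : EuclideanSpace ℝ (Fin d) → ℝ≥0∞} (mU : Measurable U) (hU : ∫⁻ z, U z ≠ ∞)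
    (ρ : Fin n → Measure (EuclideanSpace ℝ (Fin d))) [∀ j, IsFiniteMeasure (ρ j)] :
    Integrable fun w => (shiftedCycle U ρ w).toReal :=
  integrable_toReal_of_lintegral_ne_top (measurable_shiftedCycle mU ρ).aemeasurable
    (lintegral_shiftedCycle_ne_top mU ρ hU)

/-- Integrability is asked of the combined symbol only: a signed measure may have finite norm
although its Jordan parts do not. -/
theorem ae_sum_shiftedCycle {U : EuclideanSpace ℝ (Fin d) → ℝ≥0∞} (mU : Measurable U) (hU : ∫⁻ z, U z ≠ ∞)
    {κ : Type*} [Fintype κ] (a : κ → ℝ)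
    (ρ : κ → Fin n → Measure (EuclideanSpace ℝ (Fin d))) [∀ i j, IsFiniteMeasure (ρ i j)]
    (hF : Integrable fun l => ∑ i, (a i : ℂ) *
      cycleSymbol (fourierFun U) (fun j => charFun (ρ i j)) l) :
    ∀ᵐ w, inversionConst (EuclideanSpace ℝ (Fin d)) ^ n * ∑ i, (a i : ℂ) * ((shiftedCycle U (ρ i) w).toReal : ℂ) =
      ∫ l, piChar w l * ∑ i, (a i : ℂ) *
        cycleSymbol (fourierFun U) (fun j => charFun (ρ i j)) l := by
  have hi : ∀ i, Integrable fun w => (a i : ℂ) * ((shiftedCycle U (ρ i) w).toReal : ℂ) :=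
    fun i => (integrable_toReal_shiftedCycle mU hU (ρ i)).ofReal.const_mul _
  have hf : Integrable fun w => ∑ i, (a i : ℂ) * ((shiftedCycle U (ρ i) w).toReal : ℂ) :=
    integrable_finsetSum _ fun i _ => hi i
  have e : ∀ l, ∫ w, piChar (-w) l * ∑ i, (a i : ℂ) * ((shiftedCycle U (ρ i) w).toReal : ℂ) =
      ∑ i, (a i : ℂ) * cycleSymbol (fourierFun U) (fun j => charFun (ρ i j)) l := by
    intro l
    simp only [Finset.mul_sum]
    rw [integral_finsetSum]
    · refine Finset.sum_congr rfl fun i _ => ?_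
      rw [← integral_piChar_mul_shiftedCycle mU (ρ i) hU, ← integral_const_mul]
      refine integral_congr_ae (ae_of_all _ fun w => ?_)
      simp only; ring
    · intro i _
      refine (hi i).bdd_mul (c := 1) ?_ (ae_of_all _ fun p => (norm_piChar _ _).le)
      exact ((continuous_piChar_left l).comp continuous_neg).aestronglyMeasurable
  have := ae_fourier_inversion hf (by simpa only [e] using hF)
  simpa only [e, Fintype.card_fin] using this

/-- Averaging over the shifts replaces U by its convolution with k on every edge. Knowledge about
almost all w thereby becomes knowledge about unshifted cyclic integrals. -/
theorem lintegral_prod_mul_shiftedCycle {U k : EuclideanSpace ℝ (Fin d) → ℝ≥0∞} (mU : Measurable U) (mk : Measurable k)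
    (ρ : Fin n → Measure (EuclideanSpace ℝ (Fin d))) [∀ j, IsFiniteMeasure (ρ j)] :
    ∫⁻ w, (∏ j, k (w j)) * shiftedCycle U ρ w =
      ∫⁻ x, cyclicProd (fun x y => convo k U (y - x)) x ∂Measure.pi ρ := by
  have mi := measurable_cycle_integrand (n := n) mU
  have mk' : Measurable fun w : Fin n → EuclideanSpace ℝ (Fin d) => ∏ j, k (w j) :=
    Finset.measurable_prod _ fun j _ => mk.comp (measurable_pi_apply j)
  have e : ∀ w : Fin n → EuclideanSpace ℝ (Fin d), (∏ j, k (w j)) * shiftedCycle U ρ w =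
      ∫⁻ x, (∏ j, k (w j)) * ∏ j, U (x (finRotate n j) - x j - w j) ∂Measure.pi ρ := by
    intro w
    exact (lintegral_const_mul _ (mi.comp (measurable_prodMk_left (x := w)))).symm
  simp only [e]
  rw [lintegral_lintegral_swap ((mk'.comp measurable_fst).mul mi).aemeasurable]
  refine lintegral_congr fun x => ?_
  simp only [← Finset.prod_mul_distrib]
  rw [volume_pi, lintegral_pi_prod (fun _ => volume) (f := fun j w => k w * U (x (finRotate n j) - x j - w))
    fun j => by fun_prop]
  rfl

/-- `k₁, k₂, …` are sub-probability densities converging weakly to the unit mass at `0`, such that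
the convolutions with `U` increase to `U`. -/
structure IsSmoothing (U : EuclideanSpace ℝ (Fin d) → ℝ≥0∞) (k : ℕ → EuclideanSpace ℝ (Fin d) → ℝ≥0∞) : Prop where
  measurable : Measurable U
  lintegral_ne_top : ∫⁻ z, U z ≠ ∞
  measurable_kernel : ∀ m, Measurable (k m)
  lintegral_kernel_le : ∀ m, ∫⁻ z, k m z ≤ 1
  mono : ∀ z, Monotone fun m => convo (k m) U z
  tendsto : ∀ z, Tendsto (fun m => convo (k m) U z) atTop (𝓝 (U z))
  tendsto_fourier : ∀ ξ, Tendsto (fun m => fourierFun (k m) ξ) atTop (𝓝 1)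

variable {k : ℕ → EuclideanSpace ℝ (Fin d) → ℝ≥0∞} (hk : IsSmoothing U k)

theorem measurable_convo {U k : EuclideanSpace ℝ (Fin d) → ℝ≥0∞} (mU : Measurable U) (mk : Measurable k) :
    Measurable (convo k U) :=
  Measurable.lintegral_prod_right' (f := fun p : EuclideanSpace ℝ (Fin d) × EuclideanSpace ℝ (Fin d) => k p.2 * U (p.1 - p.2)) (by fun_prop)

/-- Multiplication on [0,∞] is discontinuous at (0,∞). A zero limit of an increasing sequence forces
the sequence to be zero; if no limit is zero, that pair cannot occur. -/
theorem tendsto_prod_of_monotone {ι : Type*} (s : Finset ι) {a : ι → ℕ → ℝ≥0∞} {b : ι → ℝ≥0∞}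
    (hm : ∀ i, Monotone (a i)) (h : ∀ i, Tendsto (a i) atTop (𝓝 (b i))) :
    Tendsto (fun m => ∏ i ∈ s, a i m) atTop (𝓝 (∏ i ∈ s, b i)) := by
  by_cases h0 : ∃ i ∈ s, b i = 0
  · obtain ⟨i, hi, hb⟩ := h0
    rw [Finset.prod_eq_zero hi hb]
    have : ∀ m, a i m = 0 := fun m => le_antisymm (hb ▸ (hm i).ge_of_tendsto (h i) m) zero_le
    simp only [Finset.prod_eq_zero (f := fun i => a i _) hi (this _), tendsto_const_nhds]
  · push Not at h0
    classical
    induction s using Finset.induction_on with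
    | empty => simp
    | insert i s his ih =>
      simp only [Finset.prod_insert his]
      have h1 : ∀ j ∈ s, b j ≠ 0 := fun j hj => h0 j (Finset.mem_insert_of_mem hj)
      exact ENNReal.Tendsto.mul (h i) (Or.inl (h0 i (Finset.mem_insert_self _ _))) (ih h1)
        (Or.inl (Finset.prod_ne_zero_iff.2 h1))

omit [∀ j, IsFiniteMeasure (ρ j)] in
include hk in
theorem IsSmoothing.tendsto_lintegral :
    Tendsto (fun m => ∫⁻ x, cyclicProd (fun x y => convo (k m) U (y - x)) x ∂Measure.pi ρ) atTop
      (𝓝 (∫⁻ x, cyclicProd (fun x y => U (y - x)) x ∂Measure.pi ρ)) := by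
  refine lintegral_tendsto_of_tendsto_of_monotone (fun m => ?_) (ae_of_all _ fun x => ?_)
    (ae_of_all _ fun x => ?_)
  · have := measurable_convo hk.measurable (hk.measurable_kernel m)
    exact (measurable_cyclicProd (u := fun x y => convo (k m) U (y - x))
      (this.comp (measurable_snd.sub measurable_fst)) n).aemeasurable
  · intro a b hab
    exact Finset.prod_le_prod' fun j _ => hk.mono _ hab
  · exact tendsto_prod_of_monotone _ (fun j => hk.mono _) fun j => hk.tendsto _

omit [∀ j, IsFiniteMeasure (ρ j)] in
include hk in
theorem IsSmoothing.lintegral_le (m : ℕ) :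
    ∫⁻ x, cyclicProd (fun x y => convo (k m) U (y - x)) x ∂Measure.pi ρ ≤
      ∫⁻ x, cyclicProd (fun x y => U (y - x)) x ∂Measure.pi ρ :=
  lintegral_mono fun _ => Finset.prod_le_prod' fun _ _ => (hk.mono _).ge_of_tendsto (hk.tendsto _) m

include hk in
/-- The cyclic integral of positive measures converges if its Fourier transform is integrable. -/
theorem IsSmoothing.lintegral_cyclicProd_lt_top
    (hF : Integrable (cycleSymbol (fourierFun U) fun j => charFun (ρ j))) :
    ∫⁻ x, cyclicProd (fun x y => U (y - x)) x ∂Measure.pi ρ < ∞ := by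
  obtain ⟨c, hc, hce⟩ := exists_inversionConst (EuclideanSpace ℝ (Fin d))
  have h := ae_sum_shiftedCycle hk.measurable hk.lintegral_ne_top (fun _ : Unit => 1)
    (fun _ => ρ) (by simpa using hF)
  simp only [Finset.univ_unique, Finset.sum_singleton, Complex.ofReal_one, one_mul] at h
  set F := cycleSymbol (fourierFun U) fun j => charFun (ρ j)
  -- Inversion bounds the shifted integral uniformly in w, so averages with weights of mass at most
  -- 1 obey the same bound for all m, and so does their limit.
  have hb : ∀ᵐ w, shiftedCycle U ρ w ≤ ENNReal.ofReal ((c ^ n)⁻¹ * ∫ l, ‖F l‖) := by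
    filter_upwards [h, ae_lt_top (measurable_shiftedCycle hk.measurable ρ)
      (lintegral_shiftedCycle_ne_top hk.measurable ρ hk.lintegral_ne_top)] with w hw hw'
    refine (ENNReal.le_ofReal_iff_toReal_le hw'.ne (by positivity)).2 ?_
    have h2 : ‖∫ l, piChar w l * F l‖ ≤ ∫ l, ‖F l‖ := by
      refine norm_integral_le_of_norm_le hF.norm (ae_of_all _ fun l => ?_)
      rw [norm_mul, norm_piChar, one_mul]
    rw [← hw, norm_mul, norm_pow, hce, Complex.norm_real, Complex.norm_real,
      Real.norm_of_nonneg hc.le, Real.norm_of_nonneg ENNReal.toReal_nonneg] at h2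
    rwa [inv_mul_eq_div, le_div_iff₀' (by positivity)]
  refine lt_of_le_of_lt (le_of_tendsto' (hk.tendsto_lintegral ρ) fun m => ?_)
    (ENNReal.ofReal_lt_top (r := (c ^ n)⁻¹ * ∫ l, ‖F l‖))
  rw [← lintegral_prod_mul_shiftedCycle hk.measurable (hk.measurable_kernel m)]
  calc ∫⁻ w, (∏ j, k m (w j)) * shiftedCycle U ρ w
      ≤ ∫⁻ w : Fin n → EuclideanSpace ℝ (Fin d), (∏ j, k m (w j)) *
          ENNReal.ofReal ((c ^ n)⁻¹ * ∫ l, ‖F l‖) := by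
        refine lintegral_mono_ae ?_
        filter_upwards [hb] with w hw
        gcongr
    _ = (∏ _j : Fin n, ∫⁻ z, k m z) * ENNReal.ofReal ((c ^ n)⁻¹ * ∫ l, ‖F l‖) := by
        rw [lintegral_mul_const' _ _ ENNReal.ofReal_ne_top, volume_pi,
          lintegral_pi_prod (fun _ => volume) (f := fun _ => k m) fun _ => hk.measurable_kernel m]
    _ ≤ 1 * _ := by
        gcongr
        exact Finset.prod_le_one' fun _ _ => hk.lintegral_kernel_le m
    _ = _ := one_mul _

theorem integral_piChar_mul_kernel (k : EuclideanSpace ℝ (Fin d) → ℝ≥0∞)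
    (l : Fin n → EuclideanSpace ℝ (Fin d)) :
    ∫ w, piChar w l * ((∏ j, k (w j)).toReal : ℂ) = ∏ j, fourierFun k (l j) := by
  simp only [ENNReal.toReal_prod, piChar, Complex.ofReal_prod, ← Finset.prod_mul_distrib]
  exact integral_fintype_prod_volume_eq_prod (fun j (w : EuclideanSpace ℝ (Fin d)) =>
    Complex.exp (Complex.I * (inner ℝ w (l j) : ℝ)) * ((k w).toReal : ℂ))

theorem norm_fourierFun_le (k : EuclideanSpace ℝ (Fin d) → ℝ≥0∞) (mk : Measurable k)
    (ξ : EuclideanSpace ℝ (Fin d)) (hk : ∫⁻ z, k z ≠ ∞) :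
    ‖fourierFun k ξ‖ ≤ (∫⁻ z, k z).toReal := by
  refine (norm_integral_le_integral_norm _).trans ?_
  rw [← integral_toReal mk.aemeasurable (ae_lt_top mk hk)]
  refine (integral_congr_ae (ae_of_all _ fun z => ?_)).le
  rw [norm_mul, mul_comm Complex.I, Complex.norm_exp_ofReal_mul_I, one_mul, Complex.norm_real,
    Real.norm_of_nonneg ENNReal.toReal_nonneg]

include hk in
/-- The cyclic integral as a Fourier integral. -/
theorem IsSmoothing.sum_lintegral_cyclicProd {κ : Type*} [Fintype κ] (a : κ → ℝ)
    (ρ : κ → Fin n → Measure (EuclideanSpace ℝ (Fin d))) [∀ i j, IsFiniteMeasure (ρ i j)]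
    (hF : Integrable fun l => ∑ i, (a i : ℂ) *
      cycleSymbol (fourierFun U) (fun j => charFun (ρ i j)) l)
    (hfin : ∀ i, ∫⁻ x, cyclicProd (fun x y => U (y - x)) x ∂Measure.pi (ρ i) < ∞) :
    inversionConst (EuclideanSpace ℝ (Fin d)) ^ n * ∑ i, (a i : ℂ) *
        ((∫⁻ x, cyclicProd (fun x y => U (y - x)) x ∂Measure.pi (ρ i)).toReal : ℂ) =
      ∫ l, ∑ i, (a i : ℂ) * cycleSymbol (fourierFun U) (fun j => charFun (ρ i j)) l := by
  set c := inversionConst (EuclideanSpace ℝ (Fin d))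
  have hae := ae_sum_shiftedCycle hk.measurable hk.lintegral_ne_top a ρ hF
  set F := fun l => ∑ i, (a i : ℂ) * cycleSymbol (fourierFun U) (fun j => charFun (ρ i j)) l
  have lim1 : Tendsto (fun m => c ^ n * ∑ i, (a i : ℂ) * ((∫⁻ x, cyclicProd (fun x y =>
      convo (k m) U (y - x)) x ∂Measure.pi (ρ i)).toReal : ℂ)) atTop
      (𝓝 (c ^ n * ∑ i, (a i : ℂ) *
        ((∫⁻ x, cyclicProd (fun x y => U (y - x)) x ∂Measure.pi (ρ i)).toReal : ℂ))) := by
    refine Tendsto.const_mul _ (tendsto_finsetSum _ fun i _ => Tendsto.const_mul _ ?_)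
    exact (Complex.continuous_ofReal.tendsto _).comp
      ((ENNReal.tendsto_toReal (hfin i).ne).comp (hk.tendsto_lintegral (ρ i)))
  have mk' : ∀ m, Measurable fun w : Fin n → EuclideanSpace ℝ (Fin d) => ∏ j, k m (w j) :=
    fun m => Finset.measurable_prod _ fun j _ =>
      (hk.measurable_kernel m).comp (measurable_pi_apply j)
  have hkfin : ∀ m, ∫⁻ w : Fin n → EuclideanSpace ℝ (Fin d), ∏ j, k m (w j) ≠ ∞ := by
    intro m
    rw [volume_pi, lintegral_pi_prod (fun _ => volume) (f := fun _ => k m) fun _ => hk.measurable_kernel m]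
    exact ENNReal.prod_ne_top fun _ _ =>
      ((hk.lintegral_kernel_le m).trans_lt ENNReal.one_lt_top).ne
  have hki : ∀ m, Integrable fun w : Fin n → EuclideanSpace ℝ (Fin d) =>
      ((∏ j, k m (w j)).toReal : ℂ) := fun m =>
    (integrable_toReal_of_lintegral_ne_top (mk' m).aemeasurable (hkfin m)).ofReal
  -- The inversion formula is multiplied by ∏ k m (w j) and integrated over w; Fubini moves the
  -- Fourier transform onto the kernels.
  have key : ∀ m, c ^ n * ∑ i, (a i : ℂ) * ((∫⁻ x, cyclicProd (fun x y =>
      convo (k m) U (y - x)) x ∂Measure.pi (ρ i)).toReal : ℂ) =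
      ∫ l, F l * ∏ j, fourierFun (k m) (l j) := by
    intro m
    have hlt : ∀ i, ∫⁻ w, (∏ j, k m (w j)) * shiftedCycle U (ρ i) w ≠ ∞ := fun i => by
      rw [lintegral_prod_mul_shiftedCycle hk.measurable (hk.measurable_kernel m)]
      exact ((hk.lintegral_le (ρ i) m).trans_lt (hfin i)).ne
    have mm : ∀ i, Measurable fun w => (∏ j, k m (w j)) * shiftedCycle U (ρ i) w := fun i =>
      (mk' m).mul (measurable_shiftedCycle hk.measurable (ρ i))
    have hint : ∀ i, Integrable fun w =>
        (((∏ j, k m (w j)) * shiftedCycle U (ρ i) w).toReal : ℂ) := fun i =>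
      (integrable_toReal_of_lintegral_ne_top (mm i).aemeasurable (hlt i)).ofReal
    have e1 : ∀ i, ((∫⁻ x, cyclicProd (fun x y =>
        convo (k m) U (y - x)) x ∂Measure.pi (ρ i)).toReal : ℂ) =
        ∫ w, (((∏ j, k m (w j)) * shiftedCycle U (ρ i) w).toReal : ℂ) := by
      intro i
      rw [← lintegral_prod_mul_shiftedCycle hk.measurable (hk.measurable_kernel m),
        ← integral_toReal (mm i).aemeasurable (ae_lt_top (mm i) (hlt i)), integral_complex_ofReal]
    have hi2 : Integrable (fun p : (Fin n → EuclideanSpace ℝ (Fin d)) ×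
        (Fin n → EuclideanSpace ℝ (Fin d)) => piChar p.1 p.2 *
          (((∏ j, k m (p.1 j)).toReal : ℂ) * F p.2)) (volume.prod volume) := by
      refine ((hki m).mul_prod hF).bdd_mul (c := 1) ?_ (ae_of_all _ fun p => (norm_piChar _ _).le)
      exact continuous_piChar.aestronglyMeasurable
    calc c ^ n * ∑ i, (a i : ℂ) * ((∫⁻ x, cyclicProd (fun x y =>
          convo (k m) U (y - x)) x ∂Measure.pi (ρ i)).toReal : ℂ)
        = ∫ w, c ^ n * ∑ i, (a i : ℂ) *
            (((∏ j, k m (w j)) * shiftedCycle U (ρ i) w).toReal : ℂ) := by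
          rw [integral_const_mul, integral_finsetSum _ fun i _ => (hint i).const_mul _]
          simp only [e1, integral_const_mul]
      _ = ∫ w, ∫ l, piChar w l * (((∏ j, k m (w j)).toReal : ℂ) * F l) := by
          refine integral_congr_ae ?_
          filter_upwards [hae] with w hw
          have : ∀ l, piChar w l * (((∏ j, k m (w j)).toReal : ℂ) * F l) =
            ((∏ j, k m (w j)).toReal : ℂ) * (piChar w l * F l) := fun l => by ring
          simp only [this]
          rw [integral_const_mul, ← hw]
          simp only [ENNReal.toReal_mul, Complex.ofReal_mul, Finset.mul_sum]
          exact Finset.sum_congr rfl fun i _ => by ring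
      _ = ∫ l, ∫ w, piChar w l * (((∏ j, k m (w j)).toReal : ℂ) * F l) :=
          integral_integral_swap hi2
      _ = _ := by
          refine integral_congr_ae (ae_of_all _ fun l => ?_)
          simp only [← mul_assoc]
          rw [integral_mul_const, integral_piChar_mul_kernel, mul_comm]
  -- The transforms of the kernels tend to 1 and are bounded by 1, so ‖F‖ dominates.
  have lim2 : Tendsto (fun m => ∫ l, F l * ∏ j, fourierFun (k m) (l j)) atTop (𝓝 (∫ l, F l)) := by
    refine tendsto_integral_of_dominated_convergence (fun l => ‖F l‖) ?_ hF.norm ?_ ?_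
    · intro m
      refine hF.1.mul ?_
      simp only [← integral_piChar_mul_kernel]
      refine AEStronglyMeasurable.integral_prod_right' (μ := volume) (ν := volume)
        (f := fun p : (Fin n → EuclideanSpace ℝ (Fin d)) × (Fin n → EuclideanSpace ℝ (Fin d)) =>
          piChar p.2 p.1 * ((∏ j, k m (p.2 j)).toReal : ℂ)) ?_
      exact (continuous_piChar.comp continuous_swap).aestronglyMeasurable.mul
        (hki m).1.comp_snd
    · refine fun m => ae_of_all _ fun l => ?_
      rw [norm_mul, norm_prod]
      refine mul_le_of_le_one_right (norm_nonneg _)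
        (Finset.prod_le_one (fun _ _ => norm_nonneg _) fun j _ => ?_)
      have h1 := hk.lintegral_kernel_le m
      refine (norm_fourierFun_le _ (hk.measurable_kernel m) _
        (h1.trans_lt ENNReal.one_lt_top).ne).trans ?_
      exact ENNReal.toReal_le_of_le_ofReal zero_le_one (by simpa using h1)
    · refine ae_of_all _ fun l => ?_
      have := tendsto_finsetProd (Finset.univ : Finset (Fin n)) fun j _ => hk.tendsto_fourier (l j)
      simpa using this.const_mul (F l)
  simp only [key] at lim1
  exact tendsto_nhds_unique lim1 lim2

end Smoothing

end ProperNorms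

namespace ProperNorms

/-! ### Weighted Fourier norms, Parseval's identity, and ‖·‖_{γ,2} -/

section FourierNorms

variable {d : ℕ}

theorem fourierMeas_eq (ν : SignedMeasure (EuclideanSpace ℝ (Fin d)))
    (ξ : EuclideanSpace ℝ (Fin d)) :
    fourierMeas ν ξ = charFun (pos ν) ξ - charFun (neg ν) ξ := by
  simp only [fourierMeas, sint, charFun_apply, mul_comm Complex.I]

theorem continuous_fourierMeas (ν : SignedMeasure (EuclideanSpace ℝ (Fin d))) :
    Continuous (fourierMeas ν) := by
  rw [funext (fourierMeas_eq ν)]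
  exact continuous_charFun.sub continuous_charFun

theorem charFun_add_measure (μ₁ μ₂ : Measure (EuclideanSpace ℝ (Fin d))) [IsFiniteMeasure μ₁]
    [IsFiniteMeasure μ₂] (ξ : EuclideanSpace ℝ (Fin d)) :
    charFun (μ₁ + μ₂) ξ = charFun μ₁ ξ + charFun μ₂ ξ := by
  have hi : ∀ (μ : Measure (EuclideanSpace ℝ (Fin d))) [IsFiniteMeasure μ],
      Integrable (fun x => Complex.exp ((inner ℝ x ξ : ℝ) * Complex.I)) μ := fun μ _ =>
    Integrable.of_bound (C := 1) (by fun_prop)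
      (ae_of_all _ fun x => (Complex.norm_exp_ofReal_mul_I _).le)
  simp only [charFun_apply]
  exact integral_add_measure (hi μ₁) (hi μ₂)

theorem charFun_nnreal_smul (c : ℝ≥0) (μ : Measure (EuclideanSpace ℝ (Fin d)))
    (ξ : EuclideanSpace ℝ (Fin d)) : charFun (c • μ) ξ = c * charFun μ ξ := by
  simp only [charFun_apply]
  rw [integral_smul_nnreal_measure, NNReal.smul_def, Complex.real_smul]

theorem fourierMeas_add (ν ν' : SignedMeasure (EuclideanSpace ℝ (Fin d)))
    (ξ : EuclideanSpace ℝ (Fin d)) :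
    fourierMeas (ν + ν') ξ = fourierMeas ν ξ + fourierMeas ν' ξ := by
  have h := congrArg (fun μ => charFun μ ξ) (pos_add_eq_neg_add (add_eq_pos_sub_neg ν ν'))
  simp only [charFun_add_measure] at h
  simp only [fourierMeas_eq]
  linear_combination h

theorem fourierMeas_smul (c : ℝ) (ν : SignedMeasure (EuclideanSpace ℝ (Fin d)))
    (ξ : EuclideanSpace ℝ (Fin d)) : fourierMeas (c • ν) ξ = c * fourierMeas ν ξ := by
  simp only [fourierMeas_eq]
  rcases lt_or_ge c 0 with hc | hc
  · rw [(pos_smul_of_neg hc ν).1, (pos_smul_of_neg hc ν).2, charFun_nnreal_smul,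
      charFun_nnreal_smul, Real.coe_toNNReal _ (by linarith)]
    push_cast; ring
  · rw [(pos_smul_of_nonneg hc ν).1, (pos_smul_of_nonneg hc ν).2, charFun_nnreal_smul,
      charFun_nnreal_smul, Real.coe_toNNReal _ hc]
    ring

theorem eq_zero_of_fourierMeas_eq_zero {ν : SignedMeasure (EuclideanSpace ℝ (Fin d))}
    (h : ∀ᵐ ξ, fourierMeas ν ξ = 0) : ν = 0 := by
  have h' : fourierMeas ν = fun _ => 0 :=
    ((continuous_fourierMeas ν).ae_eq_iff_eq volume continuous_const).1 h
  refine eq_zero_of_pos_eq_neg (Measure.ext_of_charFun (funext fun ξ => ?_))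
  have := congrFun h' ξ
  rw [fourierMeas_eq] at this
  exact sub_eq_zero.1 this

/-- The `L²` norm of `(λ, λ') ↦ ν̂(λ - λ')` with respect to the weight `ω`. -/
noncomputable def weightNorm (ω : EuclideanSpace ℝ (Fin d) × EuclideanSpace ℝ (Fin d) → ℝ≥0∞)
    (ν : SignedMeasure (EuclideanSpace ℝ (Fin d))) : ℝ≥0∞ :=
  (∫⁻ p, ω p * ‖fourierMeas ν (p.1 - p.2)‖ₑ ^ 2) ^ (1 / 2 : ℝ)

theorem measurable_enorm_fourierMeas_sub (ν : SignedMeasure (EuclideanSpace ℝ (Fin d))) :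
    Measurable fun p : EuclideanSpace ℝ (Fin d) × EuclideanSpace ℝ (Fin d) =>
      ‖fourierMeas ν (p.1 - p.2)‖ₑ :=
  ((continuous_fourierMeas ν).comp (continuous_fst.sub continuous_snd)).measurable.enorm

variable {ω : EuclideanSpace ℝ (Fin d) × EuclideanSpace ℝ (Fin d) → ℝ≥0∞}

theorem weightNorm_add_le (hω : Measurable ω) (ν ν' : SignedMeasure (EuclideanSpace ℝ (Fin d))) :
    weightNorm ω (ν + ν') ≤ weightNorm ω ν + weightNorm ω ν' := by
  have m := measurable_enorm_fourierMeas_sub ν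
  have m' := measurable_enorm_fourierMeas_sub ν'
  have e : ∀ f : EuclideanSpace ℝ (Fin d) × EuclideanSpace ℝ (Fin d) → ℝ≥0∞, Measurable f →
      ∫⁻ p, ω p * f p ^ 2 = ∫⁻ p, f p ^ 2 ∂volume.withDensity ω := fun f hf => by
    rw [lintegral_withDensity_eq_lintegral_mul _ hω (hf.pow_const 2)]; rfl
  have h := ENNReal.lintegral_Lp_add_le (μ := volume.withDensity ω) (p := 2)
    m.aemeasurable m'.aemeasurable (by norm_num)
  simp only [Pi.add_apply, ENNReal.rpow_two] at h
  rw [← e _ m, ← e _ m'] at h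
  refine le_trans ?_ h
  rw [← e (fun p => ‖fourierMeas ν (p.1 - p.2)‖ₑ + ‖fourierMeas ν' (p.1 - p.2)‖ₑ) (m.add m'),
    weightNorm]
  gcongr with p
  rw [fourierMeas_add]
  exact enorm_add_le _ _

theorem weightNorm_smul (c : ℝ) (ν : SignedMeasure (EuclideanSpace ℝ (Fin d))) :
    weightNorm ω (c • ν) = ENNReal.ofReal |c| * weightNorm ω ν := by
  have hc : ‖(c : ℂ)‖ₑ = ENNReal.ofReal |c| := by
    rw [← ofReal_norm, Complex.norm_real, Real.norm_eq_abs]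
  have e : ∀ p : EuclideanSpace ℝ (Fin d) × EuclideanSpace ℝ (Fin d),
      ω p * ‖fourierMeas (c • ν) (p.1 - p.2)‖ₑ ^ 2 =
        ENNReal.ofReal |c| ^ 2 * (ω p * ‖fourierMeas ν (p.1 - p.2)‖ₑ ^ 2) := fun p => by
    rw [fourierMeas_smul, enorm_mul, hc, mul_pow]; ring
  simp only [weightNorm, e]
  rw [lintegral_const_mul' _ _ (ENNReal.pow_ne_top ENNReal.ofReal_ne_top),
    ENNReal.mul_rpow_of_nonneg _ _ (by norm_num), sq_rpow_half]

theorem weightNorm_mono {ω' : EuclideanSpace ℝ (Fin d) × EuclideanSpace ℝ (Fin d) → ℝ≥0∞}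
    (h : ∀ p, ω p ≤ ω' p) (ν : SignedMeasure (EuclideanSpace ℝ (Fin d))) :
    weightNorm ω ν ≤ weightNorm ω' ν := by
  unfold weightNorm
  gcongr with p
  exact h p

variable {h : EuclideanSpace ℝ (Fin d) → ℂ}

/-- Evenness of `H` turns the convolution into a correlation, and a = x + b separates the two
factors. -/
theorem lintegral_mul_convolution {H G : EuclideanSpace ℝ (Fin d) → ℝ≥0∞} (mH : Measurable H)
    (mG : Measurable G) (hsymm : ∀ ξ, H (-ξ) = H ξ) :
    ∫⁻ x, G x * ∫⁻ y, H (x - y) * H y = ∫⁻ p : EuclideanSpace ℝ (Fin d) × EuclideanSpace ℝ (Fin d),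
      H p.1 * H p.2 * G (p.1 - p.2) := by
  calc ∫⁻ x, G x * ∫⁻ y, H (x - y) * H y
      = ∫⁻ x, ∫⁻ b, H (x + b) * H b * G x := by
        refine lintegral_congr fun x => ?_
        rw [lintegral_mul_const _ (by fun_prop), mul_comm]
        congr 1
        rw [← lintegral_neg_eq_self]
        simp only [sub_neg_eq_add, hsymm]
    _ = ∫⁻ b, ∫⁻ x, H (x + b) * H b * G x := lintegral_lintegral_swap (by fun_prop)
    _ = ∫⁻ b, ∫⁻ a, H a * H b * G (a - b) := by
        refine lintegral_congr fun b => ?_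
        have := lintegral_add_right_eq_self (μ := volume) (fun a => H a * H b * G (a - b)) b
        simpa only [add_sub_cancel_right] using this
    _ = _ := by
        rw [Measure.volume_eq_prod, lintegral_prod_symm _ (by fun_prop)]

theorem gammaNorm_eq_weightNorm (mh : Measurable h) (hsymm : ∀ ξ, ‖h (-ξ)‖ₑ = ‖h ξ‖ₑ)
    (ν : SignedMeasure (EuclideanSpace ℝ (Fin d))) :
    gammaNorm h ν = weightNorm (fun p => ‖h p.1‖ₑ * ‖h p.2‖ₑ) ν := by
  rw [gammaNorm, weightNorm]
  congr 1
  exact lintegral_mul_convolution (G := fun x => ‖fourierMeas ν x‖ₑ ^ 2) mh.enorm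
    ((continuous_fourierMeas ν).measurable.enorm.pow_const 2) hsymm

theorem enorm_finsetProd {ι : Type*} (s : Finset ι) (f : ι → ℂ) :
    ‖∏ j ∈ s, f j‖ₑ = ∏ j ∈ s, ‖f j‖ₑ := by
  simp only [← ofReal_norm, norm_prod]
  exact ENNReal.ofReal_prod_of_nonneg fun _ _ => norm_nonneg _

/-- Each vertex factor |h(λⱼ)| is split into two square roots, one for each adjacent edge. The L²
norms of the resulting edge kernels are the weighted norms of the νⱼ, and the trace inequality
applies. -/
theorem lintegral_enorm_cycleSymbol_le {n : ℕ} (hn : 2 ≤ n) (mh : Measurable h)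
    (ν : Fin n → SignedMeasure (EuclideanSpace ℝ (Fin d))) :
    ∫⁻ l, ‖cycleSymbol h (fun j => fourierMeas (ν j)) l‖ₑ ≤
      ∏ j, weightNorm (fun p => ‖h p.1‖ₑ * ‖h p.2‖ₑ) (ν j) := by
  have mh' : Measurable fun ξ => ‖h ξ‖ₑ := mh.enorm
  let F : Fin n → EuclideanSpace ℝ (Fin d) × EuclideanSpace ℝ (Fin d) → ℝ≥0∞ := fun i p =>
    ‖h p.1‖ₑ ^ (1 / 2 : ℝ) * ‖h p.2‖ₑ ^ (1 / 2 : ℝ) * ‖fourierMeas (ν i) (p.2 - p.1)‖ₑ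
  have mF : ∀ i, Measurable (F i) := fun i => by
    have : Measurable fun p : EuclideanSpace ℝ (Fin d) × EuclideanSpace ℝ (Fin d) =>
      ‖fourierMeas (ν i) (p.2 - p.1)‖ₑ :=
      ((continuous_fourierMeas (ν i)).comp (continuous_snd.sub continuous_fst)).measurable.enorm
    exact (((mh'.comp measurable_fst).pow_const _).mul
      ((mh'.comp measurable_snd).pow_const _)).mul this
  have hF : ∀ i, kernelNorm volume (F i) = weightNorm (fun p => ‖h p.1‖ₑ * ‖h p.2‖ₑ) (ν i) := by
    intro i
    rw [kernelNorm, weightNorm, Measure.volume_eq_prod, ← lintegral_prod_swap]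
    congr 2
    ext p
    simp only [F, Prod.fst_swap, Prod.snd_swap, mul_pow, rpow_half_sq]
    ring
  have := lintegral_ring_le (μ := volume) hn (F := fun j => F (finRotate n j)) fun j => mF _
  rw [Equiv.prod_comp (finRotate n) (fun j => kernelNorm volume (F j))] at this
  simp only [hF] at this
  refine le_trans (le_of_eq ?_) this
  rw [volume_pi]
  refine lintegral_congr fun l => ?_
  have e1 : ∏ j, ‖h (l (finRotate n j))‖ₑ ^ (1 / 2 : ℝ) = ∏ j, ‖h (l j)‖ₑ ^ (1 / 2 : ℝ) :=
    Equiv.prod_comp (finRotate n) (fun j => ‖h (l j)‖ₑ ^ (1 / 2 : ℝ))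
  have e2 : ∏ j, ‖fourierMeas (ν j) (l j - l ((finRotate n).symm j))‖ₑ =
      ∏ j, ‖fourierMeas (ν (finRotate n j)) (l (finRotate n j) - l j)‖ₑ := by
    rw [← Equiv.prod_comp (finRotate n)
      (fun j => ‖fourierMeas (ν j) (l j - l ((finRotate n).symm j))‖ₑ)]
    simp only [Equiv.symm_apply_apply]
  simp only [F, cycleSymbol, enorm_mul, Finset.prod_mul_distrib, e1, enorm_finsetProd, e2]
  congr 1
  rw [← Finset.prod_mul_distrib]
  refine Finset.prod_congr rfl fun j _ => ?_
  rw [← sq, rpow_half_sq]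

theorem measurable_cycleSymbol {n : ℕ} (mh : Measurable h) {χ : Fin n → EuclideanSpace ℝ (Fin d) → ℂ}
    (hχ : ∀ j, Measurable (χ j)) : Measurable (cycleSymbol h χ) := by
  unfold cycleSymbol
  refine (Finset.measurable_prod _ fun j _ => by fun_prop).mul
    (Finset.measurable_prod _ fun j _ => (hχ j).comp ?_)
  exact (measurable_pi_apply j).sub (measurable_pi_apply _)

theorem integrable_cycleSymbol {n : ℕ} (hn : 2 ≤ n) (mh : Measurable h)
    {ν : Fin n → SignedMeasure (EuclideanSpace ℝ (Fin d))}
    (hfin : ∀ j, weightNorm (fun p => ‖h p.1‖ₑ * ‖h p.2‖ₑ) (ν j) < ∞) :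
    Integrable (cycleSymbol h fun j => fourierMeas (ν j)) := by
  refine ⟨(measurable_cycleSymbol mh fun j =>
    (continuous_fourierMeas _).measurable).aestronglyMeasurable, ?_⟩
  exact (lintegral_enorm_cycleSymbol_le hn mh ν).trans_lt
    (ENNReal.prod_lt_top fun j _ => hfin j)

theorem cycleSymbol_fourierMeas {n : ℕ} (ν : Fin n → SignedMeasure (EuclideanSpace ℝ (Fin d)))
    (l : Fin n → EuclideanSpace ℝ (Fin d)) :
    cycleSymbol h (fun j => fourierMeas (ν j)) l =
      ∑ ε : Fin n → Bool, (((∏ j, if ε j then (1 : ℝ) else -1 : ℝ)) : ℂ) *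
        cycleSymbol h (fun j => charFun (if ε j then pos (ν j) else neg (ν j))) l := by
  simp only [cycleSymbol, fourierMeas_eq]
  rw [← sum_signs_mul_prod, Finset.mul_sum]
  refine Finset.sum_congr rfl fun ε _ => ?_
  rw [mul_left_comm]
  congr 1
  · push_cast
    exact Finset.prod_congr rfl fun j _ => by split_ifs <;> simp
  · congr 1
    exact Finset.prod_congr rfl fun j _ => by split_ifs <;> rfl

theorem measurable_fourierFun {U : EuclideanSpace ℝ (Fin d) → ℝ≥0∞} (mU : Measurable U) :
    Measurable (fourierFun U) := by
  have : StronglyMeasurable fun p : EuclideanSpace ℝ (Fin d) × EuclideanSpace ℝ (Fin d) =>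
      Complex.exp (Complex.I * (inner ℝ p.2 p.1 : ℝ)) * ((U p.2).toReal : ℂ) := by
    refine Measurable.stronglyMeasurable ?_
    fun_prop
  exact this.integral_prod_right.measurable

theorem enorm_fourierFun_neg (U : EuclideanSpace ℝ (Fin d) → ℝ≥0∞)
    (ξ : EuclideanSpace ℝ (Fin d)) : ‖fourierFun U (-ξ)‖ₑ = ‖fourierFun U ξ‖ₑ := by
  have : fourierFun U (-ξ) = starRingEnd ℂ (fourierFun U ξ) := by
    rw [fourierFun, fourierFun, ← integral_conj]
    refine integral_congr_ae (ae_of_all _ fun z => ?_)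
    simp [← Complex.exp_conj, inner_neg_right]
  rw [this, ← ofReal_norm, ← ofReal_norm, RCLike.norm_conj]

variable {U : EuclideanSpace ℝ (Fin d) → ℝ≥0∞} {k : ℕ → EuclideanSpace ℝ (Fin d) → ℝ≥0∞}
  (hk : IsSmoothing U k)

include hk in
theorem IsSmoothing.gammaNorm_eq (ν : SignedMeasure (EuclideanSpace ℝ (Fin d))) :
    gammaNorm (fourierFun U) ν =
      weightNorm (fun p => ‖fourierFun U p.1‖ₑ * ‖fourierFun U p.2‖ₑ) ν :=
  gammaNorm_eq_weightNorm (measurable_fourierFun hk.measurable) (enorm_fourierFun_neg U) ν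

include hk in
/-- Parseval's identity for the cyclic integrals. -/
theorem IsSmoothing.cyclicInt_eq {n : ℕ} (hn : 2 ≤ n)
    {ν : Fin n → SignedMeasure (EuclideanSpace ℝ (Fin d))}
    (hfin : ∀ j, gammaNorm (fourierFun U) (ν j) < ∞)
    (hc : CyclicConverges (fun x y => U (y - x)) ν) :
    inversionConst (EuclideanSpace ℝ (Fin d)) ^ n * (cyclicInt (fun x y => U (y - x)) ν : ℂ) =
      ∫ l, cycleSymbol (fourierFun U) (fun j => fourierMeas (ν j)) l := by
  have mu : Measurable fun p : EuclideanSpace ℝ (Fin d) × EuclideanSpace ℝ (Fin d) =>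
      U (p.2 - p.1) := hk.measurable.comp (measurable_snd.sub measurable_fst)
  have hi := integrable_cycleSymbol hn (measurable_fourierFun hk.measurable)
    (fun j => (hk.gammaNorm_eq (ν j)) ▸ hfin j)
  have hinst : ∀ (ε : Fin n → Bool) j, IsFiniteMeasure (if ε j then pos (ν j) else neg (ν j)) := by
    intro ε j; split_ifs <;> infer_instance
  have := hk.sum_lintegral_cyclicProd (fun ε : Fin n → Bool => ∏ j, if ε j then (1 : ℝ) else -1)
    (fun ε j => if ε j then pos (ν j) else neg (ν j))
    (by simpa only [← cycleSymbol_fourierMeas] using hi)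
    (fun ε => lintegral_cyclicProd_signs_lt_top mu hc ε)
  simp only [← cycleSymbol_fourierMeas] at this
  rw [← this, cyclicInt]
  push_cast
  rfl

theorem cyclicInt_eq_zero {S : Type*} [MeasurableSpace S] {u : S → S → ℝ≥0∞} {n : ℕ}
    {ν : Fin n → SignedMeasure S} {i : Fin n} (h : ν i = 0) : cyclicInt u ν = 0 := by
  refine Finset.sum_eq_zero fun ε _ => ?_
  have hinst : ∀ j, IsFiniteMeasure (if ε j then pos (ν j) else neg (ν j)) := by
    intro j; split_ifs <;> infer_instance
  have : Measure.pi (fun j => if ε j then pos (ν j) else neg (ν j)) = 0 := by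
    rw [← Measure.measure_univ_eq_zero, Measure.pi_univ]
    exact Finset.prod_eq_zero (Finset.mem_univ i) (by split_ifs <;> simp [h, pos_of_zero, neg_of_zero])
  simp [this]

/-- Without zeros of h the weight γ is positive, possibly infinite, at every point. A zero norm
therefore forces the continuous function ν̂ to vanish. -/
theorem gammaNorm_eq_zero (mh : Measurable h) (h0 : ∀ ξ, h ξ ≠ 0)
    {ν : SignedMeasure (EuclideanSpace ℝ (Fin d))} (hν : gammaNorm h ν = 0) : ν = 0 := by
  have mh' : Measurable fun ξ => ‖h ξ‖ₑ := mh.enorm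
  have mν : Measurable fun ξ => ‖fourierMeas ν ξ‖ₑ := (continuous_fourierMeas ν).measurable.enorm
  have mg : Measurable (gam h) := Measurable.lintegral_prod_right'
    (f := fun p : EuclideanSpace ℝ (Fin d) × EuclideanSpace ℝ (Fin d) =>
      ‖h (p.1 - p.2)‖ₑ * ‖h p.2‖ₑ) (by fun_prop)
  have gpos : ∀ x, gam h x ≠ 0 := by
    intro x hx
    rw [gam, lintegral_eq_zero_iff (by fun_prop)] at hx
    have : ∀ᵐ _ : EuclideanSpace ℝ (Fin d), False := by
      filter_upwards [hx] with y hy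
      simp [h0] at hy
    exact NeZero.ne _ (ae_eq_bot.1 (eventually_false_iff_eq_bot.1 this))
  rw [gammaNorm, ENNReal.rpow_eq_zero_iff_of_pos (by norm_num),
    lintegral_eq_zero_iff (by fun_prop)] at hν
  refine eq_zero_of_fourierMeas_eq_zero ?_
  filter_upwards [hν] with ξ hξ
  simpa [gpos] using hξ

include hk in
theorem IsSmoothing.isProperNorm_gammaNorm (h0 : ∀ ξ, fourierFun U ξ ≠ 0) :
    IsProperNorm univ (fun x y => U (y - x)) (gammaNorm (fourierFun U)) := by
  have mh := measurable_fourierFun hk.measurable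
  have mh' : Measurable fun ξ => ‖fourierFun U ξ‖ₑ := mh.enorm
  have mω : Measurable fun p : EuclideanSpace ℝ (Fin d) × EuclideanSpace ℝ (Fin d) =>
    ‖fourierFun U p.1‖ₑ * ‖fourierFun U p.2‖ₑ := by fun_prop
  have mu : Measurable fun p : EuclideanSpace ℝ (Fin d) × EuclideanSpace ℝ (Fin d) =>
      U (p.2 - p.1) := hk.measurable.comp (measurable_snd.sub measurable_fst)
  have hadd : ∀ ν ν', gammaNorm (fourierFun U) (ν + ν') ≤
      gammaNorm (fourierFun U) ν + gammaNorm (fourierFun U) ν' := fun ν ν' => by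
    simpa only [hk.gammaNorm_eq] using weightNorm_add_le mω ν ν'
  refine ⟨⟨fun c ν _ => ?_, fun ν _ ν' _ => hadd ν ν', fun n hn ν hν => ?_, ?_⟩,
    fun ν _ h => gammaNorm_eq_zero mh h0 h⟩
  · simpa only [hk.gammaNorm_eq] using weightNorm_smul c ν
  · choose ρ h1 h2 h3 using fun j => exists_le_of_mem_finitePart (hν j) fun ν _ ν' _ => hadd ν ν'
    have hpi := lintegral_pi_mono (fun j => h1 j)
      (measurable_cyclicProd (u := fun x y => U (y - x)) mu n)
    refine lt_of_le_of_lt hpi ?_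
    simp only [fun j => totalVariation_of_nonneg (h2 j)]
    refine hk.lintegral_cyclicProd_lt_top _ ?_
    have hi := integrable_cycleSymbol hn mh (fun j => (hk.gammaNorm_eq (ρ j)) ▸ h3 j)
    have e : ∀ j, fourierMeas (ρ j) = charFun (pos (ρ j)) := fun j => by
      ext ξ; rw [fourierMeas_eq, neg_eq_zero_of_nonneg (h2 j), charFun_zero_measure, sub_zero]
    simpa only [e] using hi
  · obtain ⟨c, hc, hce⟩ := exists_inversionConst (EuclideanSpace ℝ (Fin d))
    -- Parseval's identity carries one factor c for each of the n variables, so C = 1/c.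
    refine ⟨(c⁻¹).toNNReal, fun n hn ν _ hconv => ?_⟩
    -- A zero measure is treated apart: another norm may be infinite, and then 0 · ∞ = 0 makes the
    -- bound nontrivial outside the range of Parseval's identity.
    by_cases hz : ∃ i, ν i = 0
    · obtain ⟨i, hi⟩ := hz
      simp [cyclicInt_eq_zero hi]
    push Not at hz
    by_cases hfin : ∀ j, gammaNorm (fourierFun U) (ν j) < ∞
    · have key := hk.cyclicInt_eq hn hfin hconv
      have h1 : ENNReal.ofReal (c ^ n) * ENNReal.ofReal |cyclicInt (fun x y => U (y - x)) ν| ≤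
          ∏ j, gammaNorm (fourierFun U) (ν j) := by
        rw [← ENNReal.ofReal_mul (by positivity)]
        have : c ^ n * |cyclicInt (fun x y => U (y - x)) ν| =
            ‖∫ l, cycleSymbol (fourierFun U) (fun j => fourierMeas (ν j)) l‖ := by
          rw [← key, hce, norm_mul, norm_pow, Complex.norm_real, Complex.norm_real,
            Real.norm_of_nonneg hc.le, Real.norm_eq_abs]
        rw [this, ofReal_norm]
        refine (enorm_integral_le_lintegral_enorm _).trans ?_
        simpa only [hk.gammaNorm_eq] using lintegral_enorm_cycleSymbol_le hn mh ν
      calc ENNReal.ofReal |cyclicInt (fun x y => U (y - x)) ν|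
          = ENNReal.ofReal c⁻¹ ^ n * (ENNReal.ofReal (c ^ n) *
              ENNReal.ofReal |cyclicInt (fun x y => U (y - x)) ν|) := by
            rw [← mul_assoc, ← ENNReal.ofReal_pow (by positivity),
              ← ENNReal.ofReal_mul (by positivity), ← mul_pow, inv_mul_cancel₀ hc.ne', one_pow,
              ENNReal.ofReal_one, one_mul]
        _ ≤ _ := by gcongr; rfl
    · push Not at hfin
      obtain ⟨i, hi⟩ := hfin
      -- One norm is infinite, and by definiteness none is zero, so the bound is ∞.
      have hp : ∏ j, gammaNorm (fourierFun U) (ν j) = ∞ := by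
        rw [← Finset.mul_prod_erase _ _ (Finset.mem_univ i), top_le_iff.1 hi, ENNReal.top_mul]
        exact Finset.prod_ne_zero_iff.2 fun j _ h => hz j (gammaNorm_eq_zero mh h0 h)
      rw [hp, ENNReal.mul_top]
      · exact le_top
      · have : (c⁻¹).toNNReal ≠ 0 := (Real.toNNReal_pos.2 (by positivity)).ne'
        exact pow_ne_zero _ (by exact_mod_cast this)

end FourierNorms

end ProperNorms

namespace ProperNorms

/-! ### Convolution semigroups of killed Lévy processes -/

section KilledDensity

variable {d : ℕ}

theorem fourierFun_eq_integral_withDensity {f : EuclideanSpace ℝ (Fin d) → ℝ≥0∞}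
    (mf : Measurable f) (hf : ∫⁻ z, f z ≠ ∞) (ξ : EuclideanSpace ℝ (Fin d)) :
    fourierFun f ξ = ∫ z, Complex.exp (Complex.I * (inner ℝ z ξ : ℝ)) ∂volume.withDensity f := by
  rw [integral_withDensity_eq_integral_toReal_smul mf (ae_lt_top mf hf), fourierFun]
  refine integral_congr_ae (ae_of_all _ fun z => ?_)
  simp only [Complex.real_smul, mul_comm]

theorem fourierFun_eq_charFun {f : EuclideanSpace ℝ (Fin d) → ℝ≥0∞}
    (mf : Measurable f) (hf : ∫⁻ z, f z ≠ ∞) (ξ : EuclideanSpace ℝ (Fin d)) :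
    fourierFun f ξ = charFun (volume.withDensity f) ξ := by
  rw [fourierFun_eq_integral_withDensity mf hf]
  simp only [charFun_apply, mul_comm Complex.I]

theorem isFiniteMeasure_density {f : EuclideanSpace ℝ (Fin d) → ℝ≥0∞}
    (hf : ∫⁻ z, f z ≠ ∞) : IsFiniteMeasure (volume.withDensity f) :=
  isFiniteMeasure_withDensity hf

theorem lintegral_convo {f g : EuclideanSpace ℝ (Fin d) → ℝ≥0∞}
    (mf : Measurable f) (mg : Measurable g) :
    ∫⁻ z, convo f g z = (∫⁻ z, f z) * ∫⁻ z, g z := by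
  simp only [convo]
  rw [lintegral_lintegral_swap (by fun_prop)]
  have : ∀ w, ∫⁻ z, f w * g (z - w) = f w * ∫⁻ z, g z := fun w => by
    rw [lintegral_const_mul _ (by fun_prop), lintegral_sub_right_eq_self g w]
  simp only [this]
  exact lintegral_mul_const _ mf

theorem fourierFun_convo {f g : EuclideanSpace ℝ (Fin d) → ℝ≥0∞}
    (mf : Measurable f) (mg : Measurable g) (hf : ∫⁻ z, f z ≠ ∞) (hg : ∫⁻ z, g z ≠ ∞)
    (ξ : EuclideanSpace ℝ (Fin d)) :
    fourierFun (convo f g) ξ = fourierFun f ξ * fourierFun g ξ := by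
  have := isFiniteMeasure_density hf
  have := isFiniteMeasure_density hg
  have hfg : ∫⁻ z, convo f g z ≠ ∞ := by
    rw [lintegral_convo mf mg]; exact ENNReal.mul_ne_top hf hg
  rw [fourierFun_eq_charFun (measurable_convo mg mf) hfg, fourierFun_eq_charFun mf hf,
    fourierFun_eq_charFun mg hg, ← charFun_conv, conv_withDensity_eq_lconvolution mf mg]
  congr 2
  ext z
  simp only [convo, lconvolution_def, neg_add_eq_sub]

/-- Transition densities `q_t(y - x)` of a Lévy process killed at rate `β`. -/
structure IsKilledDensity (q : ℝ → EuclideanSpace ℝ (Fin d) → ℝ≥0∞) (β : ℝ) : Prop where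
  rate_pos : 0 < β
  measurable : Measurable fun p : ℝ × EuclideanSpace ℝ (Fin d) => q p.1 p.2
  mass : ∀ t, 0 < t → ∫⁻ z, q t z = ENNReal.ofReal (Real.exp (-(β * t)))
  chapman_kolmogorov : ∀ s t, 0 < s → 0 < t → q (s + t) = convo (q s) (q t)
  tendsto_fourier : ∀ ξ, Tendsto (fun t => fourierFun (q t) ξ) (𝓝[>] 0) (𝓝 1)

/-- The density of the occupation measure of a set of times. -/
noncomputable def occupation (q : ℝ → EuclideanSpace ℝ (Fin d) → ℝ≥0∞) (s : Set ℝ)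
    (z : EuclideanSpace ℝ (Fin d)) : ℝ≥0∞ := ∫⁻ t in s, q t z

variable {q : ℝ → EuclideanSpace ℝ (Fin d) → ℝ≥0∞} {β : ℝ} (hq : IsKilledDensity q β)

namespace IsKilledDensity

include hq in
theorem measurable_time (t : ℝ) : Measurable (q t) := hq.measurable.comp measurable_prodMk_left

include hq in
theorem lintegral_ne_top {t : ℝ} (ht : 0 < t) : ∫⁻ z, q t z ≠ ∞ := by
  rw [hq.mass t ht]; exact ENNReal.ofReal_ne_top

include hq in
theorem lintegral_le_one {t : ℝ} (ht : 0 < t) : ∫⁻ z, q t z ≤ 1 := by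
  rw [hq.mass t ht, ENNReal.ofReal_le_one, Real.exp_le_one_iff]
  have := mul_pos hq.rate_pos ht
  linarith

include hq in
theorem measurable_occupation (s : Set ℝ) : Measurable (occupation q s) :=
  Measurable.lintegral_prod_left' hq.measurable

include hq in
theorem lintegral_lintegral_ne_top : ∫⁻ t in Ioi (0 : ℝ), (∫⁻ z, q t z) ≠ ∞ := by
  rw [setLIntegral_congr_fun measurableSet_Ioi fun t ht => hq.mass t ht]
  have hi : IntegrableOn (fun t => Real.exp (-β * t)) (Ioi 0) :=
    integrableOn_exp_mul_Ioi (neg_neg_of_pos hq.rate_pos) 0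
  have := hi.lintegral_lt_top
  simpa only [neg_mul] using this.ne

include hq in
theorem lintegral_occupation {s : Set ℝ} : ∫⁻ z, occupation q s z = ∫⁻ t in s, (∫⁻ z, q t z) :=
  lintegral_lintegral_swap (f := fun z t => q t z) (hq.measurable.comp measurable_swap).aemeasurable

include hq in
theorem lintegral_occupation_ne_top {s : Set ℝ} (hs : s ⊆ Ioi 0) :
    ∫⁻ z, occupation q s z ≠ ∞ := by
  rw [hq.lintegral_occupation]
  exact ((lintegral_mono_set hs).trans_lt hq.lintegral_lintegral_ne_top.lt_top).ne

include hq in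
theorem measurable_fourierFun (ξ : EuclideanSpace ℝ (Fin d)) :
    Measurable fun t => fourierFun (q t) ξ := by
  have : StronglyMeasurable fun p : ℝ × EuclideanSpace ℝ (Fin d) =>
      Complex.exp (Complex.I * (inner ℝ p.2 ξ : ℝ)) * ((q p.1 p.2).toReal : ℂ) := by
    refine Measurable.stronglyMeasurable ?_
    have := hq.measurable
    fun_prop
  exact this.integral_prod_right.measurable

include hq in
theorem norm_fourierFun_le (ξ : EuclideanSpace ℝ (Fin d)) {t : ℝ} (ht : 0 < t) :
    ‖fourierFun (q t) ξ‖ ≤ Real.exp (-β * t) := by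
  refine (ProperNorms.norm_fourierFun_le _ (hq.measurable_time t) ξ (hq.lintegral_ne_top ht)).trans ?_
  rw [hq.mass t ht, ENNReal.toReal_ofReal (Real.exp_pos _).le, neg_mul]

include hq in
theorem integrableOn_fourierFun (ξ : EuclideanSpace ℝ (Fin d)) :
    IntegrableOn (fun t => fourierFun (q t) ξ) (Ioi 0) := by
  refine Integrable.mono' (integrableOn_exp_mul_Ioi (neg_neg_of_pos hq.rate_pos) 0)
    (hq.measurable_fourierFun ξ).aestronglyMeasurable ?_
  filter_upwards [ae_restrict_mem measurableSet_Ioi] with t ht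
  exact hq.norm_fourierFun_le ξ ht

include hq in
theorem fourierFun_occupation {s : Set ℝ} (hs : s ⊆ Ioi 0)
    (ξ : EuclideanSpace ℝ (Fin d)) :
    fourierFun (occupation q s) ξ = ∫ t in s, fourierFun (q t) ξ := by
  have mq := hq.measurable
  have hfin : ∫⁻ p, q p.2 p.1 ∂(volume : Measure (EuclideanSpace ℝ (Fin d))).prod
      (volume.restrict s) ≠ ∞ := by
    rw [lintegral_prod _ (by fun_prop)]
    exact hq.lintegral_occupation_ne_top hs
  have hi : Integrable (fun p : EuclideanSpace ℝ (Fin d) × ℝ =>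
      Complex.exp (Complex.I * (inner ℝ p.1 ξ : ℝ)) * ((q p.2 p.1).toReal : ℂ))
      (volume.prod (volume.restrict s)) := by
    refine (integrable_toReal_of_lintegral_ne_top (f := fun p : EuclideanSpace ℝ (Fin d) × ℝ =>
      q p.2 p.1) (by fun_prop) hfin).ofReal.bdd_mul (c := 1) (by fun_prop) (ae_of_all _ fun p => ?_)
    rw [mul_comm]; exact (Complex.norm_exp_ofReal_mul_I _).le
  have hae := ae_lt_top (hq.measurable_occupation s) (hq.lintegral_occupation_ne_top hs)
  calc fourierFun (occupation q s) ξ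
      = ∫ z, ∫ t in s, Complex.exp (Complex.I * (inner ℝ z ξ : ℝ)) * ((q t z).toReal : ℂ) := by
        refine integral_congr_ae ?_
        filter_upwards [hae] with z hz
        have mz : Measurable fun t => q t z := hq.measurable.comp measurable_prodMk_right
        rw [integral_const_mul, integral_complex_ofReal, occupation,
          integral_toReal mz.aemeasurable (ae_lt_top mz hz.ne)]
    _ = ∫ t in s, (∫ z, Complex.exp (Complex.I * (inner ℝ z ξ : ℝ)) * ((q t z).toReal : ℂ)) :=
        integral_integral_swap hi

include hq in
-- Convolution with q_δ deletes the first δ units of time. This makes q_δ the right mollifier: the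
-- smoothed potentials increase as δ decreases.
theorem convo_occupation {δ : ℝ} (hδ : 0 < δ) :
    convo (q δ) (occupation q (Ioi 0)) = occupation q (Ioi δ) := by
  have mq := hq.measurable
  ext z
  simp only [convo, occupation]
  have e : ∀ w, q δ w * ∫⁻ t in Ioi (0 : ℝ), q t (z - w) =
      ∫⁻ t in Ioi (0 : ℝ), q δ w * q t (z - w) := fun w =>
    (lintegral_const_mul _ (by fun_prop)).symm
  simp only [e]
  have m1 := hq.measurable_time δ
  rw [lintegral_lintegral_swap (by fun_prop)]
  have e2 : ∫⁻ t in Ioi δ, q t z = ∫⁻ t in Ioi (0 : ℝ), q (δ + t) z := by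
    rw [← lintegral_indicator measurableSet_Ioi, ← lintegral_indicator measurableSet_Ioi,
      ← lintegral_add_left_eq_self _ δ]
    refine lintegral_congr fun t => ?_
    simp [indicator]
  rw [e2]
  refine setLIntegral_congr_fun measurableSet_Ioi fun t ht => ?_
  rw [hq.chapman_kolmogorov δ t hδ ht]; rfl

include hq in
/-- The Fourier transform of the potential density does not vanish. -/
theorem fourierFun_potential_ne_zero (ξ : EuclideanSpace ℝ (Fin d)) :
    fourierFun (occupation q (Ioi 0)) ξ ≠ 0 := by
  intro h0
  have hsub : ∀ {δ : ℝ}, 0 < δ → Ioi δ ⊆ Ioi 0 := fun h => Ioi_subset_Ioi h.le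
  -- The transform of q_δ * u is a multiple of û(ξ) = 0. The time integral of the transforms over
  -- (δ,∞) therefore vanishes along with the one over (0,∞), which contradicts their being close to
  -- 1 at small times.
  have hI : ∀ δ : ℝ, 0 < δ → ∫ t in Ioc 0 δ, fourierFun (q t) ξ = 0 := by
    intro δ hδ
    have h1 : fourierFun (occupation q (Ioi δ)) ξ = 0 := by
      rw [← hq.convo_occupation hδ, fourierFun_convo (hq.measurable_time δ)
        (hq.measurable_occupation _) (hq.lintegral_ne_top hδ)
        (hq.lintegral_occupation_ne_top Subset.rfl), h0, mul_zero]
    rw [hq.fourierFun_occupation (hsub hδ)] at h1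
    rw [hq.fourierFun_occupation Subset.rfl, ← Ioc_union_Ioi_eq_Ioi hδ.le,
      setIntegral_union (Ioc_disjoint_Ioi le_rfl) measurableSet_Ioi
      ((hq.integrableOn_fourierFun ξ).mono_set Ioc_subset_Ioi_self)
      ((hq.integrableOn_fourierFun ξ).mono_set (hsub hδ)), h1, add_zero] at h0
    exact h0
  have hre : ∀ᶠ t in 𝓝[>] (0 : ℝ), 1 / 2 < (fourierFun (q t) ξ).re := by
    have := (Complex.continuous_re.tendsto _).comp (hq.tendsto_fourier ξ)
    exact this.eventually (lt_mem_nhds (by norm_num))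
  obtain ⟨δ, hδ, hδ'⟩ := mem_nhdsGT_iff_exists_Ioc_subset.1 hre
  have hδ0 : (0 : ℝ) < δ := hδ
  have hint := (hq.integrableOn_fourierFun ξ).mono_set
    (fun t (ht : t ∈ Ioc 0 δ) => ht.1)
  have h2 : ∫ t in Ioc 0 δ, (1 / 2 : ℝ) ≤ ∫ t in Ioc 0 δ, (fourierFun (q t) ξ).re :=
    setIntegral_mono_on (integrableOn_const (by simp)) hint.re measurableSet_Ioc
      fun t ht => le_of_lt (hδ' ht)
  have h3 : ∫ t in Ioc 0 δ, (fourierFun (q t) ξ).re = 0 := by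
    have := integral_re hint
    simp only [RCLike.re_to_complex] at this
    rw [this, hI δ hδ0, Complex.zero_re]
  rw [h3] at h2
  simp only [integral_const, MeasurableSet.univ, measureReal_restrict_apply, univ_inter,
    Real.volume_real_Ioc_of_le hδ0.le, sub_zero, smul_eq_mul] at h2
  linarith

include hq in
-- Pointwise convergence is continuity from below of the measure q_t(z) dt, which covers the points
-- where the potential is infinite.
theorem isSmoothing :
    IsSmoothing (occupation q (Ioi 0)) fun m : ℕ => q (1 / ((m : ℝ) + 1)) := by
  have hpos : ∀ m : ℕ, 0 < 1 / ((m : ℝ) + 1) := fun m => by positivity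
  have hanti : ∀ {a b : ℕ}, a ≤ b → 1 / ((b : ℝ) + 1) ≤ 1 / ((a : ℝ) + 1) := fun h =>
    Nat.one_div_le_one_div h
  have hmono : Monotone fun m : ℕ => Ioi (1 / ((m : ℝ) + 1)) := fun a b hab =>
    Ioi_subset_Ioi (hanti hab)
  refine ⟨hq.measurable_occupation _, hq.lintegral_occupation_ne_top Subset.rfl,
    fun m => hq.measurable_time _, fun m => hq.lintegral_le_one (hpos m), fun z a b hab => ?_,
    fun z => ?_, fun ξ => ?_⟩
  · simp only [hq.convo_occupation (hpos _)]
    exact lintegral_mono_set (hmono hab)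
  · simp only [hq.convo_occupation (hpos _)]
    have h := tendsto_measure_iUnion_atTop (μ := volume.withDensity fun t => q t z) hmono
    have hU : ⋃ m : ℕ, Ioi (1 / ((m : ℝ) + 1)) = Ioi 0 := by
      ext t
      simp only [mem_iUnion, mem_Ioi]
      exact ⟨fun ⟨m, hm⟩ => (hpos m).trans hm, fun ht => exists_nat_one_div_lt ht⟩
    rw [hU, withDensity_apply _ measurableSet_Ioi] at h
    refine h.congr fun m => ?_
    simp only [Function.comp]
    rw [withDensity_apply _ measurableSet_Ioi]; rfl
  · refine (hq.tendsto_fourier ξ).comp (tendsto_nhdsWithin_iff.2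
      ⟨tendsto_one_div_add_atTop_nhds_zero_nat, Eventually.of_forall fun m => hpos m⟩)

end IsKilledDensity

end KilledDensity

/-! ### From the killed process to its densities -/

section KilledProcess

variable {Ω : Type*} [MeasurableSpace Ω] {P : Measure Ω} [IsProbabilityMeasure P] {d : ℕ}
  {Y : ℝ≥0 → Ω → EuclideanSpace ℝ (Fin d)} {ζ : Ω → ℝ} {β : ℝ}
  {q : ℝ → EuclideanSpace ℝ (Fin d) → ℝ≥0∞} (hL : IsKilledLevy Y ζ β P)
  (hp : IsTransitionDensity (killedTrans Y ζ P) volume fun t x y => q t (y - x))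

omit [IsProbabilityMeasure P] in
include hL in
theorem measurableSet_alive (t : ℝ) : MeasurableSet {ω | t < ζ ω} :=
  measurableSet_lt measurable_const hL.measurable

omit [IsProbabilityMeasure P] in
include hL hp in
theorem map_restrict_alive {t : ℝ≥0} (ht : 0 < t) :
    (P.restrict {ω | (t : ℝ) < ζ ω}).map (Y t) = volume.withDensity (q t) := by
  ext A hA
  have h := hp.density t ht 0 A hA
  simp only [sub_zero] at h
  rw [withDensity_apply _ hA, ← h, Measure.map_apply (hL.levy.measurable t) hA,
    Measure.restrict_apply (hL.levy.measurable t hA), killedTrans]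
  congr 1
  ext ω
  simp [and_comm]

omit [IsProbabilityMeasure P] in
include hL in
theorem measure_alive {t : ℝ} (ht : 0 ≤ t) :
    P {ω | t < ζ ω} = ENNReal.ofReal (Real.exp (-(β * t))) := by
  have := isProbabilityMeasure_expMeasure hL.rate_pos
  have e : P {ω | t < ζ ω} = expMeasure β (Ioi t) := by
    rw [← hL.law, Measure.map_apply hL.measurable measurableSet_Ioi]; rfl
  have h := cdf_expMeasure_eq hL.rate_pos t
  rw [if_pos ht, cdf_eq_real] at h
  rw [e, ← compl_Iic, ← ofReal_measureReal, measureReal_compl measurableSet_Iic, h]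
  simp

omit [IsProbabilityMeasure P] in
include hp in
theorem measurable_density :
    Measurable fun p : ℝ × EuclideanSpace ℝ (Fin d) => q p.1 p.2 := by
  have := hp.measurable.comp (by fun_prop : Measurable fun p : ℝ × EuclideanSpace ℝ (Fin d) =>
    (p.1, (0 : EuclideanSpace ℝ (Fin d)), p.2))
  simpa [Function.comp_def] using this

omit [IsProbabilityMeasure P] in
include hL hp in
theorem lintegral_killed_density {t : ℝ≥0} (ht : 0 < t) :
    ∫⁻ z, q t z = ENNReal.ofReal (Real.exp (-(β * t))) := by
  have h := congrArg (fun μ => μ univ) (map_restrict_alive hL hp ht)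
  simp only [withDensity_apply _ MeasurableSet.univ, Measure.restrict_univ] at h
  rw [← h, Measure.map_apply (hL.levy.measurable _) MeasurableSet.univ, preimage_univ,
    Measure.restrict_apply_univ, measure_alive hL t.coe_nonneg]

omit [IsProbabilityMeasure P] in
include hL hp in
theorem fourierFun_killed_density {t : ℝ≥0} (ht : 0 < t) (ξ : EuclideanSpace ℝ (Fin d)) :
    fourierFun (q t) ξ =
      ∫ ω in {ω | (t : ℝ) < ζ ω}, Complex.exp (Complex.I * (inner ℝ ξ (Y t ω) : ℝ)) ∂P := by
  have mq : Measurable (q t) := (measurable_density hp).comp measurable_prodMk_left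
  rw [fourierFun_eq_integral_withDensity mq
    (by rw [lintegral_killed_density hL hp ht]; exact ENNReal.ofReal_ne_top),
    ← map_restrict_alive hL hp ht,
    integral_map (hL.levy.measurable t).aemeasurable (by fun_prop)]
  simp only [real_inner_comm]

include hL in
-- Continuity in probability gives almost sure convergence along subsequences only, which is enough
-- for a limit. Killing does not interfere, since ζ > 0 almost surely.
theorem tendsto_integral_alive (ξ : EuclideanSpace ℝ (Fin d)) :
    Tendsto (fun t : ℝ≥0 => ∫ ω in {ω | (t : ℝ) < ζ ω},
      Complex.exp (Complex.I * (inner ℝ ξ (Y t ω) : ℝ)) ∂P) (𝓝 0) (𝓝 1) := by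
  refine tendsto_of_subseq_tendsto fun ns hns => ?_
  have h1 : TendstoInMeasure P (fun n => Y (ns n)) atTop (Y 0) := fun ε hε =>
    (hL.levy.continuous 0 ε hε).comp hns
  obtain ⟨ms, hms, hae⟩ := h1.exists_seq_tendsto_ae
  refine ⟨ms, ?_⟩
  have hpos : ∀ᵐ ω ∂P, 0 < ζ ω := by
    have h := measure_alive hL le_rfl
    simp only [mul_zero, neg_zero, Real.exp_zero, ENNReal.ofReal_one] at h
    exact (prob_compl_eq_zero_iff (measurableSet_alive hL 0)).2 h
  have e : (1 : ℂ) = ∫ _ω, (1 : ℂ) ∂P := by simp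
  rw [e]
  simp only [← integral_indicator (measurableSet_alive hL _)]
  refine tendsto_integral_of_dominated_convergence (fun _ => 1) ?_ (integrable_const _) ?_ ?_
  · intro n
    have := hL.levy.measurable (ns (ms n))
    exact (Measurable.indicator (by fun_prop) (measurableSet_alive hL _)).aestronglyMeasurable
  · refine fun n => ae_of_all _ fun ω => (norm_indicator_le_norm_self _ _).trans ?_
    rw [mul_comm]; exact (Complex.norm_exp_ofReal_mul_I _).le
  · filter_upwards [hae, hpos, hL.levy.zero] with ω h2 h3 h4
    have h5 : Tendsto (fun n => ((ns (ms n) : ℝ≥0) : ℝ)) atTop (𝓝 0) := by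
      have := hns.comp hms.tendsto_atTop
      exact_mod_cast (NNReal.continuous_coe.tendsto 0).comp this
    have h6 : Tendsto (fun n => Complex.exp (Complex.I * (inner ℝ ξ (Y (ns (ms n)) ω) : ℝ))) atTop
        (𝓝 1) := by
      have hc : Continuous fun y : EuclideanSpace ℝ (Fin d) =>
        Complex.exp (Complex.I * (inner ℝ ξ y : ℝ)) := by fun_prop
      have := (hc.tendsto _).comp h2
      simpa [h4, Function.comp_def] using this
    refine h6.congr' ?_
    filter_upwards [h5.eventually (gt_mem_nhds h3)] with n hn
    rw [indicator_of_mem]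
    exact hn

include hL hp in
theorem isKilledDensity : IsKilledDensity q β where
  rate_pos := hL.rate_pos
  measurable := measurable_density hp
  mass t ht := by
    lift t to ℝ≥0 using ht.le
    exact lintegral_killed_density hL hp (by exact_mod_cast ht)
  chapman_kolmogorov s t hs ht := by
    ext z
    have h : q (s + t) z = ∫⁻ y, q s y * q t (z - y) := by
      simpa only [sub_zero] using hp.chapman_kolmogorov s t hs ht 0 z
    exact h
  tendsto_fourier ξ := by
    have h : Tendsto (fun t : ℝ => t.toNNReal) (𝓝[>] 0) (𝓝 0) := by
      have := (continuous_real_toNNReal.tendsto 0).mono_left (nhdsWithin_le_nhds (s := Ioi 0))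
      simpa using this
    refine ((tendsto_integral_alive hL ξ).comp h).congr' ?_
    filter_upwards [self_mem_nhdsWithin] with t ht
    have ht' : (0 : ℝ) < t := ht
    have := fourierFun_killed_density hL hp (t := t.toNNReal) (Real.toNNReal_pos.2 ht') ξ
    rw [Function.comp, ← this, Real.coe_toNNReal _ ht'.le]

end KilledProcess

end ProperNorms

namespace ProperNorms

/-! ### The double integral expression for ‖·‖_{γ,2} -/

section SecondExpression

variable {d : ℕ}

/-- The parameter σ takes the value -1 for the inner integration and 1 for the outer one. -/
theorem sint_integral_exp (ν : SignedMeasure (EuclideanSpace ℝ (Fin d)))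
    {g : EuclideanSpace ℝ (Fin d) → ℂ} (hg : Integrable g) (σ : ℝ) :
    sint ν (fun y => ∫ z, Complex.exp (Complex.I * (inner ℝ y (σ • z) : ℝ)) * g z) =
      ∫ z, g z * fourierMeas ν (σ • z) := by
  have key : ∀ (μ : Measure (EuclideanSpace ℝ (Fin d))) [IsFiniteMeasure μ],
      ∫ y, (∫ z, Complex.exp (Complex.I * (inner ℝ y (σ • z) : ℝ)) * g z) ∂μ =
        ∫ z, g z * charFun μ (σ • z) := by
    intro μ _
    have hi : Integrable (fun p : EuclideanSpace ℝ (Fin d) × EuclideanSpace ℝ (Fin d) =>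
        Complex.exp (Complex.I * (inner ℝ p.1 (σ • p.2) : ℝ)) * g p.2) (μ.prod volume) := by
      refine (hg.comp_snd μ).bdd_mul (c := 1) (by fun_prop) (ae_of_all _ fun p => ?_)
      rw [mul_comm]; exact (Complex.norm_exp_ofReal_mul_I _).le
    rw [integral_integral_swap hi]
    refine integral_congr_ae (ae_of_all _ fun z => ?_)
    simp only [integral_mul_const, charFun_apply, mul_comm Complex.I]
    rw [mul_comm]
  have hint : ∀ (μ : Measure (EuclideanSpace ℝ (Fin d))) [IsFiniteMeasure μ],
      Integrable fun z => g z * charFun μ (σ • z) := by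
    intro μ _
    refine hg.mul_bdd (c := μ.real univ) ?_ (ae_of_all _ fun z => norm_charFun_le _)
    exact (continuous_charFun.comp (by fun_prop)).aestronglyMeasurable
  rw [sint, key, key, ← integral_sub (hint _) (hint _)]
  refine integral_congr_ae (ae_of_all _ fun z => ?_)
  simp only [fourierMeas_eq, mul_sub]

theorem fourierMeas_neg (ν : SignedMeasure (EuclideanSpace ℝ (Fin d)))
    (ξ : EuclideanSpace ℝ (Fin d)) :
    fourierMeas ν (-ξ) = starRingEnd ℂ (fourierMeas ν ξ) := by
  simp only [fourierMeas_eq, charFun_neg, map_sub]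

variable {h : EuclideanSpace ℝ (Fin d) → ℂ}

theorem gam_eq_convo (x : EuclideanSpace ℝ (Fin d)) :
    gam h x = convo (fun r => ‖h r‖ₑ) (fun r => ‖h r‖ₑ) x := by
  simp only [gam, convo, mul_comm]

theorem enorm_fourierMeas_le (ν : SignedMeasure (EuclideanSpace ℝ (Fin d)))
    (ξ : EuclideanSpace ℝ (Fin d)) :
    ‖fourierMeas ν ξ‖ₑ ≤ ENNReal.ofReal ((pos ν).real univ + (neg ν).real univ) := by
  rw [← ofReal_norm, fourierMeas_eq]
  exact ENNReal.ofReal_le_ofReal ((norm_sub_le _ _).trans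
    (add_le_add (norm_charFun_le _) (norm_charFun_le _)))

theorem lintegral_gam_ne_top (mh : Measurable h) (hh : Integrable h) :
    ∫⁻ x, gam h x ≠ ∞ := by
  have e : ∫⁻ x, gam h x = ∫⁻ x, convo (fun r => ‖h r‖ₑ) (fun r => ‖h r‖ₑ) x :=
    lintegral_congr gam_eq_convo
  rw [e, lintegral_convo mh.enorm mh.enorm]
  exact ENNReal.mul_ne_top hh.2.ne hh.2.ne

theorem lintegral_fourierMeas_gam_lt_top (mh : Measurable h) (hh : Integrable h)
    (ν : SignedMeasure (EuclideanSpace ℝ (Fin d))) :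
    ∫⁻ x, ‖fourierMeas ν x‖ₑ ^ 2 * gam h x < ∞ := by
  calc ∫⁻ x, ‖fourierMeas ν x‖ₑ ^ 2 * gam h x
      ≤ ∫⁻ x, ENNReal.ofReal ((pos ν).real univ + (neg ν).real univ) ^ 2 * gam h x := by
        gcongr with x; exact enorm_fourierMeas_le ν x
    _ = ENNReal.ofReal ((pos ν).real univ + (neg ν).real univ) ^ 2 * ∫⁻ x, gam h x :=
        lintegral_const_mul' _ _ (ENNReal.pow_ne_top ENNReal.ofReal_ne_top)
    _ < ∞ := ENNReal.mul_lt_top (ENNReal.pow_lt_top ENNReal.ofReal_lt_top)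
        (lintegral_gam_ne_top mh hh).lt_top

theorem gammaNorm_lt_top (mh : Measurable h) (hh : Integrable h)
    (ν : SignedMeasure (EuclideanSpace ℝ (Fin d))) : gammaNorm h ν < ∞ :=
  ENNReal.rpow_lt_top_of_nonneg (by norm_num) (lintegral_fourierMeas_gam_lt_top mh hh ν).ne

/-- The Fourier transform of a convolution square is the square of the transform. -/
theorem integral_exp_norm_sq (mh : Measurable h) (hh : Integrable h)
    (x : EuclideanSpace ℝ (Fin d)) :
    (∫ r, Complex.exp (Complex.I * (inner ℝ x r : ℝ)) * (‖h r‖ : ℂ)) ^ 2 =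
      fourierFun (gam h) x := by
  have e : ∫ r, Complex.exp (Complex.I * (inner ℝ x r : ℝ)) * (‖h r‖ : ℂ) =
      fourierFun (fun r => ‖h r‖ₑ) x := by
    simp only [fourierFun, toReal_enorm, real_inner_comm]
  rw [e, sq, ← fourierFun_convo mh.enorm mh.enorm hh.2.ne hh.2.ne, funext gam_eq_convo]

/-- Both sides equal ∫ γ(z) ν̂(z) ν̂(-z) dz, since ν̂(-z) is the conjugate of ν̂(z). Fubini applies
because γ is integrable and ν̂ bounded. -/
theorem sq_gammaNorm_eq (mh : Measurable h) (hh : Integrable h)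
    (ν : SignedMeasure (EuclideanSpace ℝ (Fin d))) :
    (((gammaNorm h ν).toReal ^ 2 : ℝ) : ℂ) = sint ν fun x => sint ν fun y =>
      (∫ r, Complex.exp (Complex.I * (inner ℝ (x - y) r : ℝ)) * (‖h r‖ : ℂ)) ^ 2 := by
  have mh' : Measurable fun r => ‖h r‖ₑ := mh.enorm
  have mν : Measurable fun ξ => ‖fourierMeas ν ξ‖ₑ := (continuous_fourierMeas ν).measurable.enorm
  have mg : Measurable (gam h) := by
    rw [funext gam_eq_convo]; exact measurable_convo mh' mh'
  have hg : Integrable fun z => ((gam h z).toReal : ℂ) :=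
    (integrable_toReal_of_lintegral_ne_top mg.aemeasurable (lintegral_gam_ne_top mh hh)).ofReal
  have hx : ∀ x, Integrable fun z =>
      Complex.exp (Complex.I * (inner ℝ x z : ℝ)) * ((gam h z).toReal : ℂ) := fun x => by
    refine hg.bdd_mul (c := 1) (by fun_prop) (ae_of_all _ fun p => ?_)
    rw [mul_comm]; exact (Complex.norm_exp_ofReal_mul_I _).le
  have hm : Integrable fun z => ((gam h z).toReal : ℂ) * fourierMeas ν (-z) := by
    refine hg.mul_bdd (c := (pos ν).real univ + (neg ν).real univ)
      ((continuous_fourierMeas ν).comp continuous_neg).aestronglyMeasurable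
      (ae_of_all _ fun z => ?_)
    rw [fourierMeas_eq]
    exact (norm_sub_le _ _).trans (add_le_add (norm_charFun_le _) (norm_charFun_le _))
  have e1 : ∀ x, sint ν (fun y => fourierFun (gam h) (x - y)) =
      ∫ z, Complex.exp (Complex.I * (inner ℝ x ((1 : ℝ) • z) : ℝ)) *
        (((gam h z).toReal : ℂ) * fourierMeas ν (-z)) := by
    intro x
    have := sint_integral_exp ν (hx x) (-1)
    simp only [neg_smul, one_smul] at this ⊢
    simp only [← mul_assoc]
    rw [← this]
    congr 1
    ext y
    refine integral_congr_ae (ae_of_all _ fun z => ?_)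
    simp only
    rw [← mul_assoc, ← Complex.exp_add]
    congr 3
    rw [inner_sub_right, inner_neg_right, real_inner_comm, real_inner_comm z y]
    push_cast; ring
  simp only [integral_exp_norm_sq mh hh, e1]
  rw [sint_integral_exp ν hm 1]
  simp only [one_smul]
  have e2 : (gammaNorm h ν).toReal ^ 2 = (∫⁻ x, ‖fourierMeas ν x‖ₑ ^ 2 * gam h x).toReal := by
    rw [← ENNReal.toReal_pow, gammaNorm, rpow_half_sq]
  rw [e2, ← integral_toReal (by fun_prop) (ae_lt_top (by fun_prop)
    (lintegral_fourierMeas_gam_lt_top mh hh ν).ne), ← integral_complex_ofReal]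
  refine integral_congr_ae (ae_of_all _ fun z => ?_)
  simp only
  rw [fourierMeas_neg, mul_assoc, ← Complex.normSq_eq_conj_mul_self, Complex.normSq_eq_norm_sq,
    ENNReal.toReal_mul, ENNReal.toReal_pow, toReal_enorm]
  push_cast; ring

end SecondExpression

/-! ### The sectorial case and ‖·‖_{[2]} -/

section Sectorial

variable {d : ℕ} {U : EuclideanSpace ℝ (Fin d) → ℝ≥0∞} {k : ℕ → EuclideanSpace ℝ (Fin d) → ℝ≥0∞}

theorem finitePart_add {S : Type*} [MeasurableSpace S] {N : SignedMeasure S → ℝ≥0∞}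
    (hN : ∀ ν ν', N (ν + ν') ≤ N ν + N ν') {ν ν' : SignedMeasure S}
    (h : ν ∈ finitePart univ N) (h' : ν' ∈ finitePart univ N) : ν + ν' ∈ finitePart univ N := by
  obtain ⟨a, -, b, -, pa, pb, fa, fb, rfl⟩ := h
  obtain ⟨a', -, b', -, pa', pb', fa', fb', rfl⟩ := h'
  exact ⟨a + a', trivial, b + b', trivial, add_nonneg pa pa', add_nonneg pb pb',
    (hN _ _).trans_lt (ENNReal.add_lt_top.2 ⟨fa, fa'⟩),
    (hN _ _).trans_lt (ENNReal.add_lt_top.2 ⟨fb, fb'⟩), by abel⟩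

theorem sub_eq_add_neg_one_smul {S : Type*} [MeasurableSpace S] (a b : SignedMeasure S) :
    a - b = a + (-1 : ℝ) • b := by
  ext A hA; simp [sub_eq_add_neg]

theorem finitePart_smul {S : Type*} [MeasurableSpace S] {N : SignedMeasure S → ℝ≥0∞}
    (hN : ∀ (c : ℝ) ν, N (c • ν) = ENNReal.ofReal |c| * N ν) (c : ℝ) {ν : SignedMeasure S}
    (h : ν ∈ finitePart univ N) : c • ν ∈ finitePart univ N := by
  obtain ⟨a, -, b, -, pa, pb, fa, fb, rfl⟩ := h
  have hp : ∀ {c : ℝ} {a : SignedMeasure S}, 0 ≤ c → 0 ≤ a → 0 ≤ c • a := by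
    intro c a hc ha A hA
    exact mul_nonneg hc (ha A hA)
  have hf : ∀ (c : ℝ) {a : SignedMeasure S}, N a < ∞ → N (c • a) < ∞ := fun c a ha => by
    rw [hN]; exact ENNReal.mul_lt_top ENNReal.ofReal_lt_top ha
  rcases le_total 0 c with hc | hc
  · exact ⟨c • a, trivial, c • b, trivial, hp hc pa, hp hc pb, hf _ fa, hf _ fb, smul_sub _ _ _⟩
  · refine ⟨(-c) • b, trivial, (-c) • a, trivial, hp (neg_nonneg.2 hc) pb, hp (neg_nonneg.2 hc) pa,
      hf _ fb, hf _ fa, ?_⟩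
    ext A hA; simp; ring

theorem lt_top_of_mem_finitePart {S : Type*} [MeasurableSpace S] {N : SignedMeasure S → ℝ≥0∞}
    (hN : ∀ ν ν', N (ν + ν') ≤ N ν + N ν')
    (hs : ∀ (c : ℝ) ν, N (c • ν) = ENNReal.ofReal |c| * N ν) {ν : SignedMeasure S}
    (h : ν ∈ finitePart univ N) : N ν < ∞ := by
  obtain ⟨a, -, b, -, -, -, fa, fb, rfl⟩ := h
  rw [sub_eq_add_neg_one_smul]
  refine (hN _ _).trans_lt (ENNReal.add_lt_top.2 ⟨fa, ?_⟩)
  rw [hs]; exact ENNReal.mul_lt_top ENNReal.ofReal_lt_top fb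

/-- On a cycle of length two the arguments of ν̂ are opposite, so its two values are conjugate and
only the phase of h(λ₀)h(λ₁) remains. -/
theorem cycleSymbol_two (h : EuclideanSpace ℝ (Fin d) → ℂ)
    (ν : SignedMeasure (EuclideanSpace ℝ (Fin d))) (l : Fin 2 → EuclideanSpace ℝ (Fin d)) :
    cycleSymbol h (fun _ => fourierMeas ν) l =
      h (l 0) * h (l 1) * (‖fourierMeas ν (l 0 - l 1)‖ ^ 2 : ℝ) := by
  have e0 : (finRotate 2).symm 0 = 1 := by decide
  have e1 : (finRotate 2).symm 1 = 0 := by decide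
  have e : fourierMeas ν (l 1 - l 0) = starRingEnd ℂ (fourierMeas ν (l 0 - l 1)) := by
    rw [← fourierMeas_neg, neg_sub]
  rw [cycleSymbol, Fin.prod_univ_two, Fin.prod_univ_two, e0, e1, e, Complex.mul_conj,
    Complex.normSq_eq_norm_sq]

/-- The weight of the norm `‖ν‖_{[2]}`. -/
noncomputable def sectWeight (h : EuclideanSpace ℝ (Fin d) → ℂ)
    (p : EuclideanSpace ℝ (Fin d) × EuclideanSpace ℝ (Fin d)) : ℝ≥0∞ :=
  ENNReal.ofReal (h p.1 * h p.2).re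

theorem measurable_sectWeight {h : EuclideanSpace ℝ (Fin d) → ℂ} (mh : Measurable h) :
    Measurable (sectWeight h) := by
  have : Measurable fun p : EuclideanSpace ℝ (Fin d) × EuclideanSpace ℝ (Fin d) =>
    h p.1 * h p.2 := by fun_prop
  exact (Complex.measurable_re.comp this).ennreal_ofReal

theorem sectWeight_le (h : EuclideanSpace ℝ (Fin d) → ℂ)
    (p : EuclideanSpace ℝ (Fin d) × EuclideanSpace ℝ (Fin d)) :
    sectWeight h p ≤ ‖h p.1‖ₑ * ‖h p.2‖ₑ := by
  rw [sectWeight, ← enorm_mul, ← ofReal_norm]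
  exact ENNReal.ofReal_le_ofReal (Complex.re_le_norm _)

variable (hk : IsSmoothing U k)

include hk in
-- Parseval's identity for n = 2. The form is real, so the real part of the symbol suffices, and
-- this is nonnegative by assumption.
theorem IsSmoothing.quadForm_eq (h0 : ∀ ξ, fourierFun U ξ ≠ 0)
    (hre : ∀ a b, 0 ≤ (fourierFun U a * fourierFun U b).re) {c : ℝ}
    (hce : inversionConst (EuclideanSpace ℝ (Fin d)) = c)
    {ν : SignedMeasure (EuclideanSpace ℝ (Fin d))}
    (hν : ν ∈ finitePart univ (gammaNorm (fourierFun U))) :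
    FormConverges (fun x y => U (y - x) * U (x - y)) ν ∧
      c ^ 2 * quadForm (fun x y => U (y - x) * U (x - y)) ν =
        (weightNorm (sectWeight (fourierFun U)) ν ^ 2).toReal := by
  have hP := hk.isProperNorm_gammaNorm h0
  set h := fourierFun U
  have mh : Measurable h := measurable_fourierFun hk.measurable
  have mu : Measurable fun p : EuclideanSpace ℝ (Fin d) × EuclideanSpace ℝ (Fin d) =>
      U (p.2 - p.1) := hk.measurable.comp (measurable_snd.sub measurable_fst)
  have hc := hP.converges 2 le_rfl (fun _ => ν) fun _ => hν
  have hform := (cyclicConverges_two_iff mu ν).1 hc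
  refine ⟨hform, ?_⟩
  have hfin : gammaNorm h ν < ∞ := lt_top_of_mem_finitePart
    (fun ν ν' => hP.add_le ν trivial ν' trivial) (fun c ν => hP.smul c ν trivial) hν
  have key := hk.cyclicInt_eq le_rfl (ν := fun _ : Fin 2 => ν) (fun _ => hfin) hc
  have hi : Integrable (cycleSymbol h fun _ : Fin 2 => fourierMeas ν) :=
    integrable_cycleSymbol le_rfl mh (fun _ => (hk.gammaNorm_eq ν) ▸ hfin)
  rw [quadForm_eq_cyclicInt mu hform]
  have key' := congrArg Complex.re key
  rw [hce, ← Complex.ofReal_pow, ← Complex.ofReal_mul, Complex.ofReal_re] at key'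
  rw [key']
  have e1 := integral_re hi
  simp only [RCLike.re_to_complex] at e1
  rw [← e1]
  have e2 : ∀ l : Fin 2 → EuclideanSpace ℝ (Fin d),
      (cycleSymbol h (fun _ => fourierMeas ν) l).re =
        (h (l 0) * h (l 1)).re * ‖fourierMeas ν (l 0 - l 1)‖ ^ 2 := fun l => by
    rw [cycleSymbol_two, Complex.re_mul_ofReal]
  simp only [e2]
  have mp := (volume_preserving_finTwoArrow (EuclideanSpace ℝ (Fin d)))
  have e3 := mp.integral_comp' (g := fun p : EuclideanSpace ℝ (Fin d) × EuclideanSpace ℝ (Fin d) =>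
    (h p.1 * h p.2).re * ‖fourierMeas ν (p.1 - p.2)‖ ^ 2)
  have e4 : ∫ l : Fin 2 → EuclideanSpace ℝ (Fin d), (h (l 0) * h (l 1)).re *
      ‖fourierMeas ν (l 0 - l 1)‖ ^ 2 = ∫ p : EuclideanSpace ℝ (Fin d) × EuclideanSpace ℝ (Fin d),
        (h p.1 * h p.2).re * ‖fourierMeas ν (p.1 - p.2)‖ ^ 2 := e3
  rw [e4, weightNorm, rpow_half_sq]
  have mm : Measurable fun p : EuclideanSpace ℝ (Fin d) × EuclideanSpace ℝ (Fin d) =>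
      (h p.1 * h p.2).re * ‖fourierMeas ν (p.1 - p.2)‖ ^ 2 := by
    have m1 : Measurable fun p : EuclideanSpace ℝ (Fin d) × EuclideanSpace ℝ (Fin d) =>
      h p.1 * h p.2 := by fun_prop
    have m2 : Measurable fun p : EuclideanSpace ℝ (Fin d) × EuclideanSpace ℝ (Fin d) =>
        ‖fourierMeas ν (p.1 - p.2)‖ :=
      ((continuous_fourierMeas ν).comp (continuous_fst.sub continuous_snd)).measurable.norm
    exact (Complex.measurable_re.comp m1).mul (m2.pow_const 2)
  rw [integral_eq_lintegral_of_nonneg_ae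
    (ae_of_all _ fun p => mul_nonneg (hre _ _) (sq_nonneg _)) mm.aestronglyMeasurable]
  congr 1
  refine lintegral_congr fun p => ?_
  rw [ENNReal.ofReal_mul (hre _ _), sectWeight, ENNReal.ofReal_pow (norm_nonneg _), ofReal_norm]

include hk in
/-- The norm `‖ν‖_{[2]}` when the Fourier transform of `u` is sectorial. -/
theorem IsSmoothing.isProperNorm_sectNorm (h0 : ∀ ξ, fourierFun U ξ ≠ 0) {r : ℝ} (hr : 0 < r)
    (hre : ∀ a b, r * (‖fourierFun U a‖ * ‖fourierFun U b‖) ≤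
      (fourierFun U a * fourierFun U b).re) :
    (∀ ν ∈ finitePart univ (gammaNorm (fourierFun U)),
      FormConverges (fun x y => U (y - x) * U (x - y)) ν ∧
        0 ≤ quadForm (fun x y => U (y - x) * U (x - y)) ν) ∧
    IsProperNorm (finitePart univ (gammaNorm (fourierFun U))) (fun x y => U (y - x))
      (sectNorm fun x y => U (y - x)) := by
  obtain ⟨c, hc, hce⟩ := exists_inversionConst (EuclideanSpace ℝ (Fin d))
  have hP := hk.isProperNorm_gammaNorm h0
  have hre0 : ∀ a b, 0 ≤ (fourierFun U a * fourierFun U b).re := fun a b =>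
    le_trans (by positivity) (hre a b)
  have hQ := fun ν hν => hk.quadForm_eq h0 hre0 hce (ν := ν) hν
  set h := fourierFun U
  have mh : Measurable h := measurable_fourierFun hk.measurable
  set V := finitePart univ (gammaNorm h)
  have gadd : ∀ ν ν', gammaNorm h (ν + ν') ≤ gammaNorm h ν + gammaNorm h ν' :=
    fun ν ν' => hP.add_le ν trivial ν' trivial
  have gsmul : ∀ (c : ℝ) ν, gammaNorm h (c • ν) = ENNReal.ofReal |c| * gammaNorm h ν :=
    fun c ν => hP.smul c ν trivial
  have Vadd : ∀ {ν ν'}, ν ∈ V → ν' ∈ V → ν + ν' ∈ V := fun a b => finitePart_add gadd a b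
  have Vsmul : ∀ (c : ℝ) {ν}, ν ∈ V → c • ν ∈ V := fun c ν a => finitePart_smul gsmul c a
  have Vfin : ∀ {ν}, ν ∈ V → gammaNorm h ν < ∞ := fun a => lt_top_of_mem_finitePart gadd gsmul a
  have hnonneg : ∀ ν ∈ V, 0 ≤ quadForm (fun x y => U (y - x) * U (x - y)) ν := fun ν hν => by
    have : 0 ≤ c ^ 2 * quadForm (fun x y => U (y - x) * U (x - y)) ν := by
      rw [(hQ ν hν).2]; exact ENNReal.toReal_nonneg
    exact nonneg_of_mul_nonneg_right this (by positivity)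
  have wfin : ∀ ν ∈ V, weightNorm (sectWeight h) ν ≠ ∞ := fun ν hν =>
    ((weightNorm_mono (sectWeight_le h) ν).trans_lt ((hk.gammaNorm_eq ν) ▸ Vfin hν)).ne
  have hS : ∀ ν ∈ V, sectNorm (fun x y => U (y - x)) ν =
      ENNReal.ofReal c⁻¹ * weightNorm (sectWeight h) ν := by
    intro ν hν
    rw [sectNorm, quadNorm, if_pos (hQ ν hν).1]
    have h1 : quadForm (fun x y => U (y - x) * U (x - y)) ν =
        (c⁻¹ * (weightNorm (sectWeight h) ν).toReal) ^ 2 := by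
      rw [mul_pow, ← ENNReal.toReal_pow, ← (hQ ν hν).2, ← mul_assoc, ← mul_pow,
        inv_mul_cancel₀ hc.ne', one_pow, one_mul]
    rw [h1, Real.sqrt_sq (by positivity), ENNReal.ofReal_mul (by positivity),
      ENNReal.ofReal_toReal (wfin ν hν)]
  -- The lower bound on Re(û(a)û(b)) is a pointwise comparison of the two weights.
  have hle : ∀ ν, gammaNorm h ν ≤
      ENNReal.ofReal r⁻¹ ^ (1 / 2 : ℝ) * weightNorm (sectWeight h) ν := by
    intro ν
    rw [hk.gammaNorm_eq, weightNorm, weightNorm, ← ENNReal.mul_rpow_of_nonneg _ _ (by norm_num),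
      ← lintegral_const_mul' _ _ ENNReal.ofReal_ne_top]
    refine ENNReal.rpow_le_rpow (lintegral_mono fun p => ?_) (by norm_num)
    have hp : ‖h p.1‖ₑ * ‖h p.2‖ₑ ≤ ENNReal.ofReal r⁻¹ * sectWeight h p := by
      change _ ≤ ENNReal.ofReal r⁻¹ * ENNReal.ofReal (h p.1 * h p.2).re
      rw [← ENNReal.ofReal_mul (by positivity), ← enorm_mul, ← ofReal_norm]
      refine ENNReal.ofReal_le_ofReal ?_
      rw [inv_mul_eq_div, le_div_iff₀' hr, norm_mul]
      exact hre _ _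
    rw [← mul_assoc]
    exact mul_le_mul_left hp _
  obtain ⟨D, hD⟩ : ∃ D : ℝ≥0, ∀ ν ∈ V, gammaNorm h ν ≤ D * sectNorm (fun x y => U (y - x)) ν := by
    refine ⟨(r⁻¹).toNNReal ^ (1 / 2 : ℝ) * c.toNNReal, fun ν hν => ?_⟩
    have h1 : (c.toNNReal : ℝ≥0∞) * ENNReal.ofReal c⁻¹ = 1 := by
      change ENNReal.ofReal c * ENNReal.ofReal c⁻¹ = 1
      rw [← ENNReal.ofReal_mul hc.le, mul_inv_cancel₀ hc.ne', ENNReal.ofReal_one]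
    have h2 : ((r⁻¹).toNNReal : ℝ≥0∞) ^ (1 / 2 : ℝ) = ENNReal.ofReal r⁻¹ ^ (1 / 2 : ℝ) := rfl
    rw [hS ν hν, ENNReal.coe_mul, ENNReal.coe_rpow_of_nonneg _ (by norm_num), h2, mul_assoc, ← mul_assoc (c.toNNReal : ℝ≥0∞), h1, one_mul]
    exact hle ν
  refine ⟨fun ν hν => ⟨(hQ ν hν).1, hnonneg ν hν⟩, ⟨⟨fun a ν hν => ?_, fun ν hν ν' hν' => ?_,
    fun n hn ν hν => ?_, ?_⟩, fun ν hν hz => ?_⟩⟩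
  · rw [hS _ (Vsmul a hν), hS ν hν, weightNorm_smul, mul_left_comm]
  · rw [hS _ (Vadd hν hν'), hS ν hν, hS ν' hν', ← mul_add]
    gcongr
    exact weightNorm_add_le (measurable_sectWeight mh) ν ν'
  -- `V` is a linear space, so differences of its elements stay in `V`, where convergence is already
  -- known.
  · refine hP.converges n hn ν fun j => ?_
    obtain ⟨a, ha, b, hb, -, -, -, -, e⟩ := hν j
    rw [e, sub_eq_add_neg_one_smul]
    exact Vadd ha (Vsmul _ hb)
  · obtain ⟨C, hC⟩ := hP.bound
    refine ⟨C * D, fun n hn ν hν hconv => (hC n hn ν (fun _ => trivial) hconv).trans ?_⟩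
    calc (C : ℝ≥0∞) ^ n * ∏ j, gammaNorm h (ν j)
        ≤ (C : ℝ≥0∞) ^ n * ∏ j, (D * sectNorm (fun x y => U (y - x)) (ν j)) := by
          gcongr with j; exact hD _ (hν j)
      _ = _ := by
          rw [Finset.prod_mul_distrib, Finset.prod_const, Finset.card_univ, Fintype.card_fin,
            ENNReal.coe_mul]
          ring
  · refine hP.eq_zero ν trivial ?_
    have := hD ν hν
    rw [hz, mul_zero] at this
    exact le_antisymm this zero_le

/-- In the sector Re(zw) ≥ (1 - C²) Re z Re w and |z||w| ≤ (1 + C²) Re z Re w, whence the ratio.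
Passing to inverses divides Re(zw) by |zw|², because inversion is conjugation up to that factor. -/
theorem re_inv_mul_inv_ge {z w : ℂ} {C : ℝ} (hC : C < 1) (hz0 : 0 < z.re) (hw0 : 0 < w.re)
    (hz : |z.im| ≤ C * z.re) (hw : |w.im| ≤ C * w.re) :
    (1 - C ^ 2) / (1 + C ^ 2) * (‖z⁻¹‖ * ‖w⁻¹‖) ≤ (z⁻¹ * w⁻¹).re := by
  have hC0 : 0 ≤ C := by
    by_contra h
    push Not at h
    have := (abs_nonneg _).trans hz
    nlinarith
  have hn : ∀ {z : ℂ}, 0 < z.re → |z.im| ≤ C * z.re → ‖z‖ ^ 2 ≤ (1 + C ^ 2) * z.re ^ 2 := by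
    intro z h0 h
    rw [← Complex.normSq_eq_norm_sq, Complex.normSq_apply]
    have := sq_le_sq' (by linarith [neg_abs_le z.im, abs_nonneg z.im]) h
    rw [sq_abs] at this
    nlinarith
  have h1 : ‖z‖ * ‖w‖ ≤ (1 + C ^ 2) * (z.re * w.re) := by
    refine abs_le_of_sq_le_sq' ?_ (by positivity) |>.2
    calc (‖z‖ * ‖w‖) ^ 2 = ‖z‖ ^ 2 * ‖w‖ ^ 2 := by ring
      _ ≤ ((1 + C ^ 2) * z.re ^ 2) * ((1 + C ^ 2) * w.re ^ 2) :=
          mul_le_mul (hn hz0 hz) (hn hw0 hw) (by positivity) (by positivity)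
      _ = _ := by ring
  have h2 : (1 - C ^ 2) * (z.re * w.re) ≤ (z * w).re := by
    rw [Complex.mul_re]
    have : z.im * w.im ≤ (C * z.re) * (C * w.re) := by
      calc z.im * w.im ≤ |z.im * w.im| := le_abs_self _
        _ = |z.im| * |w.im| := abs_mul _ _
        _ ≤ _ := mul_le_mul hz hw (abs_nonneg _) (by positivity)
    linarith
  have hC2 : 0 ≤ 1 - C ^ 2 := by nlinarith
  have hz1 : z ≠ 0 := fun h => by simp [h] at hz0
  have hw1 : w ≠ 0 := fun h => by simp [h] at hw0
  have h3 : (1 - C ^ 2) / (1 + C ^ 2) * (‖z‖ * ‖w‖) ≤ (z * w).re := by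
    refine le_trans ?_ h2
    rw [div_mul_eq_mul_div, div_le_iff₀ (by positivity), mul_assoc]
    refine (mul_le_mul_of_nonneg_left h1 hC2).trans_eq (by ring)
  have hN : 0 < ‖z‖ * ‖w‖ := mul_pos (norm_pos_iff.2 hz1) (norm_pos_iff.2 hw1)
  have e : (z⁻¹ * w⁻¹).re = (z * w).re / (‖z‖ * ‖w‖) ^ 2 := by
    rw [← mul_inv, Complex.inv_re, Complex.normSq_eq_norm_sq, norm_mul]
  rw [e, norm_inv, norm_inv, ← mul_inv, le_div_iff₀ (by positivity)]
  refine le_trans (le_of_eq ?_) h3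
  field_simp

end Sectorial

/-! ### The potential in terms of the characteristic exponent -/

section CharExponent

variable {Ω : Type*} [MeasurableSpace Ω] {P : Measure Ω} [IsProbabilityMeasure P] {d : ℕ}
  {Y : ℝ≥0 → Ω → EuclideanSpace ℝ (Fin d)} {ζ : Ω → ℝ} {β : ℝ}
  {q : ℝ → EuclideanSpace ℝ (Fin d) → ℝ≥0∞} (hL : IsKilledLevy Y ζ β P)
  (hp : IsTransitionDensity (killedTrans Y ζ P) volume fun t x y => q t (y - x))
  {κ : EuclideanSpace ℝ (Fin d) → ℂ} (hκ : IsCharExponent Y ζ P κ)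

omit [IsProbabilityMeasure P] in
include hL hp hκ in
theorem fourierFun_eq_exp {t : ℝ} (ht : 0 < t) (ξ : EuclideanSpace ℝ (Fin d)) :
    fourierFun (q t) ξ = Complex.exp (-(t : ℝ) * κ ξ) := by
  lift t to ℝ≥0 using ht.le
  rw [fourierFun_killed_density hL hp (by exact_mod_cast ht), hκ t ξ]

include hL hp hκ in
-- Killing bounds the transform of q_1 by e^{-β}, so that Re κ ≥ β > 0.
theorem charExponent_re_pos (ξ : EuclideanSpace ℝ (Fin d)) : 0 < (κ ξ).re := by
  have h := (isKilledDensity hL hp).norm_fourierFun_le ξ one_pos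
  rw [fourierFun_eq_exp hL hp hκ one_pos, Complex.norm_exp, Real.exp_le_exp] at h
  simp at h
  linarith [hL.rate_pos]

include hL hp hκ in
theorem fourierFun_potential_eq_inv (ξ : EuclideanSpace ℝ (Fin d)) :
    fourierFun (occupation q (Ioi 0)) ξ = (κ ξ)⁻¹ := by
  have hpos := charExponent_re_pos hL hp hκ ξ
  rw [(isKilledDensity hL hp).fourierFun_occupation Subset.rfl,
    setIntegral_congr_fun measurableSet_Ioi fun t ht => fourierFun_eq_exp hL hp hκ ht ξ]
  have e : ∀ t : ℝ, Complex.exp (-(t : ℝ) * κ ξ) = Complex.exp ((-κ ξ) * t) := fun t => by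
    congr 1; ring
  simp only [e]
  rw [integral_exp_mul_complex_Ioi (by simpa using hpos) 0]
  simp [neg_div_neg_eq]

end CharExponent

end ProperNorms
theorem theorem6p1 :
    -- exponentially killed Lévy processes
    (∀ (d : ℕ) (Ω : Type*) [MeasurableSpace Ω] (P : Measure Ω) [IsProbabilityMeasure P]
      (Y : ℝ≥0 → Ω → EuclideanSpace ℝ (Fin d)) (ζ : Ω → ℝ) (β : ℝ)
      (q : ℝ → EuclideanSpace ℝ (Fin d) → ℝ≥0∞)
      (u : EuclideanSpace ℝ (Fin d) → EuclideanSpace ℝ (Fin d) → ℝ≥0∞)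
      (uhat : EuclideanSpace ℝ (Fin d) → ℂ),
      IsKilledLevy Y ζ β P →
      IsTransitionDensity (killedTrans Y ζ P) volume (fun t x y => q t (y - x)) →
      u = potential (fun t x y => q t (y - x)) →
      uhat = fourierFun (fun z => u 0 z) →
      -- the norm `‖ν‖_{γ,2}`
      IsProperNorm univ u (gammaNorm uhat) ∧
      -- its second expression
      (Integrable uhat → ∀ ν : SignedMeasure (EuclideanSpace ℝ (Fin d)),
        gammaNorm uhat ν < ∞ ∧
        (((gammaNorm uhat ν).toReal ^ 2 : ℝ) : ℂ) =
          sint ν fun x => sint ν fun y =>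
            (∫ r, Complex.exp (Complex.I * (inner ℝ (x - y) r : ℝ)) * (‖uhat r‖ : ℂ)) ^ 2) ∧
      -- the norm `‖ν‖_{[2]}`, under the sectorial condition
      (∀ κ : EuclideanSpace ℝ (Fin d) → ℂ, IsCharExponent Y ζ P κ →
        ∀ C : ℝ, C < 1 → (∀ x, |(κ x).im| ≤ C * (κ x).re) →
        (∀ ν ∈ finitePart univ (gammaNorm uhat),
          FormConverges (fun x y => u x y * u y x) ν ∧
          0 ≤ quadForm (fun x y => u x y * u y x) ν) ∧
        IsProperNorm (finitePart univ (gammaNorm uhat)) u (sectNorm u))) ∧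
    -- general state spaces
    (∀ (S Ω : Type*) [TopologicalSpace S] [LocallyCompactSpace S] [T2Space S]
      [SecondCountableTopology S] [MeasurableSpace S] [BorelSpace S] [MeasurableSpace Ω]
      (X : MarkovProcess S Ω) (m : Measure S) [SigmaFinite m] (p : ℝ → S → S → ℝ≥0∞),
      IsTransitionDensity X.trans m p →
      -- the norms `‖ν‖_w` and `‖ν‖_Φ`
      IsProperSeminorm univ (potential p) (wNorm m p) ∧
      IsProperSeminorm univ (potential p) (phiNorm m p) ∧
      (∀ ν : SignedMeasure S, FormConverges (phi m p) ν → 0 ≤ quadForm (phi m p) ν) ∧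
      -- only the zero measure has norm zero, if the process is right continuous and has a right
      -- continuous dual
      (∀ (Ω' : Type*) [MeasurableSpace Ω'] (X' : MarkovProcess S Ω'),
        X.RightContinuous → X'.RightContinuous →
        IsTransitionDensity X'.trans m (fun t x y => p t y x) →
        IsProperNorm univ (potential p) (wNorm m p) ∧
        IsProperNorm univ (potential p) (phiNorm m p))) := by
  refine ⟨fun d Ω _ P _ Y ζ β q u uhat hL hp hu huhat => ?_, fun S Ω _ _ _ _ _ _ _ X m _ p hp =>
    ⟨isProperSeminorm_wNorm hp, isProperSeminorm_phiNorm hp, fun ν h => quadForm_phi_nonneg hp h,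
      fun Ω' _ X' hX hX' hp' =>
        ⟨⟨isProperSeminorm_wNorm hp, fun ν _ h => eq_zero_of_wNorm_eq_zero hp hp' hX hX' h⟩,
          ⟨isProperSeminorm_phiNorm hp, fun ν _ h => eq_zero_of_phiNorm_eq_zero hp hp' hX hX' h⟩⟩⟩⟩
  have hq := isKilledDensity hL hp
  have hu' : u = fun x y => occupation q (Ioi 0) (y - x) := hu
  have hhat : uhat = fourierFun (occupation q (Ioi 0)) := by
    rw [huhat, hu']
    simp only [sub_zero]
  have mh := measurable_fourierFun (hq.measurable_occupation (Ioi 0))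
  subst hu' hhat
  refine ⟨hq.isSmoothing.isProperNorm_gammaNorm hq.fourierFun_potential_ne_zero,
    fun hi ν => ⟨gammaNorm_lt_top mh hi ν, sq_gammaNorm_eq mh hi ν⟩, fun κ hκ C hC hsect => ?_⟩
  have hκ0 := charExponent_re_pos hL hp hκ
  -- Since Re κ(0) > 0, the sector condition at 0 forces C ≥ 0, and C < 1 then gives C² < 1.
  have hC1 : 0 < 1 - C ^ 2 := by
    have hC0 : 0 ≤ C := nonneg_of_mul_nonneg_left ((abs_nonneg _).trans (hsect 0)) (hκ0 0)
    nlinarith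
  refine hq.isSmoothing.isProperNorm_sectNorm hq.fourierFun_potential_ne_zero
    (r := (1 - C ^ 2) / (1 + C ^ 2)) (by positivity) fun a b => ?_
  rw [fourierFun_potential_eq_inv hL hp hκ, fourierFun_potential_eq_inv hL hp hκ]
  exact re_inv_mul_inv_ge hC (hκ0 a) (hκ0 b) (hsect a) (hsect b)
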